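/- **Theorem (time complexity of findmaxr).** *Machine.* Consider a unit-cost random access machine with integer variables, integer arrays (initially $0$) and recursive procedures. Each constant, variable access, array access, addition, subtraction, halving (one-bit shift), comparison and Boolean connective costs one unit, and so does each executed assignment, test of a conditional or loop, and procedure call. Stored integers occupy one cell each. *Problem.* A string $w=w[1..n]$ over a finite ordered alphabet is given, with an integer $ml\ge 1$. A maximal repeat of $w$ is a string that occurs more than once in $w$ and all of whose proper extensions occur fewer times in $w$. *Algorithm.* $\mathbf{findmaxr}(w,ml)$ is the following program. 1. Compute the suffix array $r$ of $w$ (the permutation of $1,\dots,n$ for which $w[r[1]..n],\dots,w[r[n]..n]$ is lexicographically increasing) by the Larsson–Sadakane algorithm: sort and group the suffixes by first symbol; then for $h=1,2,4,\dots$, until every suffix is alone in its group, split each group of suffixes by ternary-split Quicksort, the key of the suffix at $q$ being the current group number of the suffix at $q+h$. The pivots are medians, found by the selection algorithm of Blum, Floyd, Pratt, Rivest and Tarjan. Compute the inverse permutation $p$ of $r$. 2. Compute, by the algorithm of Kasai et al., $LCP[q]$, the length of the longest common prefix of $w[r[q]..n]$ and $w[r[q+1]..n]$, for $1\le q<n$;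 put $LCP[0]=0$. 3. Put $S:=\{u\in[1,n-1]: LCP[u]<ml\}\cup\{0,n\}$. The set $S$ is stored as a complete binary tree of bits whose leaves represent the elements of the universe (their number is rounded up to a power of two), an internal node being $0$ if and only if both its children are. Inserting updates the branch of a leaf. The greatest element less than $i$ is found from the leaf $i$ by repeatedly moving to the left neighbour in the level (from a left child) or to the parent (from a right child) until a node with bit $1$ is reached, and then descending to the rightmost leaf with bit $1$ below it; the least element greater than $i$ is found symmetrically. 4. Compute by counting sort the permutation $I$ of $[0,n-1]$ that orders the indices by non-decreasing $LCP$, and increasingly in case of ties; let $\mathit{initial}$ be the least $t<n$ with $LCP[I[t]]\ge ml$ (and $n$ if there is none). 5. For $t=\mathit{initial},\dots,n-1$: let $i:=I[t]$, $p_i:=\max\{j\in S: j<i\}+1$, $n_i:=\min\{j\in S: j>i\}$, and insert $i$ into $S$. If ($p_i=1$ or $LCP[p_i-1]\ne LCP[i]$) and ($n_i=n$ or $LCP[n_i]\ne LCP[i]$), and moreover $r[p_i]=1$ or $r[n_i]=1$ or $w[r[p_i]-1]\ne w[r[n_i]-1]$ or $p[r[n_i]-1]-p[r[p_i]-1]\ne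 n_i-p_i$, then report the maximal repeat $w[r[i]..r[i]+LCP[i]-1]$ and its $n_i-p_i+1$ occurrences $r[p_i],\dots,r[n_i]$, by means of the three integers $p_i$, $LCP[i]$, $n_i-p_i+1$. The *memory-saving variant* of findmaxr differs as follows. In step 4, counting sort yields the inverse of $I$, which is then inverted in place (using signs as auxiliary bits). Step 5 does not use $LCP$. It keeps a number $curLCP$, initially $0$, and for each $i=I[t]$ increases it by one as long as the suffixes at $r[i]$ and $r[i+1]$ both have a symbol at offset $curLCP$ and these symbols agree. It uses $curLCP$ in place of $LCP[i]$ in the reports, and replaces the first of the two conditions by: $p_i=1$, or $p_i-1$ is not the index treated in the previous iteration, or $curLCP$ differs from its value in the previous iteration. *Claim.* Findmaxr, and likewise its memory-saving variant, halts on every input and takes time $O(n\log n)$: there is a constant $C$, independent of the alphabet, of $w$ and of $ml$, such that it takes at most $C\,n\log n$ units of time on every string $w$ of length $n\ge 2$ and every integer $ml\ge 1$. -/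

import Mathlib

namespace FindMaxR

/-! ### A unit-cost random access machine

The machine has integer variables, integer arrays and recursive procedures.  Additions,
subtractions, halvings (one-bit shifts), comparisons, Boolean connectives, variable accesses, array
accesses and constants cost one unit each, and so does every command in addition to the expressions
and commands that it evaluates.  There are no multiplications. -/

/-- Names of the integer variables.  They are local to an activation of a procedure. -/
inductive Var
  | n | ml | h | lo | hi | k | i | j | v | a | b | e | x | u | sl | size | t
  | pi | ni | count | curLCP | lastLCP | lasti | res | dummy
  deriving DecidableEq

/-- Names of the arrays.  They are global, so that they can be shared by all procedures. -/
inductive Arr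
  /-- the input string: symbols in the cells `1, …, n`, the terminator `0` elsewhere -/
  | w
  /-- the sorted suffixes during suffix sorting, in the cells `0, …, n`; the suffix that starts at
  position `n + 1` is the empty one -/
  | sfx
  /-- `V[q]` is the number of the group of the suffix that starts at `q`, that is, the last cell
  of `sfx` that is occupied by this group -/
  | V
  /-- `len[q]` is the length of the unsorted group of `sfx` that starts in cell `q`, or the negated
  length of the combined sorted group that starts there -/
  | len
  /-- work space for the selection of medians -/
  | M
  /-- the suffix array, in the cells `1, …, n` -/
  | r
  /-- the inverse permutation of `r` -/
  | p
  /-- `LCP[q]` belongs to the suffixes that start at `r[q]` and `r[q + 1]`, `1 ≤ q < n`;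
  `LCP[0]` keeps the value `0` -/
  | LCP
  /-- the binary tree of bits that represents the set `S` -/
  | S
  /-- work space for counting -/
  | cnt
  /-- the permutation that puts the values of `LCP` in non-decreasing order -/
  | I
  /-- the output: the `c`-th report is the triple `outStart[c]`, `outLen[c]`, `outOcc[c]`; it stands
  for the prefix of length `outLen[c]` of the suffix at position `r[outStart[c]]`, whose
  `outOcc[c]` occurrences are listed in `r` from the cell `outStart[c]` on -/
  | outStart | outLen | outOcc
  deriving DecidableEq

/-- Names of the procedures. -/
inductive Proc
  | insertionSort | select | updateGroup | sortSplit | suffixSort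
  | suffixArray | lcpArray | insert | maxLess | minGreater

/-- Integer expressions. -/
inductive Expr
  | const (c : ℤ)
  | var (y : Var)
  | get (A : Arr) (e : Expr)
  | add (e f : Expr)
  | sub (e f : Expr)
  | half (e : Expr)

/-- Boolean expressions. -/
inductive BExpr
  | lt (e f : Expr)
  | le (e f : Expr)
  | eq (e f : Expr)
  | ne (e f : Expr)
  | and (b c : BExpr)
  | or (b c : BExpr)

/-- Commands. -/
inductive Cmd
  | skip
  | assign (y : Var) (e : Expr)
  | store (A : Arr) (e f : Expr)
  | seq (c d : Cmd)
  | ite (b : BExpr) (c d : Cmd)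
  | while (b : BExpr) (c : Cmd)
  | call (y : Var) (f : Proc) (args : List Expr)

/-- A state of the machine: the variables of the current activation, and the arrays. -/
structure State where
  loc : Var → ℤ
  mem : Arr → ℤ → ℤ

/-- The value of an integer expression. -/
def Expr.eval (s : State) : Expr → ℤ
  | .const c => c
  | .var y => s.loc y
  | .get A e => s.mem A (e.eval s)
  | .add e f => e.eval s + f.eval s
  | .sub e f => e.eval s - f.eval s
  | .half e => e.eval s / 2

/-- The cost of an integer expression. -/
def Expr.cost : Expr → ℕ
  | .const _ => 1
  | .var _ => 1
  | .get _ e => e.cost + 1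
  | .add e f => e.cost + f.cost + 1
  | .sub e f => e.cost + f.cost + 1
  | .half e => e.cost + 1

/-- The truth value of a Boolean expression. -/
def BExpr.eval (s : State) : BExpr → Prop
  | .lt e f => e.eval s < f.eval s
  | .le e f => e.eval s ≤ f.eval s
  | .eq e f => e.eval s = f.eval s
  | .ne e f => e.eval s ≠ f.eval s
  | .and b c => b.eval s ∧ c.eval s
  | .or b c => b.eval s ∨ c.eval s

/-- The cost of a Boolean expression; both sides of a connective are always evaluated. -/
def BExpr.cost : BExpr → ℕ
  | .lt e f => e.cost + f.cost + 1
  | .le e f => e.cost + f.cost + 1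
  | .eq e f => e.cost + f.cost + 1
  | .ne e f => e.cost + f.cost + 1
  | .and b c => b.cost + c.cost + 1
  | .or b c => b.cost + c.cost + 1

/-- The state after `y := z`. -/
def State.setVar (s : State) (y : Var) (z : ℤ) : State :=
  { s with loc := Function.update s.loc y z }

/-- The state after `A[q] := z`. -/
def State.setCell (s : State) (A : Arr) (q z : ℤ) : State :=
  { s with mem := Function.update s.mem A (Function.update (s.mem A) q z) }

/-- The variables at the start of an activation: the parameters hold the arguments, all other
variables are `0`. -/
def frame : List Var → List ℤ → Var → ℤ
  | y :: ys, z :: zs => Function.update (frame ys zs) y z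
  | _, _ => fun _ => 0

/-- A program: the parameters and the body of every procedure. -/
abbrev Program := Proc → List Var × Cmd

/-- `Exec P c s t s'`: with the procedures of `P`, the command `c` started in the state `s` halts
after exactly `t` units of time, in the state `s'`.  A procedure returns the value of its variable
`res`. -/
inductive Exec (P : Program) : Cmd → State → ℕ → State → Prop
  | skip (s : State) : Exec P .skip s 1 s
  | assign (s : State) (y : Var) (e : Expr) :
      Exec P (.assign y e) s (e.cost + 1) (s.setVar y (e.eval s))
  | store (s : State) (A : Arr) (e f : Expr) :
      Exec P (.store A e f) s (e.cost + f.cost + 1) (s.setCell A (e.eval s) (f.eval s))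
  | seq {c d : Cmd} {s₁ s₂ s₃ : State} {t₁ t₂ : ℕ} :
      Exec P c s₁ t₁ s₂ → Exec P d s₂ t₂ s₃ → Exec P (.seq c d) s₁ (t₁ + t₂) s₃
  | iteTrue {b : BExpr} {c d : Cmd} {s s' : State} {t : ℕ} :
      b.eval s → Exec P c s t s' → Exec P (.ite b c d) s (b.cost + 1 + t) s'
  | iteFalse {b : BExpr} {c d : Cmd} {s s' : State} {t : ℕ} :
      ¬ b.eval s → Exec P d s t s' → Exec P (.ite b c d) s (b.cost + 1 + t) s'
  | whileTrue {b : BExpr} {c : Cmd} {s₁ s₂ s₃ : State} {t₁ t₂ : ℕ} :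
      b.eval s₁ → Exec P c s₁ t₁ s₂ → Exec P (.while b c) s₂ t₂ s₃ →
      Exec P (.while b c) s₁ (b.cost + 1 + t₁ + t₂) s₃
  | whileFalse {b : BExpr} {c : Cmd} {s : State} :
      ¬ b.eval s → Exec P (.while b c) s (b.cost + 1) s
  | call {y : Var} {f : Proc} {args : List Expr} {s s' : State} {t : ℕ} :
      Exec P (P f).2 ⟨frame (P f).1 (args.map (Expr.eval s)), s.mem⟩ t s' →
      Exec P (.call y f args) s ((args.map Expr.cost).sum + 1 + t)
        ⟨Function.update s.loc y (s'.loc .res), s'.mem⟩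

/-! ### Notation for programs -/

instance (c : ℕ) : OfNat Expr c := ⟨.const c⟩
instance : Coe Var Expr := ⟨.var⟩
instance : Add Expr := ⟨.add⟩
instance : Sub Expr := ⟨.sub⟩
instance : Neg Expr := ⟨fun e => .sub 0 e⟩
/-- `A e` is the content of the cell `e` of the array `A`. -/
instance : CoeFun Arr (fun _ => Expr → Expr) := ⟨.get⟩

local infixr:30 " ;; " => Cmd.seq
local infix:40 " ≔ " => Cmd.assign
local infix:50 " <ᵉ " => BExpr.lt
local infix:50 " ≤ᵉ " => BExpr.le
local infix:50 " =ᵉ " => BExpr.eq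
local infix:50 " ≠ᵉ " => BExpr.ne
local infixr:45 " ∧ᵉ " => BExpr.and
local infixr:43 " ∨ᵉ " => BExpr.or

section Programs
open Var Arr Cmd FindMaxR.Expr

/-- Call a procedure that returns nothing. -/
def run (f : Proc) (args : List Expr) : Cmd := call dummy f args

/-- A conditional without an alternative. -/
def when (b : BExpr) (c : Cmd) : Cmd := ite b c skip

/-- Exchange `A[q]` and `A[q']`. -/
def swap (A : Arr) (q q' : Expr) : Cmd :=
  x ≔ A q ;;
  store A q (A q') ;;
  store A q' x

/-! ### Suffix sorting by the method of Larsson and Sadakane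

Groups of suffixes that agree on their first `h` symbols are split by ternary-split Quicksort, the
key of the suffix `q` being `V[q + h]`; then `h` is doubled.  The pivot is the median of the keys,
which is found by the linear-time selection of Blum, Floyd, Pratt, Rivest and Tarjan. -/

/-- Ternary split of `A[lo..hi]` with the pivot `v`, with respect to the keys `key (A[q])`.
Afterwards the keys in `A[lo..a-1]` are less than `v`, those in `A[a..b]` are equal to `v`, and
those in `A[b+1..hi]` are greater than `v`. -/
def partition (A : Arr) (key : Expr → Expr) : Cmd :=
  a ≔ lo ;;
  i ≔ lo ;;
  b ≔ hi ;;
  Cmd.while (i ≤ᵉ b) (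
    ite (key (A i) <ᵉ v) (
      swap A a i ;;
      a ≔ a + 1 ;;
      i ≔ i + 1
    ) (ite (v <ᵉ key (A i)) (
      swap A i b ;;
      b ≔ b - 1
    ) (
      i ≔ i + 1)))

/-- `insertionSort(lo, hi)`: sort `M[lo..hi]`. -/
def insertionSortBody : Cmd :=
  i ≔ lo + 1 ;;
  Cmd.while (i ≤ᵉ hi) (
    x ≔ M i ;;
    j ≔ i - 1 ;;
    Cmd.while (lo ≤ᵉ j ∧ᵉ x <ᵉ M j) (
      store M (j + 1) (M j) ;;
      j ≔ j - 1) ;;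
    store M (j + 1) x ;;
    i ≔ i + 1)

/-- `select(lo, hi, k)`: the `k`-th smallest value, counted from `0`, in `M[lo..hi]`.  Rearranges
`M[lo..hi]` and uses the cells to the right of `M[hi]` as work space. -/
def selectBody : Cmd :=
  ite (hi - lo <ᵉ 140) (
    run .insertionSort [lo, hi] ;;
    res ≔ M (lo + k)
  ) (
    -- store the medians of blocks of five values to the right of `M[hi]`
    i ≔ lo ;;
    j ≔ hi + 1 ;;
    Cmd.while (i ≤ᵉ hi) (
      e ≔ i + 4 ;;
      when (hi <ᵉ e) (e ≔ hi) ;;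
      run .insertionSort [i, e] ;;
      store M j (M (half (i + e))) ;;
      j ≔ j + 1 ;;
      i ≔ e + 1) ;;
    -- split by the median of these medians
    call v .select [hi + 1, j - 1, half (j - 1 - (hi + 1))] ;;
    partition M (fun y => y) ;;
    ite (k <ᵉ a - lo) (
      call res .select [lo, a - 1, k]
    ) (ite (k ≤ᵉ b - lo) (
      res ≔ v
    ) (
      call res .select [b + 1, hi, k - (b + 1 - lo)])))

/-- `updateGroup(lo, hi)`: make `sfx[lo..hi]` a group; it is sorted if it has one element. -/
def updateGroupBody : Cmd :=
  i ≔ lo ;;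
  Cmd.while (i ≤ᵉ hi) (
    store V (sfx i) hi ;;
    i ≔ i + 1) ;;
  ite (lo =ᵉ hi) (
    store len lo (-1)
  ) (
    store len lo (hi - lo + 1))

/-- `sortSplit(lo, hi, h)`: sort `sfx[lo..hi]` by the keys `V[q + h]` and split it into groups of
suffixes with equal keys. -/
def sortSplitBody : Cmd :=
  i ≔ lo ;;
  Cmd.while (i ≤ᵉ hi) (
    store M (i - lo) (V (sfx i + h)) ;;
    i ≔ i + 1) ;;
  call v .select [0, hi - lo, half (hi - lo)] ;;
  partition sfx (fun y => V (y + h)) ;;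
  when (lo <ᵉ a) (run .sortSplit [lo, a - 1, h]) ;;
  run .updateGroup [a, b] ;;
  when (b <ᵉ hi) (run .sortSplit [b + 1, hi, h])

/-- `suffixSort(n)`: sort the suffixes that start at `1, …, n + 1` into `sfx[0..n]`. -/
def suffixSortBody : Cmd :=
  -- sort and group the suffixes by their first symbols
  i ≔ 0 ;;
  Cmd.while (i ≤ᵉ n) (
    store sfx i (i + 1) ;;
    store V (i + 1) (w (i + 1)) ;;
    i ≔ i + 1) ;;
  run .sortSplit [0, n, 0] ;;
  h ≔ 1 ;;
  -- until there is a single combined sorted group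
  Cmd.while (len 0 ≠ᵉ -(n + 1)) (
    i ≔ 0 ;;
    sl ≔ 0 ;;
    Cmd.while (i ≤ᵉ n) (
      ite (len i <ᵉ 0) (
        -- skip a sorted group; `sl` is the total length of the sorted groups just skipped
        sl ≔ sl - len i ;;
        i ≔ i - len i
      ) (
        when (0 <ᵉ sl) (
          store len (i - sl) (-sl) ;;
          sl ≔ 0) ;;
        j ≔ V (sfx i) ;;
        run .sortSplit [i, j, h] ;;
        i ≔ j + 1)) ;;
    when (0 <ᵉ sl) (store len (i - sl) (-sl)) ;;
    h ≔ h + h)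

/-- `suffixArray(n)`: compute the suffix array `r` and its inverse permutation `p`. -/
def suffixArrayBody : Cmd :=
  run .suffixSort [n] ;;
  i ≔ 1 ;;
  Cmd.while (i ≤ᵉ n) (
    store r i (sfx i) ;;
    store p (r i) i ;;
    i ≔ i + 1)

/-! ### The array of longest common prefixes, by the method of Kasai et al. -/

/-- `lcpArray(n)`: compute `LCP[1..n-1]` from `r` and `p`. -/
def lcpArrayBody : Cmd :=
  i ≔ 1 ;;
  h ≔ 0 ;;
  Cmd.while (i ≤ᵉ n) (
    ite (p i <ᵉ n) (
      j ≔ r (p i + 1) ;;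
      Cmd.while (i + h ≤ᵉ n ∧ᵉ j + h ≤ᵉ n ∧ᵉ w (i + h) =ᵉ w (j + h)) (
        h ≔ h + 1) ;;
      store LCP (p i) h ;;
      when (0 <ᵉ h) (h ≔ h - 1)
    ) (
      h ≔ 0) ;;
    i ≔ i + 1)

/-! ### The set `S` as a binary tree of bits

The root is node `1`, the children of node `t` are `2t` (left) and `2t + 1` (right), and the
element `q` of the universe is the leaf `size + q`, where `size` is a power of two.  A node holds
`1` if some leaf below it does, and `0` otherwise. -/

/-- `insert(size, i)`: insert `i` into `S`. -/
def insertBody : Cmd :=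
  t ≔ size + i ;;
  Cmd.while (1 ≤ᵉ t) (
    store S t 1 ;;
    t ≔ half t)

/-- One upward step of the search for the greatest element less than a given one. -/
def stepLeft : Cmd :=
  ite (half t + half t =ᵉ t) (t ≔ t - 1) (t ≔ half t)

/-- `maxLess(size, i)`: the greatest element of `S` that is less than `i`. -/
def maxLessBody : Cmd :=
  t ≔ size + i ;;
  stepLeft ;;
  Cmd.while (S t =ᵉ 0) stepLeft ;;
  Cmd.while (t <ᵉ size) (
    ite (S (t + t + 1) =ᵉ 1) (t ≔ t + t + 1) (t ≔ t + t)) ;;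
  res ≔ t - size

/-- One upward step of the search for the least element greater than a given one. -/
def stepRight : Cmd :=
  ite (half t + half t =ᵉ t) (t ≔ half t) (t ≔ t + 1)

/-- `minGreater(size, i)`: the least element of `S` that is greater than `i`. -/
def minGreaterBody : Cmd :=
  t ≔ size + i ;;
  stepRight ;;
  Cmd.while (S t =ᵉ 0) stepRight ;;
  Cmd.while (t <ᵉ size) (
    ite (S (t + t) =ᵉ 1) (t ≔ t + t) (t ≔ t + t + 1)) ;;
  res ≔ t - size

/-! ### The algorithm -/

/-- All procedures. -/
def procs : Program
  | .insertionSort => ([lo, hi], insertionSortBody)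
  | .select => ([lo, hi, k], selectBody)
  | .updateGroup => ([lo, hi], updateGroupBody)
  | .sortSplit => ([lo, hi, h], sortSplitBody)
  | .suffixSort => ([n], suffixSortBody)
  | .suffixArray => ([n], suffixArrayBody)
  | .lcpArray => ([n], lcpArrayBody)
  | .insert => ([size, i], insertBody)
  | .maxLess => ([size, i], maxLessBody)
  | .minGreater => ([size, i], minGreaterBody)

/-- `S := {u : LCP[u] < ml} ∪ {0, n}`. -/
def initS : Cmd :=
  size ≔ 1 ;;
  Cmd.while (size <ᵉ n + 2) (size ≔ size + size) ;;
  run .insert [size, 0] ;;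
  run .insert [size, n] ;;
  u ≔ 1 ;;
  Cmd.while (u <ᵉ n) (
    when (LCP u <ᵉ ml) (run .insert [size, u]) ;;
    u ≔ u + 1)

/-- `cnt[q] :=` the number of indices `u` in `[0, n-1]` with `LCP[u] < q`, for `0 ≤ q ≤ n`. -/
def countLCP : Cmd :=
  u ≔ 0 ;;
  Cmd.while (u <ᵉ n) (
    store cnt (LCP u + 1) (cnt (LCP u + 1) + 1) ;;
    u ≔ u + 1) ;;
  u ≔ 1 ;;
  Cmd.while (u ≤ᵉ n) (
    store cnt u (cnt u + cnt (u - 1)) ;;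
    u ≔ u + 1)

/-- `I[0..n-1] :=` the permutation of `[0, n-1]` that orders the indices by non-decreasing `LCP`, and
increasingly in case of ties. -/
def sortLCP : Cmd :=
  countLCP ;;
  u ≔ 0 ;;
  Cmd.while (u <ᵉ n) (
    store I (cnt (LCP u)) u ;;
    store cnt (LCP u) (cnt (LCP u) + 1) ;;
    u ≔ u + 1)

/-- Report the substring of length `l` that occurs at the positions `r[pi..ni]`. -/
def report (l : Expr) : Cmd :=
  store outStart count pi ;;
  store outLen count l ;;
  store outOcc count (ni - pi + 1) ;;
  count ≔ count + 1

/-- The test for maximality to the left of the substring that occurs at `r[pi..ni]`. -/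
def leftMaximal : BExpr :=
  r pi =ᵉ 1 ∨ᵉ r ni =ᵉ 1 ∨ᵉ w (r pi - 1) ≠ᵉ w (r ni - 1) ∨ᵉ
    p (r ni - 1) - p (r pi - 1) ≠ᵉ ni - pi

/-- The two queries on `S` for the index `i`, and the insertion of `i` into `S`. -/
def updateS : Cmd :=
  call pi .maxLess [size, i] ;;
  pi ≔ pi + 1 ;;
  call ni .minGreater [size, i] ;;
  run .insert [size, i]

/-- The algorithm findmaxr, with the length `n` of the input and the parameter `ml` as variables. -/
def findmaxr : Cmd :=
  run .suffixArray [n] ;;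
  run .lcpArray [n] ;;
  initS ;;
  sortLCP ;;
  -- the initial value of `t`
  t ≔ 0 ;;
  Cmd.while (t <ᵉ n ∧ᵉ LCP (I t) <ᵉ ml) (t ≔ t + 1) ;;
  -- the main loop
  Cmd.while (t <ᵉ n) (
    i ≔ I t ;;
    updateS ;;
    when ((pi =ᵉ 1 ∨ᵉ LCP (pi - 1) ≠ᵉ LCP i) ∧ᵉ (ni =ᵉ n ∨ᵉ LCP ni ≠ᵉ LCP i)) (
      when leftMaximal (
        report (LCP i))) ;;
    t ≔ t + 1)

/-! ### The variant that does not use `LCP` in the main loop -/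

/-- `I[u+1] :=` the place, counted from `1`, of `u` in the order of `[0, n-1]` by non-decreasing
`LCP`, with ties in increasing order. -/
def rankLCP : Cmd :=
  countLCP ;;
  u ≔ 0 ;;
  Cmd.while (u <ᵉ n) (
    store I (u + 1) (cnt (LCP u) + 1) ;;
    store cnt (LCP u) (cnt (LCP u) + 1) ;;
    u ≔ u + 1)

/-- Invert the permutation `I[1..n]` of `[1, n]` in place.  The signs serve as auxiliary bits. -/
def invertInPlace : Cmd :=
  k ≔ n ;;
  j ≔ -1 ;;
  Cmd.while (0 <ᵉ k) (
    x ≔ k ;;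
    i ≔ I x ;;
    when (0 <ᵉ i) (
      Cmd.while (0 <ᵉ i) (
        store I x j ;;
        j ≔ -x ;;
        x ≔ i ;;
        i ≔ I x) ;;
      i ≔ j) ;;
    store I x (-i) ;;
    k ≔ k - 1)

/-- The memory-saving variant of findmaxr.  The permutation that orders the indices is
`I[t + 1] - 1`, `0 ≤ t < n`. -/
def findmaxrMem : Cmd :=
  run .suffixArray [n] ;;
  run .lcpArray [n] ;;
  initS ;;
  rankLCP ;;
  t ≔ 0 ;;
  invertInPlace ;;
  Cmd.while (t <ᵉ n ∧ᵉ LCP (I (t + 1) - 1) <ᵉ ml) (t ≔ t + 1) ;;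
  lasti ≔ -1 ;;
  lastLCP ≔ 0 ;;
  curLCP ≔ 0 ;;
  Cmd.while (t <ᵉ n) (
    i ≔ I (t + 1) - 1 ;;
    Cmd.while (r i + curLCP ≤ᵉ n ∧ᵉ r (i + 1) + curLCP ≤ᵉ n ∧ᵉ
        w (r i + curLCP) =ᵉ w (r (i + 1) + curLCP)) (
      curLCP ≔ curLCP + 1) ;;
    updateS ;;
    when (pi =ᵉ 1 ∨ᵉ lasti ≠ᵉ pi - 1 ∨ᵉ lastLCP ≠ᵉ curLCP) (
      when leftMaximal (
        report curLCP)) ;;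
    lastLCP ≔ curLCP ;;
    lasti ≔ i ;;
    t ≔ t + 1)

end Programs

/-- The initial state for the string `w` over the alphabet `{0, …, σ - 1}` and the least length
`ml`.  The symbol `c` is stored as `c + 1`; all cells and variables that do not belong to the input
are `0`. -/
def input {σ : ℕ} (w : List (Fin σ)) (ml : ℕ) : State where
  loc := frame [.n, .ml] [w.length, ml]
  mem := fun A q =>
    match A with
    | .w => if 1 ≤ q then ((w[(q - 1).toNat]?).elim 0 fun c => (c : ℤ) + 1) else 0
    | _ => 0

end FindMaxR

namespace FindMaxR

/-! ### Variables and arrays that a command can change -/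

/-! Every loop is run on a budget: an invariant names an integer that pays for the current round and
for all later ones. As each round costs something, a budget bounds the time and proves halting at
once (`wp_while_amortized`). The rest is a choice of budgets, most of them amortized.

Suffix sorting is the heart. Selection by medians of medians is linear (`select_spec`): the
recursive calls concern about `1/5` and at most about `7/10` of the input. Give an unsorted group of
`m` suffixes the potential `m log m`. Splitting at the median key leaves at most half of the group
on either side, and a part of at most half the size has a logarithm smaller by at least one
(`add_pot_le`). So the drop in potential pays for the recursive calls, and only a linear term
remains (`sortSplit_spec`). A pass over all groups costs `O(n)` beyond the potential that it
consumes (`suffixPass_spec`). There are `O(log n)` passes: suffixes with the same group number agree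
on their first `h` symbols, each pass doubles `h`, and distinct suffixes cannot agree beyond the
terminator (`Terminated.add_le`). The delicate point is that group numbers change while they serve
as keys. `Isolated` and `refines_of_split` show that such changes only refine the grouping, so
different old keys are still separated.

The computation of `LCP` is linear because `i + h` never exceeds `n + 1` and falls only at the one
possible reset of `h` (`lcpArray_spec`). In the tree of bits a search makes at most about two steps
per level on its way up and one on its way down; it halts because the bit at the root is set
(`insert_spec`, `maxLess_spec`, `minGreater_spec`). The main loop has at most `n` rounds of cost
`O(log n)`. In the variant, `curLCP` only grows, so all symbol comparisons together are linear in
number. The inversion in place is linear because each step along a cycle removes a positive cell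
(`invertInPlace_spec`).

Only what time and halting require is proved about the values. It is not shown that the suffix array
is sorted, that `LCP` holds common prefixes, or that queries on `S` return the right elements. It
suffices that `r` and `p` come from an enumeration of the suffixes, that `LCP` takes values in `[0,
n - 1]`, and that the indices used as leaves stay in range. The variant also needs the ranks to form
a permutation, since its inversion follows cycles. -/

/-- Does the command assign a value to the variable? -/
def Cmd.writesVar : Cmd → Var → Bool
  | .skip, _ => false
  | .assign y _, z => decide (z = y)
  | .store _ _ _, _ => false
  | .seq c d, z => c.writesVar z || d.writesVar z
  | .ite _ c d, z => c.writesVar z || d.writesVar z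
  | .while _ c, z => c.writesVar z
  | .call y _ _, z => decide (z = y)

/-- The arrays that a procedure changes, directly or through the procedures that it calls. -/
def Proc.writesArr : Proc → Arr → Bool
  | .insertionSort, A => decide (A = .M)
  | .select, A => decide (A = .M)
  | .updateGroup, A => decide (A = .V) || decide (A = .len)
  | .sortSplit, A => decide (A = .V) || decide (A = .len) || decide (A = .sfx) || decide (A = .M)
  | .suffixSort, A => decide (A = .V) || decide (A = .len) || decide (A = .sfx) || decide (A = .M)
  | .suffixArray, A => decide (A = .V) || decide (A = .len) || decide (A = .sfx) ||
      decide (A = .M) || decide (A = .r) || decide (A = .p)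
  | .lcpArray, A => decide (A = .LCP)
  | .insert, A => decide (A = .S)
  | .maxLess, _ => false
  | .minGreater, _ => false

/-- Can the command change the array? -/
def Cmd.writesArr : Cmd → Arr → Bool
  | .skip, _ => false
  | .assign _ _, _ => false
  | .store A _ _, B => decide (B = A)
  | .seq c d, B => c.writesArr B || d.writesArr B
  | .ite _ c d, B => c.writesArr B || d.writesArr B
  | .while _ c, B => c.writesArr B
  | .call _ f _, B => f.writesArr B

/-- Procedures may be recursive, so the arrays that they change are declared in a table. That every
body respects the table is what the case of a call in `Exec.frame` needs. -/
theorem Proc.writesArr_of_body (f : Proc) (A : Arr) (h : f.writesArr A = false) :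
    (procs f).2.writesArr A = false := by
  cases f <;> cases A <;> first | rfl | (exact absurd h (by decide))

/-- `s'` differs from `s` only in variables and arrays that `c` can change. -/
structure Frame (c : Cmd) (s s' : State) : Prop where
  loc : ∀ y, c.writesVar y = false → s'.loc y = s.loc y
  mem : ∀ A, c.writesArr A = false → s'.mem A = s.mem A

theorem Frame.refl (c : Cmd) (s : State) : Frame c s s := ⟨fun _ _ => rfl, fun _ _ => rfl⟩

theorem Frame.trans {c : Cmd} {s₁ s₂ s₃ : State} (h₁ : Frame c s₁ s₂) (h₂ : Frame c s₂ s₃) :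
    Frame c s₁ s₃ :=
  ⟨fun y hy => (h₂.loc y hy).trans (h₁.loc y hy), fun A hA => (h₂.mem A hA).trans (h₁.mem A hA)⟩

/-- Variables and arrays that a command does not mention as targets keep their values. This carries
parameters and untouched arrays across loops and calls, with `rfl` as the proof that nothing writes
to them. -/
theorem Exec.frame {c : Cmd} {s s' : State} {t : ℕ} (h : Exec procs c s t s') : Frame c s s' := by
  induction h with
  | skip s => exact Frame.refl _ _
  | assign s y e =>
    refine ⟨fun z hz => ?_, fun _ _ => rfl⟩
    have : z ≠ y := by simpa [Cmd.writesVar] using hz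
    simp [State.setVar, this]
  | store s A e f =>
    refine ⟨fun _ _ => rfl, fun B hB => ?_⟩
    have : B ≠ A := by simpa [Cmd.writesArr] using hB
    simp [State.setCell, this]
  | seq _ _ ih₁ ih₂ =>
    refine ⟨fun z hz => ?_, fun B hB => ?_⟩
    · simp only [Cmd.writesVar, Bool.or_eq_false_iff] at hz
      exact (ih₂.loc z hz.2).trans (ih₁.loc z hz.1)
    · simp only [Cmd.writesArr, Bool.or_eq_false_iff] at hB
      exact (ih₂.mem B hB.2).trans (ih₁.mem B hB.1)
  | iteTrue _ _ ih =>
    refine ⟨fun z hz => ?_, fun B hB => ?_⟩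
    · simp only [Cmd.writesVar, Bool.or_eq_false_iff] at hz
      exact ih.loc z hz.1
    · simp only [Cmd.writesArr, Bool.or_eq_false_iff] at hB
      exact ih.mem B hB.1
  | iteFalse _ _ ih =>
    refine ⟨fun z hz => ?_, fun B hB => ?_⟩
    · simp only [Cmd.writesVar, Bool.or_eq_false_iff] at hz
      exact ih.loc z hz.2
    · simp only [Cmd.writesArr, Bool.or_eq_false_iff] at hB
      exact ih.mem B hB.2
  | whileTrue _ _ _ ih₁ ih₂ =>
    exact ⟨fun z hz => (ih₂.loc z hz).trans (ih₁.loc z hz),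
      fun B hB => (ih₂.mem B hB).trans (ih₁.mem B hB)⟩
  | whileFalse _ => exact Frame.refl _ _
  | call _ ih =>
    refine ⟨fun z hz => ?_, fun B hB => ?_⟩
    · rename_i y f args s s' t _
      have : z ≠ y := by simpa [Cmd.writesVar] using hz
      simp [this]
    · exact ih.mem B (Proc.writesArr_of_body _ _ hB)

/-! ### Weakest preconditions with time -/

/-- The command halts when it is started in `s`, after a time and in a state that satisfy `Q`. -/
def wp (c : Cmd) (s : State) (Q : ℕ → State → Prop) : Prop :=
  ∃ t s', Exec procs c s t s' ∧ Q t s'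

/-- The continuation also receives `Frame c s s'`, so that postconditions need to describe only what
changes. -/
theorem wp.mono {c : Cmd} {s : State} {Q Q' : ℕ → State → Prop} (h : wp c s Q)
    (hQ : ∀ t s', Frame c s s' → Q t s' → Q' t s') : wp c s Q' := by
  obtain ⟨t, s', he, hq⟩ := h
  exact ⟨t, s', he, hQ t s' he.frame hq⟩

@[simp] theorem wp_skip {s : State} {Q : ℕ → State → Prop} : wp .skip s Q ↔ Q 1 s := by
  constructor
  · rintro ⟨t, s', he, hq⟩
    cases he
    exact hq
  · exact fun h => ⟨_, _, .skip s, h⟩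

@[simp] theorem wp_assign {y : Var} {e : Expr} {s : State} {Q : ℕ → State → Prop} :
    wp (.assign y e) s Q ↔ Q (e.cost + 1) (s.setVar y (e.eval s)) := by
  constructor
  · rintro ⟨t, s', he, hq⟩
    cases he
    exact hq
  · exact fun h => ⟨_, _, .assign s y e, h⟩

@[simp] theorem wp_store {A : Arr} {e f : Expr} {s : State} {Q : ℕ → State → Prop} :
    wp (.store A e f) s Q ↔
      Q (e.cost + f.cost + 1) (s.setCell A (e.eval s) (f.eval s)) := by
  constructor
  · rintro ⟨t, s', he, hq⟩
    cases he
    exact hq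
  · exact fun h => ⟨_, _, .store s A e f, h⟩

@[simp] theorem wp_seq {c d : Cmd} {s : State} {Q : ℕ → State → Prop} :
    wp (.seq c d) s Q ↔ wp c s (fun t₁ s₁ => wp d s₁ (fun t₂ s₂ => Q (t₁ + t₂) s₂)) := by
  constructor
  · rintro ⟨t, s', he, hq⟩
    cases he with
    | seq h₁ h₂ => exact ⟨_, _, h₁, _, _, h₂, hq⟩
  · rintro ⟨t₁, s₁, h₁, t₂, s₂, h₂, hq⟩
    exact ⟨_, _, .seq h₁ h₂, hq⟩

@[simp] theorem wp_ite {b : BExpr} {c d : Cmd} {s : State} {Q : ℕ → State → Prop} :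
    wp (.ite b c d) s Q ↔ (b.eval s → wp c s (fun t => Q (b.cost + 1 + t))) ∧
      (¬ b.eval s → wp d s (fun t => Q (b.cost + 1 + t))) := by
  constructor
  · rintro ⟨t, s', he, hq⟩
    cases he with
    | iteTrue hb h => exact ⟨fun _ => ⟨_, _, h, hq⟩, fun h => absurd hb h⟩
    | iteFalse hb h => exact ⟨fun h => absurd h hb, fun _ => ⟨_, _, h, hq⟩⟩
  · rintro ⟨h₁, h₂⟩
    by_cases hb : b.eval s
    · obtain ⟨t, s', he, hq⟩ := h₁ hb
      exact ⟨_, _, .iteTrue hb he, hq⟩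
    · obtain ⟨t, s', he, hq⟩ := h₂ hb
      exact ⟨_, _, .iteFalse hb he, hq⟩

theorem wp_call {y : Var} {f : Proc} {args : List Expr} {s : State} {Q : ℕ → State → Prop}
    (h : wp (procs f).2 ⟨frame (procs f).1 (args.map (Expr.eval s)), s.mem⟩ (fun t s' =>
      Q ((args.map Expr.cost).sum + 1 + t) ⟨Function.update s.loc y (s'.loc .res), s'.mem⟩)) :
    wp (.call y f args) s Q := by
  obtain ⟨t, s', he, hq⟩ := h
  exact ⟨_, _, .call he, hq⟩

/-- Needed for the inversion in place, where the first step on a cycle differs from the others. -/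
theorem wp_while_unroll {b : BExpr} {c : Cmd} {s : State} {Q : ℕ → State → Prop} (hb : b.eval s)
    (h : wp c s (fun t₁ s₁ => wp (.while b c) s₁ (fun t₂ s₂ => Q (b.cost + 1 + t₁ + t₂) s₂))) :
    wp (.while b c) s Q := by
  obtain ⟨t₁, s₁, h₁, t₂, s₂, h₂, hq⟩ := h
  exact ⟨_, _, .whileTrue hb h₁ h₂, hq⟩

/-- The rule for loops: `Inv B s` is an invariant that says in particular that the remaining time
is at most `B`, and `Post B s` says that the time `B` is left over in the end. -/
theorem wp_while_amortized {b : BExpr} {c : Cmd} {s₀ : State} {B₀ : ℤ} {Post : ℤ → State → Prop}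
    (Inv : ℤ → State → Prop) (h₀ : Inv B₀ s₀)
    (hstep : ∀ B s, Frame c s₀ s → Inv B s → b.eval s → wp c s (fun t s' =>
      ∃ B', 0 ≤ B' ∧ (b.cost : ℤ) + 1 + t + B' ≤ B ∧ Inv B' s'))
    (hexit : ∀ B s, Frame c s₀ s → Inv B s → ¬ b.eval s → Post (B - (b.cost + 1)) s) :
    wp (.while b c) s₀ (fun t s' => ∃ B, t + B ≤ B₀ ∧ Post B s') := by
  -- A round costs at least one unit, so the budget strictly decreases, while it must stay
  -- nonnegative after each round. Induction on a bound for the budget therefore yields halting and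
  -- the time bound together.
  suffices h : ∀ (N : ℕ) (B : ℤ) s, B ≤ N → Frame c s₀ s → Inv B s →
      wp (.while b c) s (fun t s' => ∃ B', t + B' ≤ B ∧ Post B' s') from
    h B₀.toNat B₀ s₀ (Int.self_le_toNat _) (Frame.refl _ _) h₀
  intro N
  induction N with
  | zero =>
    intro B s hN hF hI
    by_cases hb : b.eval s
    · obtain ⟨t₁, s₁, h₁, B', h0, hB, hI'⟩ := hstep B s hF hI hb
      omega
    · exact ⟨_, _, .whileFalse hb, _, by push_cast; omega, hexit B s hF hI hb⟩
  | succ N ih =>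
    intro B s hN hF hI
    by_cases hb : b.eval s
    · obtain ⟨t₁, s₁, h₁, B', h0, hB, hI'⟩ := hstep B s hF hI hb
      obtain ⟨t₂, s₂, h₂, B'', ht, hP⟩ := ih B' s₁ (by omega) (hF.trans h₁.frame) hI'
      exact ⟨_, _, .whileTrue hb h₁ h₂, B'', by push_cast; omega, hP⟩
    · exact ⟨_, _, .whileFalse hb, _, by push_cast; omega, hexit B s hF hI hb⟩

theorem wp_while {b : BExpr} {c : Cmd} {s₀ : State} {B₀ : ℤ} {Post : State → Prop}
    (Inv : ℤ → State → Prop) (h₀ : Inv B₀ s₀)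
    (hstep : ∀ B s, Frame c s₀ s → Inv B s → b.eval s → wp c s (fun t s' =>
      ∃ B', 0 ≤ B' ∧ (b.cost : ℤ) + 1 + t + B' ≤ B ∧ Inv B' s'))
    (hexit : ∀ B s, Frame c s₀ s → Inv B s → ¬ b.eval s → (b.cost : ℤ) + 1 ≤ B ∧ Post s) :
    wp (.while b c) s₀ (fun t s' => (t : ℤ) ≤ B₀ ∧ Post s') := by
  refine (wp_while_amortized (Post := fun B s => 0 ≤ B ∧ Post s) Inv h₀ hstep
    fun B s hF hI hb => ?_).mono ?_
  · obtain ⟨h, hP⟩ := hexit B s hF hI hb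
    exact ⟨by omega, hP⟩
  · rintro t s - ⟨B, ht, hB, hP⟩
    exact ⟨by omega, hP⟩

/-! ### Evaluation -/

section Eval
variable (s : State) (e f : Expr) (y z : Var) (A B : Arr) (q v : ℤ)

@[simp] theorem eval_ofNat (c : ℕ) : (no_index (OfNat.ofNat c) : Expr).eval s = c := rfl
@[simp] theorem eval_var : (Expr.var y).eval s = s.loc y := rfl
@[simp] theorem eval_get : (Expr.get A e).eval s = s.mem A (e.eval s) := rfl
@[simp] theorem eval_add : (e + f).eval s = e.eval s + f.eval s := rfl
@[simp] theorem eval_sub : (e - f).eval s = e.eval s - f.eval s := rfl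
@[simp] theorem eval_neg : (-e).eval s = -e.eval s := zero_sub _
@[simp] theorem eval_half : (Expr.half e).eval s = e.eval s / 2 := rfl
@[simp] theorem cost_ofNat (c : ℕ) : (no_index (OfNat.ofNat c) : Expr).cost = 1 := rfl
@[simp] theorem cost_var : (Expr.var y).cost = 1 := rfl
@[simp] theorem cost_get : (Expr.get A e).cost = e.cost + 1 := rfl
@[simp] theorem cost_add : (e + f).cost = e.cost + f.cost + 1 := rfl
@[simp] theorem cost_sub : (e - f).cost = e.cost + f.cost + 1 := rfl
@[simp] theorem cost_neg : (-e).cost = 1 + e.cost + 1 := rfl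
@[simp] theorem cost_half : (Expr.half e).cost = e.cost + 1 := rfl

@[simp] theorem beval_lt : (BExpr.lt e f).eval s ↔ e.eval s < f.eval s := Iff.rfl
@[simp] theorem beval_le : (BExpr.le e f).eval s ↔ e.eval s ≤ f.eval s := Iff.rfl
@[simp] theorem beval_eq : (BExpr.eq e f).eval s ↔ e.eval s = f.eval s := Iff.rfl
@[simp] theorem beval_ne : (BExpr.ne e f).eval s ↔ e.eval s ≠ f.eval s := Iff.rfl
@[simp] theorem beval_and (b c : BExpr) : (BExpr.and b c).eval s ↔ b.eval s ∧ c.eval s := Iff.rfl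
@[simp] theorem beval_or (b c : BExpr) : (BExpr.or b c).eval s ↔ b.eval s ∨ c.eval s := Iff.rfl
@[simp] theorem bcost_lt : (BExpr.lt e f).cost = e.cost + f.cost + 1 := rfl
@[simp] theorem bcost_le : (BExpr.le e f).cost = e.cost + f.cost + 1 := rfl
@[simp] theorem bcost_eq : (BExpr.eq e f).cost = e.cost + f.cost + 1 := rfl
@[simp] theorem bcost_ne : (BExpr.ne e f).cost = e.cost + f.cost + 1 := rfl
@[simp] theorem bcost_and (b c : BExpr) : (BExpr.and b c).cost = b.cost + c.cost + 1 := rfl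
@[simp] theorem bcost_or (b c : BExpr) : (BExpr.or b c).cost = b.cost + c.cost + 1 := rfl

@[simp] theorem setVar_loc : (s.setVar y v).loc = Function.update s.loc y v := rfl
@[simp] theorem setVar_mem : (s.setVar y v).mem = s.mem := rfl
@[simp] theorem setCell_loc : (s.setCell A q v).loc = s.loc := rfl
@[simp] theorem setCell_mem_self :
    (s.setCell A q v).mem A = Function.update (s.mem A) q v := by simp [State.setCell]
@[simp] theorem setCell_mem_of_ne (h : B ≠ A) : (s.setCell A q v).mem B = s.mem B := by
  simp [State.setCell, h]

@[simp] theorem frame_nil (zs : List ℤ) : frame [] zs = fun _ => 0 := by simp [frame]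
@[simp] theorem frame_cons (ys : List Var) (zs : List ℤ) :
    frame (y :: ys) (v :: zs) = Function.update (frame ys zs) y v := rfl

end Eval

/-! ### Counting and rearranging the cells of an interval -/

open Classical in
/-- The number of cells of `f[lo..hi]` whose content satisfies `p`. -/
noncomputable def cnt (f : ℤ → ℤ) (lo hi : ℤ) (p : ℤ → Prop) : ℕ :=
  ((Finset.Icc lo hi).filter (fun q => p (f q))).card

section Cnt
variable {f f' : ℤ → ℤ} {lo hi m : ℤ} {p p' : ℤ → Prop}

theorem cnt_split (h₁ : lo ≤ m + 1) (h₂ : m ≤ hi) :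
    cnt f lo hi p = cnt f lo m p + cnt f (m + 1) hi p := by
  classical
  unfold cnt
  rw [← Finset.card_union_of_disjoint, ← Finset.filter_union]
  · congr 2
    ext q
    simp only [Finset.mem_Icc, Finset.mem_union]
    omega
  · rw [Finset.disjoint_left]
    intro q
    simp only [Finset.mem_filter, Finset.mem_Icc]
    omega

theorem cnt_congr (h : ∀ q, lo ≤ q → q ≤ hi → (p (f q) ↔ p' (f' q))) :
    cnt f lo hi p = cnt f' lo hi p' := by
  classical
  unfold cnt
  congr 1
  ext q
  simp only [Finset.mem_filter, Finset.mem_Icc]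
  exact ⟨fun ⟨a, b⟩ => ⟨a, (h q a.1 a.2).1 b⟩, fun ⟨a, b⟩ => ⟨a, (h q a.1 a.2).2 b⟩⟩

theorem cnt_mono (h : ∀ q, lo ≤ q → q ≤ hi → p (f q) → p' (f' q)) :
    cnt f lo hi p ≤ cnt f' lo hi p' := by
  classical
  unfold cnt
  apply Finset.card_le_card
  intro q
  simp only [Finset.mem_filter, Finset.mem_Icc]
  exact fun ⟨a, b⟩ => ⟨a, h q a.1 a.2 b⟩

theorem cnt_all (hlh : lo ≤ hi + 1) (h : ∀ q, lo ≤ q → q ≤ hi → p (f q)) :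
    (cnt f lo hi p : ℤ) = hi + 1 - lo := by
  classical
  unfold cnt
  rw [Finset.filter_true_of_mem]
  · rw [Int.card_Icc]; omega
  · intro q; rw [Finset.mem_Icc]; exact fun a => h q a.1 a.2

theorem cnt_none (h : ∀ q, lo ≤ q → q ≤ hi → ¬ p (f q)) : cnt f lo hi p = 0 := by
  classical
  unfold cnt
  rw [Finset.filter_false_of_mem, Finset.card_empty]
  intro q; rw [Finset.mem_Icc]; exact fun a => h q a.1 a.2

theorem cnt_empty (h : hi < lo) : cnt f lo hi p = 0 := cnt_none fun q _ _ => by omega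

theorem cnt_compl (hlh : lo ≤ hi + 1) :
    (cnt f lo hi p : ℤ) + cnt f lo hi (fun z => ¬ p z) = hi + 1 - lo := by
  classical
  unfold cnt
  have := Finset.card_filter_add_card_filter_not (s := Finset.Icc lo hi) (fun q => p (f q))
  rw [Int.card_Icc] at this
  simp only [] at this ⊢
  omega

theorem cnt_pos (h : 0 < cnt f lo hi p) : ∃ q, lo ≤ q ∧ q ≤ hi ∧ p (f q) := by
  by_contra! hn
  rw [cnt_none hn] at h
  omega

theorem cnt_le (hlh : lo ≤ hi + 1) : (cnt f lo hi p : ℤ) ≤ hi + 1 - lo := by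
  have := cnt_compl (f := f) (p := p) hlh
  omega

theorem cnt_single : cnt f lo lo p = 1 ↔ p (f lo) := by
  constructor
  · intro h
    obtain ⟨q, h1, h2, h3⟩ := cnt_pos (f := f) (lo := lo) (hi := lo) (p := p) (by omega)
    rwa [show q = lo by omega] at h3
  · intro h
    have := cnt_all (f := f) (lo := lo) (hi := lo) (p := p) (by omega)
      (fun q h1 h2 => by rwa [show q = lo by omega])
    omega

end Cnt

/-- `f'` is obtained from `f` by permuting the contents of the cells `lo, …, hi`. -/
def PermOn (lo hi : ℤ) (f f' : ℤ → ℤ) : Prop :=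
  ∃ σ : Equiv.Perm ℤ, (∀ q, q < lo ∨ hi < q → σ q = q) ∧ ∀ q, f' q = f (σ q)

namespace PermOn
variable {lo hi lo' hi' : ℤ} {f f' f'' : ℤ → ℤ}

theorem refl (lo hi : ℤ) (f : ℤ → ℤ) : PermOn lo hi f f :=
  ⟨Equiv.refl _, fun _ _ => rfl, fun _ => rfl⟩

theorem trans (h₁ : PermOn lo hi f f') (h₂ : PermOn lo hi f' f'') : PermOn lo hi f f'' := by
  obtain ⟨σ, a, b⟩ := h₁
  obtain ⟨τ, c, d⟩ := h₂
  refine ⟨τ.trans σ, fun q hq => ?_, fun q => ?_⟩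
  · rw [Equiv.trans_apply, c q hq, a q hq]
  · rw [Equiv.trans_apply, d, b]

theorem mono (h : PermOn lo hi f f') (h₁ : lo' ≤ lo) (h₂ : hi ≤ hi') : PermOn lo' hi' f f' := by
  obtain ⟨σ, a, b⟩ := h
  exact ⟨σ, fun q hq => a q (by omega), b⟩

theorem eq_of_not_mem (h : PermOn lo hi f f') {q : ℤ} (hq : q < lo ∨ hi < q) : f' q = f q := by
  obtain ⟨σ, a, b⟩ := h
  rw [b, a q hq]

theorem swap {q q' : ℤ} (h₁ : lo ≤ q) (h₂ : q ≤ hi) (h₃ : lo ≤ q') (h₄ : q' ≤ hi) (f : ℤ → ℤ) :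
    PermOn lo hi f (Function.update (Function.update f q (f q')) q' (f q)) := by
  refine ⟨Equiv.swap q q', fun z hz => Equiv.swap_apply_of_ne_of_ne (by omega) (by omega),
    fun z => ?_⟩
  by_cases hz' : z = q'
  · subst hz'; simp
  · by_cases hz : z = q
    · subst hz; simp [hz']
    · simp [hz, hz', Equiv.swap_apply_of_ne_of_ne hz hz']

/-- A point outside the interval is fixed. If `σ q` lies outside, then `σ (σ q) = σ q`, and
injectivity puts `q` outside as well. -/
theorem mem_Icc {σ : Equiv.Perm ℤ} (a : ∀ q, q < lo ∨ hi < q → σ q = q) {q : ℤ} :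
    lo ≤ σ q ∧ σ q ≤ hi ↔ lo ≤ q ∧ q ≤ hi := by
  constructor
  · intro h
    by_contra hn
    rw [a q (by omega)] at h
    exact hn h
  · intro h
    by_contra hn
    have h1 := a (σ q) (by omega)
    have h2 := σ.injective h1
    rw [h2] at hn
    exact hn h

theorem cnt_eq (h : PermOn lo hi f f') (p : ℤ → Prop) : cnt f' lo hi p = cnt f lo hi p := by
  classical
  obtain ⟨σ, a, b⟩ := h
  unfold cnt
  refine Finset.card_equiv σ fun q => ?_
  simp only [Finset.mem_filter, Finset.mem_Icc, b, mem_Icc a]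

theorem exists_eq (h : PermOn lo hi f f') {q : ℤ} (h₁ : lo ≤ q) (h₂ : q ≤ hi) :
    ∃ q', lo ≤ q' ∧ q' ≤ hi ∧ f' q = f q' := by
  obtain ⟨σ, a, b⟩ := h
  have := (mem_Icc a (q := q)).2 ⟨h₁, h₂⟩
  exact ⟨σ q, this.1, this.2, b q⟩

theorem symm (h : PermOn lo hi f f') : PermOn lo hi f' f := by
  obtain ⟨σ, a, b⟩ := h
  refine ⟨σ.symm, fun q hq => ?_, fun q => ?_⟩
  · rw [Equiv.symm_apply_eq, a q hq]
  · rw [b, Equiv.apply_symm_apply]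

theorem injOn (h : PermOn lo hi f f') (h₁ : lo' ≤ lo) (h₂ : hi ≤ hi')
    (hf : Set.InjOn f (Set.Icc lo' hi')) : Set.InjOn f' (Set.Icc lo' hi') := by
  obtain ⟨σ, a, b⟩ := h.mono h₁ h₂
  intro q hq q' hq' e
  rw [b, b] at e
  exact σ.injective (hf ((mem_Icc a).2 hq) ((mem_Icc a).2 hq') e)

end PermOn

/-! ### Insertion sort -/

/-- A quadratic bound is enough: the procedure is applied only to blocks of at most five cells and
to ranges of at most 140 cells. -/
theorem insertionSort_spec {s : State} {L H : ℤ} (hL : s.loc .lo = L) (hH : s.loc .hi = H)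
    (hLH : L ≤ H) : wp insertionSortBody s (fun t s' =>
      (t : ℤ) ≤ 60 * (H - L + 1) * (H - L + 1) + 20 ∧ PermOn L H (s.mem .M) (s'.mem .M) ∧
      ∀ q q', L ≤ q → q ≤ q' → q' ≤ H → s'.mem .M q ≤ s'.mem .M q') := by
  unfold insertionSortBody
  simp only [wp_seq, wp_assign]
  refine (wp_while (fun B s' => L < s'.loc .i ∧ s'.loc .i ≤ H + 1 ∧
      PermOn L H (s.mem .M) (s'.mem .M) ∧
      (∀ q q', L ≤ q → q ≤ q' → q' < s'.loc .i → s'.mem .M q ≤ s'.mem .M q') ∧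
      B = (H + 1 - s'.loc .i) * (25 * (H - L + 1) + 35) + 5)
    (B₀ := (H - L) * (25 * (H - L + 1) + 35) + 5) (Post := fun s' =>
      PermOn L H (s.mem .M) (s'.mem .M) ∧
      ∀ q q', L ≤ q → q ≤ q' → q' ≤ H → s'.mem .M q ≤ s'.mem .M q') ?_ ?_ ?_).mono ?_
  · simp [hL]
    refine ⟨hLH, PermOn.refl _ _ _, fun q q' h1 h2 h3 => ?_⟩
    rw [show q = q' by omega]
  · rintro B s₁ hF ⟨hi1, hi2, hp, hsort, rfl⟩ hb
    have eH : s₁.loc .hi = H := by rw [hF.loc .hi rfl]; simp [hH]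
    have eL : s₁.loc .lo = L := by rw [hF.loc .lo rfl]; simp [hL]
    simp [eH] at hb
    simp only [wp_seq, wp_assign]
    -- Cell `j + 1` is a hole that waits for `x`. The array is a rearrangement only once the hole is
    -- filled, and order is asserted for the other cells only.
    refine (wp_while (fun B s' => L ≤ s'.loc .j + 1 ∧ s'.loc .j < s₁.loc .i ∧
      PermOn L H (s.mem .M) (Function.update (s'.mem .M) (s'.loc .j + 1) (s'.loc .x)) ∧
      (∀ q q', L ≤ q → q ≤ q' → q' ≤ s₁.loc .i → q ≠ s'.loc .j + 1 → q' ≠ s'.loc .j + 1 →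
        s'.mem .M q ≤ s'.mem .M q') ∧
      (∀ q, s'.loc .j + 1 < q → q ≤ s₁.loc .i → s'.loc .x < s'.mem .M q) ∧
      B = (s'.loc .j + 1 - L) * 25 + 10) (B₀ := (s₁.loc .i - L) * 25 + 10) (Post := fun s' =>
      L ≤ s'.loc .j + 1 ∧ s'.loc .j < s₁.loc .i ∧
      PermOn L H (s.mem .M) (Function.update (s'.mem .M) (s'.loc .j + 1) (s'.loc .x)) ∧
      (∀ q q', L ≤ q → q ≤ q' → q' ≤ s₁.loc .i → q ≠ s'.loc .j + 1 → q' ≠ s'.loc .j + 1 →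
        s'.mem .M q ≤ s'.mem .M q') ∧
      (∀ q, s'.loc .j + 1 < q → q ≤ s₁.loc .i → s'.loc .x < s'.mem .M q) ∧
      (L ≤ s'.loc .j → s'.mem .M (s'.loc .j) ≤ s'.loc .x)) ?_ ?_ ?_).mono ?_
    · simp
      refine ⟨by omega, hp, ?_, by intros; omega⟩
      intro q q' h1 h2 h3 h4 h5
      exact hsort q q' h1 h2 (by omega)
    · rintro B s₂ hF₂ ⟨hj1, hj2, hp2, hs2, hx2, rfl⟩ hb2
      have eL2 : s₂.loc .lo = L := by rw [hF₂.loc .lo rfl]; simp [eL]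
      simp [eL2] at hb2
      simp
      refine ⟨by omega, by omega, by omega, by omega, ?_, ?_, ?_⟩
      -- In the array with the hole filled by `x`, moving the hole one cell to the left is a swap.
      · refine hp2.trans ?_
        convert PermOn.swap (lo := L) (hi := H) (q := s₂.loc .j + 1) (q' := s₂.loc .j) (by omega)
          (by omega) (by omega) (by omega) _ using 1
        funext z
        simp only [Function.update_apply]
        split_ifs <;> first | rfl | omega
      · intro q q' h1 h2 h3 h4 h5
        simp only [Function.update_apply]
        split_ifs with c1 c2 c2
        · rfl
        · exact hs2 _ _ (by omega) (by omega) h3 (by omega) c2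
        · exact hs2 _ _ (by omega) (by omega) (by omega) c1 (by omega)
        · exact hs2 _ _ h1 h2 h3 c1 c2
      · intro q h1 h2
        simp only [Function.update_apply]
        split_ifs with c1
        · exact hb2.2
        · exact hx2 q (by omega) h2
    · rintro B s₂ hF₂ ⟨hj1, hj2, hp2, hs2, hx2, rfl⟩ hb2
      have eL2 : s₂.loc .lo = L := by rw [hF₂.loc .lo rfl]; simp [eL]
      simp [eL2] at hb2
      refine ⟨by simp; omega, hj1, hj2, hp2, hs2, hx2, hb2⟩
    · rintro t₂ s₂ hF₂ ⟨ht, hj1, hj2, hp2, hs2, hx2, hb2⟩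
      have ei : s₂.loc .i = s₁.loc .i := by rw [hF₂.loc .i rfl]; simp
      simp [ei]
      refine ⟨?_, ?_, by omega, by omega, hp2, ?_⟩
      · have : 0 ≤ (H - s₁.loc .i) * (25 * (H - L + 1) + 35) :=
          mul_nonneg (by omega) (by omega)
        omega
      · have : (H + 1 - s₁.loc .i) * (25 * (H - L + 1) + 35) =
          (H - s₁.loc .i) * (25 * (H - L + 1) + 35) + (25 * (H - L + 1) + 35) := by ring
        omega
      · intro q q' h1 h2 h3
        simp only [Function.update_apply]
        split_ifs with c1 c2 c2
        · rfl
        · exact (hx2 _ (by omega) (by omega)).le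
        · rcases eq_or_lt_of_le h2 with h | h
          · omega
          · refine le_trans ?_ (hb2 (by omega))
            exact hs2 _ _ h1 (by omega) (by omega) c1 (by omega)
        · exact hs2 _ _ h1 h2 (by omega) c1 c2
  · rintro B s₁ hF ⟨hi1, hi2, hp, hsort, rfl⟩ hb
    have eH : s₁.loc .hi = H := by rw [hF.loc .hi rfl]; simp [hH]
    simp [eH] at hb
    refine ⟨?_, hp, fun q q' h1 h2 h3 => hsort q q' h1 h2 (by omega)⟩
    have : 0 ≤ (H + 1 - s₁.loc .i) * (25 * (H - L + 1) + 35) :=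
      mul_nonneg (by omega) (by omega)
    simp
    omega
  · rintro t s' _ ⟨ht, hp, hs⟩
    refine ⟨?_, hp, hs⟩
    have : 0 ≤ (H - L) * (H - L) := mul_self_nonneg _
    simp
    nlinarith

/-! ### Ternary split -/

/-- Each round shrinks the interval from `i` to `b` by one cell. The assumption `hkey` lets the key
depend on other arrays and on `h`, but on `A` only through the given entry; this covers both the
identity on `M` and `V[q + h]` on `sfx`. -/
theorem partition_spec {A : Arr} {key : Expr → Expr} {f : ℤ → ℤ} {s : State} {L H p : ℤ}
    (hL : s.loc .lo = L) (hH : s.loc .hi = H) (hv : s.loc .v = p) (hLH : L ≤ H + 1)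
    (hkey : ∀ s', (∀ B, B ≠ A → s'.mem B = s.mem B) → s'.loc .h = s.loc .h →
      ∀ e, (key e).eval s' = f (e.eval s'))
    (hcost : ∀ e, (key e).cost ≤ e.cost + 3) :
    wp (partition A key) s (fun t s' => (t : ℤ) ≤ 60 * (H - L + 1) + 20 ∧
      PermOn L H (s.mem A) (s'.mem A) ∧
      L ≤ s'.loc .a ∧ s'.loc .a ≤ s'.loc .b + 1 ∧ s'.loc .b ≤ H ∧
      (∀ q, L ≤ q → q < s'.loc .a → f (s'.mem A q) < p) ∧
      (∀ q, s'.loc .a ≤ q → q ≤ s'.loc .b → f (s'.mem A q) = p) ∧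
      (∀ q, s'.loc .b < q → q ≤ H → p < f (s'.mem A q))) := by
  unfold partition swap
  simp only [wp_seq, wp_assign]
  refine (wp_while (fun B s' => L ≤ s'.loc .a ∧ s'.loc .a ≤ s'.loc .i ∧
      s'.loc .i ≤ s'.loc .b + 1 ∧ s'.loc .b ≤ H ∧ PermOn L H (s.mem A) (s'.mem A) ∧
      (∀ q, L ≤ q → q < s'.loc .a → f (s'.mem A q) < p) ∧
      (∀ q, s'.loc .a ≤ q → q < s'.loc .i → f (s'.mem A q) = p) ∧
      (∀ q, s'.loc .b < q → q ≤ H → p < f (s'.mem A q)) ∧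
      B = (s'.loc .b + 1 - s'.loc .i) * 60 + 8)
    (B₀ := (H - L + 1) * 60 + 8) (Post := fun s' => PermOn L H (s.mem A) (s'.mem A) ∧
      L ≤ s'.loc .a ∧ s'.loc .a ≤ s'.loc .b + 1 ∧ s'.loc .b ≤ H ∧
      (∀ q, L ≤ q → q < s'.loc .a → f (s'.mem A q) < p) ∧
      (∀ q, s'.loc .a ≤ q → q ≤ s'.loc .b → f (s'.mem A q) = p) ∧
      (∀ q, s'.loc .b < q → q ≤ H → p < f (s'.mem A q))) ?_ ?_ ?_).mono ?_
  · simp [hL, hH]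
    refine ⟨by omega, PermOn.refl _ _ _, by intros; omega, by intros; omega, by intros; omega,
      by ring⟩
  · rintro B s₁ hF ⟨ha, hai, hib, hbH, hp, h1, h2, h3, rfl⟩ hb
    have ev : s₁.loc .v = p := by rw [hF.loc .v rfl]; simp [hv]
    have eh : s₁.loc .h = s.loc .h := by rw [hF.loc .h rfl]; simp
    have em : ∀ B, B ≠ A → s₁.mem B = s.mem B := fun B hB => by
      rw [hF.mem B (by simp [Cmd.writesArr, hB])]; simp
    have ek := hkey s₁ em eh (Expr.get A (.var .i))
    have hc := hcost (Expr.get A (.var .i))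
    simp at hb ek hc
    simp [ek, ev]
    refine ⟨fun hlt => ⟨by omega, by omega, by omega, by omega, by omega, by omega, ?_, ?_, ?_, ?_⟩,
      fun hnlt => ⟨fun hgt => ⟨by omega, by omega, by omega, by omega, by omega, by omega, ?_, ?_,
        ?_, ?_⟩,
        fun hngt => ⟨by omega, by omega, by omega, by omega, by omega, by omega, hp, h1, ?_, h3⟩⟩⟩
    · exact hp.trans (PermOn.swap (by omega) (by omega) (by omega) (by omega) (s₁.mem A))
    · intro q a1 a2
      simp only [Function.update_apply]
      split_ifs with c1 c2
      · rw [show s₁.loc .a = s₁.loc .i by omega]; exact hlt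
      · exact hlt
      · exact h1 _ a1 (by omega)
    · intro q a1 a2
      simp only [Function.update_apply]
      split_ifs with c1 c2
      · exact h2 _ (by omega) (by omega)
      · omega
      · exact h2 _ (by omega) (by omega)
    · intro q a1 a2
      simp only [Function.update_apply]
      rw [if_neg (by omega), if_neg (by omega)]
      exact h3 _ a1 a2
    · exact hp.trans (PermOn.swap (by omega) (by omega) (by omega) (by omega) (s₁.mem A))
    · intro q a1 a2
      simp only [Function.update_apply]
      rw [if_neg (by omega), if_neg (by omega)]
      exact h1 _ a1 a2
    · intro q a1 a2
      simp only [Function.update_apply]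
      rw [if_neg (by omega), if_neg (by omega)]
      exact h2 _ a1 a2
    · intro q a1 a2
      simp only [Function.update_apply]
      split_ifs with c1 c2
      · exact hgt
      · omega
      · exact h3 _ (by omega) a2
    · intro q a1 a2
      by_cases c : q = s₁.loc .i
      · subst c; omega
      · exact h2 _ a1 (by omega)
  · rintro B s₁ hF ⟨ha, hai, hib, hbH, hp, h1, h2, h3, rfl⟩ hb
    simp at hb
    refine ⟨by simp; omega, hp, ha, by omega, hbH, h1, fun q a1 a2 => h2 q a1 (by omega), h3⟩
  · rintro t s' _ ⟨ht, h⟩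
    refine ⟨by simp; omega, h⟩

/-! ### Selection -/

/-- The result of a selection: `v` has the rank `k`, counted from `0`, in `f[lo..hi]`. -/
def HasRank (f : ℤ → ℤ) (lo hi k v : ℤ) : Prop :=
  (cnt f lo hi (· < v) : ℤ) ≤ k ∧ k < cnt f lo hi (· ≤ v)

theorem hasRank_of_sorted {f : ℤ → ℤ} {lo hi k : ℤ}
    (h : ∀ q q', lo ≤ q → q ≤ q' → q' ≤ hi → f q ≤ f q') (h₁ : lo ≤ k) (h₂ : k ≤ hi) :
    HasRank f lo hi (k - lo) (f k) := by
  constructor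
  · rw [cnt_split (m := k - 1) (by omega) (by omega)]
    have h3 := cnt_le (f := f) (lo := lo) (hi := k - 1) (p := (· < f k)) (by omega)
    have h4 : cnt f (k - 1 + 1) hi (· < f k) = 0 := cnt_none fun q a b => by
      have := h k q h₁ (by omega) b
      omega
    push_cast
    omega
  · rw [cnt_split (m := k) (by omega) (by omega)]
    have h3 := cnt_all (f := f) (lo := lo) (hi := k) (p := (· ≤ f k)) (by omega)
      fun q a b => h q k a b h₂
    push_cast
    omega

/-- If the cells of `f[lo..hi]` are split by a pivot, ranks to the left are ranks in `f[lo..hi]`. -/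
theorem hasRank_left {f : ℤ → ℤ} {lo hi k a v x : ℤ} (h₁ : lo ≤ a) (h₂ : a ≤ hi + 1)
    (hl : ∀ q, lo ≤ q → q < a → f q < v) (hr : ∀ q, a ≤ q → q ≤ hi → v ≤ f q)
    (hk : k < a - lo) (h : HasRank f lo (a - 1) k x) : HasRank f lo hi k x := by
  obtain ⟨h3, h4⟩ := h
  -- If `x` exceeded the pivot, all `a - lo > k` cells on the left would be less than `x`, against
  -- its rank. Hence the right part contributes no cell below `x`.
  have hx : x ≤ v := by
    by_contra hn
    have := cnt_all (f := f) (lo := lo) (hi := a - 1) (p := (· < x)) (by omega)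
      fun q b c => by have := hl q b (by omega); omega
    omega
  constructor
  · rw [cnt_split (m := a - 1) (by omega) (by omega)]
    have h5 : cnt f (a - 1 + 1) hi (· < x) = 0 := cnt_none fun q b c => by
      have := hr q (by omega) c
      omega
    push_cast
    omega
  · rw [cnt_split (m := a - 1) (by omega) (by omega)]
    push_cast
    omega

theorem hasRank_right {f : ℤ → ℤ} {lo hi k b v x : ℤ} (h₁ : lo ≤ b + 1) (h₂ : b ≤ hi)
    (hl : ∀ q, lo ≤ q → q ≤ b → f q ≤ v) (hr : ∀ q, b < q → q ≤ hi → v < f q)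
    (hk : b + 1 - lo ≤ k) (h : HasRank f (b + 1) hi (k - (b + 1 - lo)) x) :
    HasRank f lo hi k x := by
  obtain ⟨h3, h4⟩ := h
  have hx : v < x := by
    by_contra hn
    have := cnt_none (f := f) (lo := b + 1) (hi := hi) (p := (· ≤ x))
      fun q c d => by have := hr q (by omega) d; omega
    omega
  constructor
  · rw [cnt_split (m := b) (by omega) (by omega)]
    have := cnt_le (f := f) (lo := lo) (hi := b) (p := (· < x)) (by omega)
    push_cast
    omega
  · rw [cnt_split (m := b) (by omega) (by omega)]
    have := cnt_all (f := f) (lo := lo) (hi := b) (p := (· ≤ x)) (by omega)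
      fun q c d => by have := hl q c d; omega
    push_cast
    omega

/-- The loop that sorts blocks of five values and collects their medians. -/
theorem selectBlocks_spec {s : State} {L H : ℤ} (hi : s.loc .i = L) (hj : s.loc .j = H + 1)
    (hH : s.loc .hi = H) (hLH : L ≤ H) :
    wp (.while (.le (.var .i) (.var .hi)) (
      .seq (.assign .e (.var .i + 4)) <|
      .seq (when (.lt (.var .hi) (.var .e)) (.assign .e (.var .hi))) <|
      .seq (run .insertionSort [.var .i, .var .e]) <|
      .seq (.store .M (.var .j) (.get .M (.half (.var .i + .var .e)))) <|
      .seq (.assign .j (.var .j + 1)) (.assign .i (.var .e + 1)))) s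
      (fun t s' => (t : ℤ) ≤ 320 * (H - L + 1) + 1300 ∧
        (∀ q, q < L → s'.mem .M q = s.mem .M q) ∧
        (∀ p, cnt (s'.mem .M) L H p = cnt (s.mem .M) L H p) ∧
        H - L + 1 ≤ 5 * (s'.loc .j - H - 1) ∧ 5 * (s'.loc .j - H - 1) ≤ H - L + 5 ∧
        (∀ v, 3 * (cnt (s'.mem .M) (H + 1) (s'.loc .j - 1) (· ≤ v) : ℤ) ≤
          cnt (s'.mem .M) L H (· ≤ v) + 4) ∧
        (∀ v, 3 * (cnt (s'.mem .M) (H + 1) (s'.loc .j - 1) (v ≤ ·) : ℤ) ≤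
          cnt (s'.mem .M) L H (v ≤ ·) + 4)) := by
  -- A full block whose median is at most `v` has at least three cells that are at most `v`, and
  -- dually. The slack `5 * (blocks) - (cells treated)` is zero until a short last block, where it
  -- is at most `4` and makes up for the missing cells. The budget grants 1600 units per remaining
  -- block.
  refine (wp_while (fun B s' => L ≤ s'.loc .i ∧ s'.loc .i ≤ H + 1 ∧
      s'.loc .i - L ≤ 5 * (s'.loc .j - H - 1) ∧ 5 * (s'.loc .j - H - 1) ≤ s'.loc .i - L + 4 ∧
      (5 * (s'.loc .j - H - 1) = s'.loc .i - L ∨ s'.loc .i = H + 1) ∧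
      (∀ q, q < L → s'.mem .M q = s.mem .M q) ∧
      (∀ p, cnt (s'.mem .M) L H p = cnt (s.mem .M) L H p) ∧
      (∀ v, 3 * (cnt (s'.mem .M) (H + 1) (s'.loc .j - 1) (· ≤ v) : ℤ) ≤
        cnt (s'.mem .M) L (s'.loc .i - 1) (· ≤ v) +
          (5 * (s'.loc .j - H - 1) - (s'.loc .i - L))) ∧
      (∀ v, 3 * (cnt (s'.mem .M) (H + 1) (s'.loc .j - 1) (v ≤ ·) : ℤ) ≤
        cnt (s'.mem .M) L (s'.loc .i - 1) (v ≤ ·) +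
          (5 * (s'.loc .j - H - 1) - (s'.loc .i - L))) ∧
      B = (H + 1 - s'.loc .i + 4) / 5 * 1600 + 8)
    (B₀ := (H + 1 - L + 4) / 5 * 1600 + 8) (Post := fun s' =>
      (∀ q, q < L → s'.mem .M q = s.mem .M q) ∧
        (∀ p, cnt (s'.mem .M) L H p = cnt (s.mem .M) L H p) ∧
        H - L + 1 ≤ 5 * (s'.loc .j - H - 1) ∧ 5 * (s'.loc .j - H - 1) ≤ H - L + 5 ∧
        (∀ v, 3 * (cnt (s'.mem .M) (H + 1) (s'.loc .j - 1) (· ≤ v) : ℤ) ≤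
          cnt (s'.mem .M) L H (· ≤ v) + 4) ∧
        (∀ v, 3 * (cnt (s'.mem .M) (H + 1) (s'.loc .j - 1) (v ≤ ·) : ℤ) ≤
          cnt (s'.mem .M) L H (v ≤ ·) + 4)) ?_ ?_ ?_).mono ?_
  · rw [hi, hj]
    refine ⟨le_rfl, by omega, by omega, by omega, by omega, fun _ _ => rfl, fun _ => rfl,
      fun v => ?_, fun v => ?_, rfl⟩
    · rw [cnt_empty (by omega)]; omega
    · rw [cnt_empty (by omega)]; omega
  · rintro B s₁ hF ⟨hi1, hi2, hj1, hj2, hj3, hfr, hcnt, hle, hge, rfl⟩ hb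
    have eH : s₁.loc .hi = H := by rw [hF.loc .hi rfl, hH]
    simp [eH] at hb
    obtain ⟨E, hE⟩ : ∃ E, E = min (s₁.loc .i + 4) H := ⟨_, rfl⟩
    rw [wp_seq, wp_assign, wp_seq]
    refine wp.mono (Q := fun t s₂ => t ≤ 6 ∧ s₂.mem = s₁.mem ∧ s₂.loc .e = E) ?_ ?_
    · simp only [when, wp_ite, wp_assign, wp_skip]
      simp [eH]
      omega
    rintro t₂ s₂ hF₂ ⟨ht₂, hm₂, he₂⟩
    have ei : s₂.loc .i = s₁.loc .i := by rw [hF₂.loc .i rfl]; simp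
    have ej : s₂.loc .j = s₁.loc .j := by rw [hF₂.loc .j rfl]; simp
    rw [wp_seq]
    unfold run
    refine wp_call ((insertionSort_spec (L := s₁.loc .i) (H := E) ?_ ?_ ?_).mono ?_)
    · simp [procs, ei]
    · simp [procs, he₂]
    · omega
    rintro t₃ s₃ - ⟨ht₃, hp₃, hs₃⟩
    simp only [hm₂] at hp₃
    -- Insertion sort of at most five cells: `60 * 5 * 5 + 20`.
    have ht3 : (t₃ : ℤ) ≤ 1520 := by
      refine ht₃.trans ?_
      have h0 : 0 ≤ E - s₁.loc .i + 1 := by omega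
      have h5 : E - s₁.loc .i + 1 ≤ 5 := by omega
      nlinarith
    simp only [wp_seq, wp_assign, wp_store]
    simp [ei, ej, he₂]
    have hmid : ∀ q, q ≤ H → (Function.update (s₃.mem .M) (s₁.loc .j)
        (s₃.mem .M ((s₁.loc .i + E) / 2))) q = s₃.mem .M q := fun q hq =>
      Function.update_of_ne (by omega) _ _
    refine ⟨by omega, by omega, by omega, by omega, by omega, by omega, by omega, ?_, ?_, ?_, ?_⟩
    · intro q hq
      rw [hmid q (by omega), hp₃.eq_of_not_mem (by omega), hfr q hq]
    · intro p
      rw [← hcnt p, ← (hp₃.mono (lo' := L) (hi' := H) (by omega) (by omega)).cnt_eq p]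
      exact cnt_congr fun q h1 h2 => by rw [hmid q h2]
    all_goals
      intro v
      have hsp : s₁.loc .i - 1 + 1 = s₁.loc .i := by omega
      have hsq : s₁.loc .j - 1 + 1 = s₁.loc .j := by omega
    · have h1 := hle v
      rw [cnt_split (m := s₁.loc .j - 1) (by omega) (by omega),
        cnt_split (lo := L) (hi := E) (m := s₁.loc .i - 1) (by omega) (by omega), hsp, hsq]
      have h2 : cnt (Function.update (s₃.mem .M) (s₁.loc .j)
          (s₃.mem .M ((s₁.loc .i + E) / 2))) (H + 1) (s₁.loc .j - 1) (· ≤ v) =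
          cnt (s₁.mem .M) (H + 1) (s₁.loc .j - 1) (· ≤ v) := cnt_congr fun q a b => by
        rw [Function.update_of_ne (by omega), hp₃.eq_of_not_mem (by omega)]
      have h3 : cnt (Function.update (s₃.mem .M) (s₁.loc .j)
          (s₃.mem .M ((s₁.loc .i + E) / 2))) L (s₁.loc .i - 1) (· ≤ v) =
          cnt (s₁.mem .M) L (s₁.loc .i - 1) (· ≤ v) := cnt_congr fun q a b => by
        rw [Function.update_of_ne (by omega), hp₃.eq_of_not_mem (by omega)]
      rw [h2, h3]
      by_cases hv : s₃.mem .M ((s₁.loc .i + E) / 2) ≤ v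
      · have h4 : cnt (Function.update (s₃.mem .M) (s₁.loc .j)
            (s₃.mem .M ((s₁.loc .i + E) / 2))) (s₁.loc .j) (s₁.loc .j) (· ≤ v) = 1 :=
          cnt_single.2 (by simpa using hv)
        have h5 := cnt_split (f := Function.update (s₃.mem .M) (s₁.loc .j)
            (s₃.mem .M ((s₁.loc .i + E) / 2))) (lo := s₁.loc .i) (hi := E)
            (m := (s₁.loc .i + E) / 2) (p := (· ≤ v)) (by omega) (by omega)
        have h6 := cnt_all (f := Function.update (s₃.mem .M) (s₁.loc .j)
            (s₃.mem .M ((s₁.loc .i + E) / 2))) (lo := s₁.loc .i) (hi := (s₁.loc .i + E) / 2)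
            (p := (· ≤ v)) (by omega) (fun q a b => by
              rw [hmid q (by omega)]
              exact (hs₃ _ _ a b (by omega)).trans hv)
        push_cast
        omega
      · have h4 : cnt (Function.update (s₃.mem .M) (s₁.loc .j)
            (s₃.mem .M ((s₁.loc .i + E) / 2))) (s₁.loc .j) (s₁.loc .j) (· ≤ v) = 0 :=
          cnt_none fun q a b => by
            rw [show q = s₁.loc .j by omega]
            simpa using hv
        push_cast
        omega
    · have h1 := hge v
      rw [cnt_split (m := s₁.loc .j - 1) (by omega) (by omega),
        cnt_split (lo := L) (hi := E) (m := s₁.loc .i - 1) (by omega) (by omega), hsp, hsq]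
      have h2 : cnt (Function.update (s₃.mem .M) (s₁.loc .j)
          (s₃.mem .M ((s₁.loc .i + E) / 2))) (H + 1) (s₁.loc .j - 1) (v ≤ ·) =
          cnt (s₁.mem .M) (H + 1) (s₁.loc .j - 1) (v ≤ ·) := cnt_congr fun q a b => by
        rw [Function.update_of_ne (by omega), hp₃.eq_of_not_mem (by omega)]
      have h3 : cnt (Function.update (s₃.mem .M) (s₁.loc .j)
          (s₃.mem .M ((s₁.loc .i + E) / 2))) L (s₁.loc .i - 1) (v ≤ ·) =
          cnt (s₁.mem .M) L (s₁.loc .i - 1) (v ≤ ·) := cnt_congr fun q a b => by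
        rw [Function.update_of_ne (by omega), hp₃.eq_of_not_mem (by omega)]
      rw [h2, h3]
      by_cases hv : v ≤ s₃.mem .M ((s₁.loc .i + E) / 2)
      · have h4 : cnt (Function.update (s₃.mem .M) (s₁.loc .j)
            (s₃.mem .M ((s₁.loc .i + E) / 2))) (s₁.loc .j) (s₁.loc .j) (v ≤ ·) = 1 :=
          cnt_single.2 (by simpa using hv)
        have h5 := cnt_split (f := Function.update (s₃.mem .M) (s₁.loc .j)
            (s₃.mem .M ((s₁.loc .i + E) / 2))) (lo := s₁.loc .i) (hi := E)
            (m := (s₁.loc .i + E) / 2 - 1) (p := (v ≤ ·)) (by omega) (by omega)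
        have h6 := cnt_all (f := Function.update (s₃.mem .M) (s₁.loc .j)
            (s₃.mem .M ((s₁.loc .i + E) / 2))) (lo := (s₁.loc .i + E) / 2 - 1 + 1) (hi := E)
            (p := (v ≤ ·)) (by omega) (fun q a b => by
              rw [hmid q (by omega)]
              exact hv.trans (hs₃ _ _ (by omega) (by omega) b))
        push_cast
        omega
      · have h4 : cnt (Function.update (s₃.mem .M) (s₁.loc .j)
            (s₃.mem .M ((s₁.loc .i + E) / 2))) (s₁.loc .j) (s₁.loc .j) (v ≤ ·) = 0 :=
          cnt_none fun q a b => by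
            rw [show q = s₁.loc .j by omega]
            simpa using hv
        push_cast
        omega
  · rintro B s₁ hF ⟨hi1, hi2, hj1, hj2, hj3, hfr, hcnt, hle, hge, rfl⟩ hb
    have eH : s₁.loc .hi = H := by rw [hF.loc .hi rfl, hH]
    simp [eH] at hb
    have ei : s₁.loc .i - 1 = H := by omega
    rw [ei] at hle hge
    refine ⟨by simp; omega, hfr, hcnt, by omega, by omega, fun v => ?_, fun v => ?_⟩
    · have := hle v; omega
    · have := hge v; omega
  · rintro t s' _ ⟨ht, h⟩
    exact ⟨by omega, h⟩

/-- With `m` cells, the recursive calls concern at most `(m + 4) / 5` and `7m / 10 + 4` cells. As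
`1/5 + 7/10 < 1`, a tenth of `9000 m` is left for the linear work, and from `m = 140` on it also
covers the additive constants. Only cells to the left of `L` are promised to be unchanged: a
recursive call may overwrite what lies to its right, but nothing there is needed any more. -/
theorem select_spec {s : State} {L H K : ℤ} (hL : s.loc .lo = L) (hH : s.loc .hi = H)
    (hK : s.loc .k = K) (hK0 : 0 ≤ K) (hKH : K ≤ H - L) :
    wp selectBody s (fun t s' => (t : ℤ) ≤ 9000 * (H - L + 1) ∧
      (∀ q, q < L → s'.mem .M q = s.mem .M q) ∧ HasRank (s.mem .M) L H K (s'.loc .res)) := by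
  obtain ⟨N, hN⟩ : ∃ N : ℕ, H - L + 1 ≤ N := ⟨(H - L + 1).toNat, Int.self_le_toNat _⟩
  induction N using Nat.strong_induction_on generalizing s L H K with
  | _ N ih =>
  unfold selectBody
  rw [wp_ite]
  constructor
  · intro hb
    simp [hL, hH] at hb
    rw [wp_seq]
    unfold run
    refine wp_call ((insertionSort_spec (L := L) (H := H) ?_ ?_ (by omega)).mono ?_)
    · simp [procs, hL]
    · simp [procs, hH]
    rintro t₁ s₁ - ⟨ht, hp, hs⟩
    simp at hp
    simp [hL, hK]
    refine ⟨?_, fun q hq => hp.eq_of_not_mem (by omega), ?_⟩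
    · have h1 : 60 * (H - L + 1) * (H - L + 1) ≤ 60 * 140 * (H - L + 1) := by
        have : (H - L + 1) * (H - L + 1) ≤ 140 * (H - L + 1) :=
          mul_le_mul_of_nonneg_right (by omega) (by omega)
        linarith
      omega
    · have := hasRank_of_sorted hs (k := L + K) (by omega) (by omega)
      unfold HasRank at this ⊢
      rw [hp.cnt_eq, hp.cnt_eq] at this
      rwa [show L + K - L = K by omega] at this
  · intro hb
    simp [hL, hH] at hb
    simp only [wp_seq, wp_assign]
    refine (selectBlocks_spec (L := L) (H := H) ?_ ?_ ?_ (by omega)).mono ?_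
    · simp [hL]
    · simp [hH]
    · simp [hH]
    rintro t₁ s₁ hF₁ ⟨ht₁, hfr₁, hcnt₁, hj1, hj2, hle, hge⟩
    have eL : s₁.loc .lo = L := by rw [hF₁.loc .lo rfl]; simp [hL]
    have eH : s₁.loc .hi = H := by rw [hF₁.loc .hi rfl]; simp [hH]
    have eK : s₁.loc .k = K := by rw [hF₁.loc .k rfl]; simp [hK]
    refine wp_call ((ih (N - 1) (by omega) (L := H + 1) (H := s₁.loc .j - 1)
      (K := (s₁.loc .j - 1 - (H + 1)) / 2) ?_ ?_ ?_ (by omega) (by omega) (by omega)).mono ?_)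
    · simp [procs, eH]
    · simp [procs]
    · simp [procs, eH]
    rintro t₂ s₂ - ⟨ht₂, hfr₂, hr₂⟩
    obtain ⟨hr1, hr2⟩ := hr₂
    simp only [] at hfr₂ hr1 hr2
    obtain ⟨v, hv⟩ : ∃ v, v = s₂.loc .res := ⟨_, rfl⟩
    rw [← hv] at hr1 hr2
    have hpart := partition_spec (A := .M) (key := fun y => y) (f := fun z => z)
      (s := ⟨Function.update s₁.loc .v (s₂.loc .res), s₂.mem⟩) (L := L) (H := H) (p := v)
      (by simp [eL]) (by simp [eH]) (by simp [hv]) (by omega) (fun _ _ _ _ => rfl)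
      (fun _ => Nat.le_add_right _ _)
    refine hpart.mono ?_
    rintro t₃ s₃ hF₃ ⟨ht₃, hp₃, ha, hab, hbH, h1, h2, h3⟩
    have eL3 : s₃.loc .lo = L := by rw [hF₃.loc .lo rfl]; simp [eL]
    have eH3 : s₃.loc .hi = H := by rw [hF₃.loc .hi rfl]; simp [eH]
    have eK3 : s₃.loc .k = K := by rw [hF₃.loc .k rfl]; simp [eK]
    have ev3 : s₃.loc .v = v := by rw [hF₃.loc .v rfl]; simp [hv]
    simp only [] at hp₃
    have hc2 : ∀ p, cnt (s₃.mem .M) L H p = cnt (s₁.mem .M) L H p := fun p => by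
      rw [hp₃.cnt_eq]
      exact cnt_congr fun q _ b => by rw [hfr₂ q (by omega)]
    have hc : ∀ p, cnt (s₃.mem .M) L H p = cnt (s.mem .M) L H p := fun p => by
      rw [hc2, hcnt₁]; simp
    have hfr : ∀ q, q < L → s₃.mem .M q = s.mem .M q := fun q hq => by
      rw [hp₃.eq_of_not_mem (by omega), hfr₂ q (by omega), hfr₁ q hq]; simp
    suffices hmain : wp (.ite (.lt (.var .k) (.var .a - .var .lo))
        (.call .res .select [.var .lo, .var .a - 1, .var .k])
        (.ite (.le (.var .k) (.var .b - .var .lo)) (.assign .res (.var .v))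
          (.call .res .select [.var .b + 1, .var .hi, .var .k - (.var .b + 1 - .var .lo)]))) s₃
        (fun t s' => (t : ℤ) ≤ 9000 * (7 * (H - L + 1) / 10 + 5) + 50 ∧
          (∀ q, q < L → s'.mem .M q = s₃.mem .M q) ∧
            HasRank (s₃.mem .M) L H K (s'.loc .res)) by
      refine hmain.mono ?_
      rintro t₄ s₄ - ⟨ht₄, hfr₄, hr⟩
      refine ⟨?_, fun q hq => (hfr₄ q hq).trans (hfr q hq), ?_⟩
      · simp
        omega
      · unfold HasRank at hr ⊢
        rwa [hc, hc] at hr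
    have e1 := cnt_split (f := s₃.mem .M) (lo := L) (hi := H) (m := s₃.loc .a - 1)
      (p := (v ≤ ·)) (by omega) (by omega)
    rw [cnt_none (f := s₃.mem .M) (lo := L) (hi := s₃.loc .a - 1) (p := (v ≤ ·))
      fun q c d => by have := h1 q c (by omega); omega] at e1
    have e2 := cnt_le (f := s₃.mem .M) (lo := s₃.loc .a - 1 + 1) (hi := H) (p := (v ≤ ·))
      (by omega)
    have e3 := cnt_split (f := s₃.mem .M) (lo := L) (hi := H) (m := s₃.loc .b)
      (p := (· ≤ v)) (by omega) (by omega)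
    rw [cnt_none (f := s₃.mem .M) (lo := s₃.loc .b + 1) (hi := H) (p := (· ≤ v))
      fun q c d => by have := h3 q (by omega) d; omega] at e3
    have e4 := cnt_le (f := s₃.mem .M) (lo := L) (hi := s₃.loc .b) (p := (· ≤ v)) (by omega)
    have e5 := hle v
    have e6 := hge v
    have e7 := cnt_compl (f := s₁.mem .M) (lo := H + 1) (hi := s₁.loc .j - 1) (p := (· < v))
      (by omega)
    simp only [not_lt] at e7
    rw [hc2] at e1 e3
    -- At least half of the medians are at most `v`, and at least half are at least `v`. Each
    -- accounts for three cells, up to a total deficit of `4`, so about `3/10` of the cells are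
    -- excluded from either side.
    have hsz1 : s₃.loc .a - L ≤ 7 * (H - L + 1) / 10 + 4 := by omega
    have hsz2 : H - s₃.loc .b ≤ 7 * (H - L + 1) / 10 + 4 := by omega
    rw [wp_ite, wp_ite]
    refine ⟨fun hb1 => ?_, fun hb1 => ⟨fun hb2 => ?_, fun hb2 => ?_⟩⟩
    · simp [eK3, eL3] at hb1
      refine wp_call ((ih (N - 1) (by omega) (L := L) (H := s₃.loc .a - 1) (K := K)
        ?_ ?_ ?_ (by omega) (by omega) (by omega)).mono ?_)
      · simp [procs, eL3]
      · simp [procs]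
      · simp [procs, eK3]
      rintro t₄ s₄ - ⟨ht₄, hfr₄, hr₄⟩
      simp only [] at hfr₄ hr₄
      refine ⟨by simp; omega, hfr₄, ?_⟩
      simp
      refine hasRank_left (v := v) ha (by omega) h1 (fun q c d => ?_) hb1 hr₄
      by_cases hq : q ≤ s₃.loc .b
      · exact (h2 q c hq).ge
      · exact (h3 q (by omega) d).le
    · simp [eK3, eL3] at hb1 hb2
      rw [wp_assign]
      refine ⟨by simp; omega, fun _ _ => rfl, ?_⟩
      simp [ev3]
      constructor
      · have e8 := cnt_split (f := s₃.mem .M) (lo := L) (hi := H) (m := s₃.loc .a - 1)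
          (p := (· < v)) (by omega) (by omega)
        have e9 := cnt_le (f := s₃.mem .M) (lo := L) (hi := s₃.loc .a - 1) (p := (· < v))
          (by omega)
        rw [cnt_none (f := s₃.mem .M) (lo := s₃.loc .a - 1 + 1) (hi := H) (p := (· < v))
          fun q c d => by
            by_cases hq : q ≤ s₃.loc .b
            · have := h2 q (by omega) hq; omega
            · have := h3 q (by omega) d; omega] at e8
        omega
      · have e8 := cnt_split (f := s₃.mem .M) (lo := L) (hi := H) (m := s₃.loc .b)
          (p := (· ≤ v)) (by omega) (by omega)
        have e9 := cnt_all (f := s₃.mem .M) (lo := L) (hi := s₃.loc .b) (p := (· ≤ v))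
          (by omega) fun q c d => by
            by_cases hq : q < s₃.loc .a
            · have := h1 q c hq; omega
            · have := h2 q (by omega) d; omega
        omega
    · simp [eK3, eL3] at hb1 hb2
      refine wp_call ((ih (N - 1) (by omega) (L := s₃.loc .b + 1) (H := H)
        (K := K - (s₃.loc .b + 1 - L)) ?_ ?_ ?_ (by omega) (by omega) (by omega)).mono ?_)
      · simp [procs]
      · simp [procs, eH3]
      · simp [procs, eK3, eL3]
      rintro t₄ s₄ - ⟨ht₄, hfr₄, hr₄⟩
      simp only [] at hfr₄ hr₄
      refine ⟨by simp; omega, fun q hq => hfr₄ q (by omega), ?_⟩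
      simp
      refine hasRank_right (v := v) (by omega) hbH (fun q c d => ?_) h3 (by omega) hr₄
      by_cases hq : q < s₃.loc .a
      · exact (h1 q c hq).le
      · exact (h2 q (by omega) d).le

/-! ### Groups of suffixes -/

theorem cnt_shift (f : ℤ → ℤ) (lo hi m : ℤ) (p : ℤ → Prop) :
    cnt (fun q => f (q - m)) lo hi p = cnt f (lo - m) (hi - m) p := by
  classical
  unfold cnt
  refine Finset.card_equiv (Equiv.subRight m) fun q => ?_
  simp only [Finset.mem_filter, Finset.mem_Icc, Equiv.subRight_apply]
  constructor
  · rintro ⟨⟨h1, h2⟩, h3⟩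
    exact ⟨⟨by omega, by omega⟩, h3⟩
  · rintro ⟨⟨h1, h2⟩, h3⟩
    exact ⟨⟨by omega, by omega⟩, h3⟩

/-- The potential `m log m` of a group of `m` suffixes. -/
def pot (m : ℤ) : ℤ := m * Nat.log 2 m.toNat

theorem pot_nonneg {m : ℤ} (h : 0 ≤ m) : 0 ≤ pot m := mul_nonneg h (by positivity)

theorem pot_le {m N : ℤ} (h₀ : 0 ≤ m) (h : m ≤ N) : pot m ≤ m * Nat.log 2 N.toNat := by
  refine mul_le_mul_of_nonneg_left ?_ h₀
  exact_mod_cast Nat.log_mono_right (Int.toNat_le_toNat h)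

/-- Doubling raises the binary logarithm by one, so a part of at most half the size has `m` units of
potential to spare. This is the gain from splitting at a median. -/
theorem add_pot_le {m N : ℤ} (h₀ : 0 ≤ m) (h : 2 * m ≤ N) :
    m + pot m ≤ m * Nat.log 2 N.toNat := by
  rcases h₀.eq_or_lt with rfl | h1
  · simp [pot]
  have h2 : Nat.log 2 m.toNat + 1 ≤ Nat.log 2 N.toNat := by
    rw [← Nat.log_mul_base (by omega) (by omega)]
    exact Nat.log_mono_right (by omega)
  have h3 : m * (Nat.log 2 m.toNat + 1 : ℤ) ≤ m * Nat.log 2 N.toNat :=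
    mul_le_mul_of_nonneg_left (by exact_mod_cast h2) h₀
  unfold pot
  linarith

/-- The cells `i, …, k - 1` are partitioned into combined sorted groups and unsorted groups, as
described by `len`; `g` is the number of the group of a cell, and `φ` is the total potential of the
unsorted groups. -/
inductive Tiled (g len : ℤ → ℤ) (k : ℤ) : ℤ → ℤ → Prop
  | nil : Tiled g len k k 0
  | sorted {i m φ : ℤ} : 0 < m → len i = -m → (∀ q, i ≤ q → q < i + m → g q = q) →
      Tiled g len k (i + m) φ → Tiled g len k i φ
  | group {i j φ : ℤ} : i < j → 0 ≤ len i → (∀ q, i ≤ q → q ≤ j → g q = j) →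
      Tiled g len k (j + 1) φ → Tiled g len k i (pot (j + 1 - i) + φ)

namespace Tiled
variable {g g' len len' : ℤ → ℤ} {i j k φ ψ : ℤ}

theorem le (h : Tiled g len k i φ) : i ≤ k := by
  induction h with
  | nil => exact le_rfl
  | sorted => omega
  | group => omega

theorem nonneg (h : Tiled g len k i φ) : 0 ≤ φ := by
  induction h with
  | nil => exact le_rfl
  | sorted => assumption
  | group h _ _ _ ih => exact add_nonneg (pot_nonneg (by omega)) ih

theorem trans (h₁ : Tiled g len j i φ) (h₂ : Tiled g len k j ψ) :
    Tiled g len k i (φ + ψ) := by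
  induction h₁ with
  | nil => rwa [zero_add]
  | sorted a b c _ ih => exact .sorted a b c ih
  | group a b c _ ih => rw [add_assoc]; exact .group a b c ih

theorem congr (h : Tiled g len k i φ) (hg : ∀ q, i ≤ q → q < k → g' q = g q)
    (hl : ∀ q, i ≤ q → q < k → len' q = len q) : Tiled g' len' k i φ := by
  induction h with
  | nil => exact .nil
  | sorted a b c d ih =>
    have := d.le
    refine .sorted a ((hl _ le_rfl (by omega)).trans b)
      (fun q h1 h2 => (hg q h1 (by omega)).trans (c q h1 h2))
      (ih (fun q h1 h2 => hg q (by omega) h2) (fun q h1 h2 => hl q (by omega) h2))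
  | group a b c d ih =>
    have := d.le
    refine .group a (by rw [hl _ le_rfl (by omega)]; exact b)
      (fun q h1 h2 => (hg q h1 (by omega)).trans (c q h1 h2))
      (ih (fun q h1 h2 => hg q (by omega) h2) (fun q h1 h2 => hl q (by omega) h2))

/-- A group is numbered by its last cell, so the numbers met in a tiled range stay in that range.
Disjoint ranges of cells thus have disjoint sets of group numbers. -/
theorem mem_Ico (h : Tiled g len k i φ) {q : ℤ} (h₁ : i ≤ q) (h₂ : q < k) :
    q ≤ g q ∧ g q < k := by
  induction h with
  | nil => omega
  | sorted a b c d ih =>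
    rename_i i m φ
    by_cases hq : q < i + m
    · rw [c q h₁ hq]; omega
    · exact ih (by omega)
  | group a b c d ih =>
    rename_i i j φ
    have := d.le
    by_cases hq : q ≤ j
    · rw [c q h₁ hq]; omega
    · exact ih (by omega)

end Tiled

/-- `V'` separates the elements of `D` at least as well as `V` does, if it differs from `V` only in
the suffixes of `f[L..H]`, which had the common group number `top`. -/
theorem refines_of_split {f f' V V' : ℤ → ℤ} {L H top : ℤ} {D : Set ℤ} (hp : PermOn L H f f')
    (hout : ∀ x, (∀ q, L ≤ q → q ≤ H → f q ≠ x) → V' x = V x)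
    (hin : ∀ q, L ≤ q → q ≤ H → (L ≤ V' (f' q) ∧ V' (f' q) ≤ H) ∨ V' (f' q) = top)
    (htop : ∀ q, L ≤ q → q ≤ H → V (f q) = top)
    (hD : ∀ x ∈ D, (∀ q, L ≤ q → q ≤ H → f q ≠ x) → ¬ (L ≤ V x ∧ V x ≤ H))
    {x y : ℤ} (hx : x ∈ D) (hy : y ∈ D) (h : V' x = V' y) : V x = V y := by
  -- A suffix `y` outside the group keeps its number, which is not in `[L, H]`. If the new number of
  -- a member equals it, that number can only be `top`, the old number of the whole group.
  have key : ∀ x y, y ∈ D → V' x = V' y → (∃ q, L ≤ q ∧ q ≤ H ∧ f q = x) →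
      (∀ q, L ≤ q → q ≤ H → f q ≠ y) → V x = V y := by
    rintro x y hy h ⟨q, h1, h2, rfl⟩ hny
    obtain ⟨q', h3, h4, h5⟩ := hp.symm.exists_eq h1 h2
    rw [htop q h1 h2]
    have := hout y hny
    have := hD y hy hny
    rcases hin q' h3 h4 with h6 | h6
    · rw [h5] at h; omega
    · rw [h5] at h; omega
  by_cases h1 : ∃ q, L ≤ q ∧ q ≤ H ∧ f q = x
  · by_cases h2 : ∃ q, L ≤ q ∧ q ≤ H ∧ f q = y
    · obtain ⟨q, a, b, rfl⟩ := h1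
      obtain ⟨q', a', b', rfl⟩ := h2
      rw [htop q a b, htop q' a' b']
    · push Not at h2
      exact key x y hy h h1 h2
  · push Not at h1
    by_cases h2 : ∃ q, L ≤ q ∧ q ≤ H ∧ f q = y
    · exact (key y x hx h.symm h2 h1).symm
    · push Not at h2
      rw [← hout x h1, ← hout y h2, h]

/-- The suffixes of `sfx[L..H]` have a common group number, and no other elements of `D`, which
contains all the positions at which keys are looked up, have group numbers in `[L, H]`. -/
def Isolated (s : State) (L H h : ℤ) : Prop :=
  ∃ (D : Set ℤ) (top : ℤ), H ≤ top ∧ (∀ q, L ≤ q → q ≤ H → s.mem .sfx q + h ∈ D) ∧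
    (∀ q, L ≤ q → q ≤ H → s.mem .V (s.mem .sfx q) = top) ∧
    ∀ x ∈ D, (∀ q, L ≤ q → q ≤ H → s.mem .sfx q ≠ x) → ¬ (L ≤ s.mem .V x ∧ s.mem .V x ≤ H)

/-- The effect of splitting `sfx[L..H]` by the keys `V[q + h]`. -/
structure Split (s s' : State) (L H h φ : ℤ) : Prop where
  perm : PermOn L H (s.mem .sfx) (s'.mem .sfx)
  len : ∀ q, q < L ∨ H < q → s'.mem .len q = s.mem .len q
  V : ∀ x, (∀ q, L ≤ q → q ≤ H → s.mem .sfx q ≠ x) → s'.mem .V x = s.mem .V x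
  tiled : Tiled (fun q => s'.mem .V (s'.mem .sfx q)) (s'.mem .len) (H + 1) L φ
  keys : (h = 0 ∨ Isolated s L H h) → ∀ q q', L ≤ q → q ≤ H → L ≤ q' → q' ≤ H →
    s'.mem .V (s'.mem .sfx q) = s'.mem .V (s'.mem .sfx q') →
    s.mem .V (s'.mem .sfx q + h) = s.mem .V (s'.mem .sfx q' + h)

theorem Split.of_mem_eq {s₁ s₂ s₁' s₂' : State} {L H h φ : ℤ} (hs : Split s₁ s₂ L H h φ)
    (h₁ : s₁'.mem = s₁.mem) (h₂ : s₂'.mem = s₂.mem) : Split s₁' s₂' L H h φ := by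
  obtain ⟨a, b, c, d, e⟩ := hs
  unfold Isolated at e
  rw [← h₁] at a b c e
  rw [← h₂] at a b c d e
  exact ⟨a, b, c, d, e⟩

theorem Split.empty (s : State) {L H : ℤ} (h : ℤ) (hLH : H + 1 = L) : Split s s L H h 0 where
  perm := .refl _ _ _
  len _ _ := rfl
  V _ _ := rfl
  tiled := hLH ▸ .nil
  keys _ q := by omega

theorem Split.mem_range {s s' : State} {L H h φ : ℤ} (hs : Split s s' L H h φ) {q : ℤ}
    (h₁ : L ≤ q) (h₂ : q ≤ H) :
    L ≤ s'.mem .V (s'.mem .sfx q) ∧ s'.mem .V (s'.mem .sfx q) ≤ H := by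
  have := hs.tiled.mem_Ico h₁ (by omega)
  omega

theorem updateGroup_spec {s : State} {L H : ℤ} (hL : s.loc .lo = L) (hH : s.loc .hi = H)
    (hLH : L ≤ H) : wp updateGroupBody s (fun t s' => (t : ℤ) ≤ 20 * (H - L + 1) + 30 ∧
      (∀ x, (∀ q, L ≤ q → q ≤ H → s.mem .sfx q ≠ x) → s'.mem .V x = s.mem .V x) ∧
      (∀ q, L ≤ q → q ≤ H → s'.mem .V (s.mem .sfx q) = H) ∧
      s'.mem .len = Function.update (s.mem .len) L (if L = H then -1 else H - L + 1)) := by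
  unfold updateGroupBody
  simp only [wp_seq, wp_assign]
  refine (wp_while (fun B s' => L ≤ s'.loc .i ∧ s'.loc .i ≤ H + 1 ∧
      (∀ x, (∀ q, L ≤ q → q ≤ H → s.mem .sfx q ≠ x) → s'.mem .V x = s.mem .V x) ∧
      (∀ q, L ≤ q → q < s'.loc .i → s'.mem .V (s.mem .sfx q) = H) ∧
      B = (H + 1 - s'.loc .i) * 20 + 10) (B₀ := (H + 1 - L) * 20 + 10) (Post := fun s' =>
      (∀ x, (∀ q, L ≤ q → q ≤ H → s.mem .sfx q ≠ x) → s'.mem .V x = s.mem .V x) ∧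
      (∀ q, L ≤ q → q ≤ H → s'.mem .V (s.mem .sfx q) = H)) ?_ ?_ ?_).mono ?_
  · simp [hL]
    exact ⟨by omega, by intros; omega⟩
  · rintro B s₁ hF ⟨h1, h2, hV, hg, rfl⟩ hb
    have eH : s₁.loc .hi = H := by rw [hF.loc .hi rfl]; simp [hH]
    have es : s₁.mem .sfx = s.mem .sfx := by rw [hF.mem .sfx rfl]; simp
    simp [eH] at hb
    simp [eH, es]
    refine ⟨by omega, by omega, by omega, by omega, fun x hx => ?_, fun q a b => ?_⟩
    · rw [Function.update_of_ne (fun e => hx _ h1 hb e.symm), hV x hx]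
    · rw [Function.update_apply]
      split_ifs with c
      · rfl
      · exact hg q a (lt_of_le_of_ne b (by rintro rfl; exact c rfl))
  · rintro B s₁ hF ⟨h1, h2, hV, hg, rfl⟩ hb
    have eH : s₁.loc .hi = H := by rw [hF.loc .hi rfl]; simp [hH]
    simp [eH] at hb
    exact ⟨by simp; omega, hV, fun q a b => hg q a (by omega)⟩
  · rintro t₁ s₁ hF ⟨ht, hV, hg⟩
    have eH : s₁.loc .hi = H := by rw [hF.loc .hi rfl]; simp [hH]
    have eL : s₁.loc .lo = L := by rw [hF.loc .lo rfl]; simp [hL]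
    have el : s₁.mem .len = s.mem .len := by rw [hF.mem .len rfl]; simp
    simp [eH, eL, el]
    refine ⟨fun h => ⟨by omega, hV, hg, by rw [if_pos h]⟩,
      fun h => ⟨by omega, hV, hg, by rw [if_neg h]⟩⟩

/-- Three parts of a split put together: the suffixes with small keys are split, those with the key
`v` form a group, and those with large keys are split. -/
theorem Split.combine {s s₂ s₃ s₄ s₅ : State} {L H a b h v φ₁ φ₂ : ℤ}
    (hV2 : s₂.mem .V = s.mem .V) (hl2 : s₂.mem .len = s.mem .len)
    (hs4 : s₄.mem .sfx = s₃.mem .sfx) (inj : Set.InjOn (s.mem .sfx) (Set.Icc L H))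
    (hp : PermOn L H (s.mem .sfx) (s₂.mem .sfx)) (hLa : L ≤ a) (hab : a ≤ b) (hbH : b ≤ H)
    (k1 : ∀ q, a ≤ q → q ≤ b → s.mem .V (s₂.mem .sfx q + h) = v)
    (left : Split s₂ s₃ L (a - 1) h φ₁)
    (hV4 : ∀ x, (∀ q, a ≤ q → q ≤ b → s₃.mem .sfx q ≠ x) → s₄.mem .V x = s₃.mem .V x)
    (hg4 : ∀ q, a ≤ q → q ≤ b → s₄.mem .V (s₃.mem .sfx q) = b)
    (hl4 : s₄.mem .len = Function.update (s₃.mem .len) a (if a = b then -1 else b - a + 1))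
    (right : Split s₄ s₅ (b + 1) H h φ₂) :
    ∃ φ, φ ≤ φ₁ + pot (b + 1 - a) + φ₂ ∧ Split s s₅ L H h φ := by
  have p3 : PermOn L H (s.mem .sfx) (s₃.mem .sfx) :=
    hp.trans (left.perm.mono le_rfl (by omega))
  have p5 : PermOn L H (s.mem .sfx) (s₅.mem .sfx) := by
    have := right.perm.mono (lo' := L) (hi' := H) (by omega) le_rfl
    rw [hs4] at this
    exact p3.trans this
  have inj3 := p3.injOn le_rfl le_rfl inj
  have inj2 := hp.injOn le_rfl le_rfl inj
  have e53 : ∀ q, q ≤ b → s₅.mem .sfx q = s₃.mem .sfx q := fun q hq => by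
    rw [right.perm.eq_of_not_mem (by omega), hs4]
  have e32 : ∀ q, a ≤ q → s₃.mem .sfx q = s₂.mem .sfx q := fun q hq =>
    left.perm.eq_of_not_mem (by omega)
  have out2 : ∀ x, (∀ q, L ≤ q → q ≤ H → s.mem .sfx q ≠ x) →
      ∀ q, L ≤ q → q ≤ H → s₂.mem .sfx q ≠ x := fun x hx q c d => by
    obtain ⟨q', c', d', e⟩ := hp.exists_eq c d
    exact e ▸ hx q' c' d'
  have out3 : ∀ x, (∀ q, L ≤ q → q ≤ H → s.mem .sfx q ≠ x) →
      ∀ q, L ≤ q → q ≤ H → s₃.mem .sfx q ≠ x := fun x hx q c d => by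
    obtain ⟨q', c', d', e⟩ := p3.exists_eq c d
    exact e ▸ hx q' c' d'
  have out4 : ∀ x, (∀ q, L ≤ q → q ≤ H → s.mem .sfx q ≠ x) → s₄.mem .V x = s.mem .V x := by
    intro x hx
    rw [hV4 x fun q c d => out3 x hx q (by omega) (by omega),
      left.V x fun q c d => out2 x hx q (by omega) (by omega), hV2]
  -- the group numbers of the three parts
  have gl4 : ∀ q, L ≤ q → q < a → s₄.mem .V (s₃.mem .sfx q) = s₃.mem .V (s₃.mem .sfx q) := by
    intro q c d
    refine hV4 _ fun q' c' d' e => ?_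
    have := inj3 (Set.mem_Icc.2 ⟨by omega, by omega⟩) (Set.mem_Icc.2 ⟨by omega, by omega⟩) e
    omega
  have g54 : ∀ q, L ≤ q → q ≤ b → s₅.mem .V (s₃.mem .sfx q) = s₄.mem .V (s₃.mem .sfx q) := by
    intro q c d
    refine right.V _ fun q' c' d' e => ?_
    rw [hs4] at e
    have := inj3 (Set.mem_Icc.2 ⟨by omega, by omega⟩) (Set.mem_Icc.2 ⟨by omega, by omega⟩) e
    omega
  have gr4 : ∀ q, b < q → q ≤ H → s₄.mem .V (s₃.mem .sfx q) = s.mem .V (s₃.mem .sfx q) := by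
    intro q c d
    rw [hV4 _ fun q' c' d' e => ?_, left.V _ fun q' c' d' e => ?_, hV2]
    · rw [e32 q (by omega)] at e
      have := inj2 (Set.mem_Icc.2 ⟨by omega, by omega⟩) (Set.mem_Icc.2 ⟨by omega, by omega⟩) e
      omega
    · have := inj3 (Set.mem_Icc.2 ⟨by omega, by omega⟩) (Set.mem_Icc.2 ⟨by omega, by omega⟩) e
      omega
  have gl : ∀ q, L ≤ q → q < a → s₅.mem .V (s₅.mem .sfx q) = s₃.mem .V (s₃.mem .sfx q) := by
    intro q c d
    rw [e53 q (by omega), g54 q c (by omega), gl4 q c d]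
  have gm : ∀ q, a ≤ q → q ≤ b → s₅.mem .V (s₅.mem .sfx q) = b := by
    intro q c d
    rw [e53 q (by omega), g54 q (by omega) d, hg4 q c d]
  -- the tiling
  have tl : Tiled (fun q => s₅.mem .V (s₅.mem .sfx q)) (s₅.mem .len) a L φ₁ := by
    have := left.tiled
    rw [sub_add_cancel] at this
    refine this.congr (fun q c d => gl q c d) fun q c d => ?_
    rw [right.len q (by omega), hl4, Function.update_of_ne (by omega)]
  obtain ⟨φm, hφm, tm⟩ : ∃ φm, φm ≤ pot (b + 1 - a) ∧
      Tiled (fun q => s₅.mem .V (s₅.mem .sfx q)) (s₅.mem .len) (b + 1) a φm := by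
    have hlen : s₅.mem .len a = if a = b then -1 else b - a + 1 := by
      rw [right.len a (by omega), hl4, Function.update_self]
    by_cases hc : a = b
    · refine ⟨0, pot_nonneg (by omega), .sorted (m := 1) (by omega) ?_ ?_ ?_⟩
      · rw [hlen, if_pos hc]
      · intro q c d
        have := gm q c (by omega)
        omega
      · rw [hc]; exact .nil
    · refine ⟨pot (b + 1 - a) + 0, by omega, .group (j := b) (by omega) ?_ gm .nil⟩
      rw [hlen, if_neg hc]
      omega
  refine ⟨φ₁ + φm + φ₂, by omega, p5, ?_, ?_, (tl.trans tm).trans right.tiled, ?_⟩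
  · intro q hq
    rw [right.len q (by omega), hl4, Function.update_of_ne (by omega), left.len q (by omega), hl2]
  · intro x hx
    rw [right.V x fun q c d => ?_, out4 x hx]
    rw [hs4]
    exact out3 x hx q (by omega) d
  · intro hiso q q' hq1 hq2 hq1' hq2' e
    -- The suffixes of the other two parts still carry `top`, and `top ≥ H ≥ a`, so their numbers
    -- lie outside `[L, a - 1]`.
    have hleft : h = 0 ∨ Isolated s₂ L (a - 1) h := by
      refine hiso.imp_right ?_
      rintro ⟨D, top, ht, hD, htop, hsep⟩
      refine ⟨D, top, by omega, fun q c d => ?_, fun q c d => ?_, fun x hx hn => ?_⟩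
      · obtain ⟨q', c', d', e⟩ := hp.exists_eq c (by omega)
        rw [e]; exact hD q' c' d'
      · obtain ⟨q', c', d', e⟩ := hp.exists_eq c (by omega)
        rw [e, hV2]; exact htop q' c' d'
      · rw [hV2]
        by_cases hin : ∃ q, L ≤ q ∧ q ≤ H ∧ s.mem .sfx q = x
        · obtain ⟨q, c, d, rfl⟩ := hin
          rw [htop q c d]
          omega
        · push Not at hin
          have := hsep x hx hin
          omega
    -- By now the first two parts have received new numbers. These are at most `b`, hence outside
    -- `[b + 1, H]`, and the right part still has the number `top`.
    have hright : h = 0 ∨ Isolated s₄ (b + 1) H h := by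
      refine hiso.imp_right ?_
      rintro ⟨D, top, ht, hD, htop, hsep⟩
      refine ⟨D, top, ht, fun q c d => ?_, fun q c d => ?_, fun x hx hn => ?_⟩
      · obtain ⟨q', c', d', e⟩ := p3.exists_eq (q := q) (by omega) d
        rw [hs4, e]; exact hD q' c' d'
      · rw [hs4, gr4 q (by omega) d]
        obtain ⟨q', c', d', e⟩ := p3.exists_eq (q := q) (by omega) d
        rw [e]; exact htop q' c' d'
      · rw [hs4] at hn
        by_cases hin : ∃ q, L ≤ q ∧ q ≤ H ∧ s.mem .sfx q = x
        · obtain ⟨q, c, d, rfl⟩ := hin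
          obtain ⟨q', c', d', e⟩ := p3.symm.exists_eq c d
          rw [e] at hn ⊢
          by_cases h1 : q' < a
          · rw [gl4 q' c' h1]
            have := left.mem_range c' (by omega)
            omega
          · by_cases h2 : q' ≤ b
            · rw [hg4 q' (by omega) h2]; omega
            · exact absurd rfl (hn q' (by omega) d')
        · push Not at hin
          rw [out4 x hin]
          have := hsep x hx hin
          omega
    -- The right part is split by keys that may have been renumbered already. Equal renumbered keys
    -- were equal before: for `h = 0` because the right part has not been touched yet, otherwise by
    -- `refines_of_split`.
    have step : ∀ x y, (∃ q, b + 1 ≤ q ∧ q ≤ H ∧ s₅.mem .sfx q = x) →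
        (∃ q, b + 1 ≤ q ∧ q ≤ H ∧ s₅.mem .sfx q = y) → s₄.mem .V (x + h) = s₄.mem .V (y + h) →
        s.mem .V (x + h) = s.mem .V (y + h) := by
      rintro x y ⟨q, c, d, rfl⟩ ⟨q', c', d', rfl⟩ e
      rcases hiso with rfl | ⟨D, top, ht, hD, htop, hsep⟩
      · obtain ⟨z, z1, z2, z3⟩ := right.perm.exists_eq c d
        obtain ⟨z', z1', z2', z3'⟩ := right.perm.exists_eq c' d'
        rw [z3, z3', hs4, add_zero, add_zero, gr4 z (by omega) z2, gr4 z' (by omega) z2'] at e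
        rw [z3, z3', hs4, add_zero, add_zero, e]
      · refine refines_of_split (D := D) p3 out4 (fun z z1 z2 => ?_) htop hsep ?_ ?_ e
        · by_cases h1 : z < a
          · rw [gl4 z z1 h1]
            have := left.mem_range z1 (by omega)
            omega
          · by_cases h2 : z ≤ b
            · rw [hg4 z (by omega) h2]; omega
            · obtain ⟨q', c', d', e⟩ := p3.exists_eq (q := z) (by omega) z2
              rw [gr4 z (by omega) z2, e, htop q' c' d']
              exact .inr rfl
        · obtain ⟨z, z1, z2, z3⟩ := p5.exists_eq (q := q) (by omega) d
          rw [z3]; exact hD z z1 z2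
        · obtain ⟨z, z1, z2, z3⟩ := p5.exists_eq (q := q') (by omega) d'
          rw [z3]; exact hD z z1 z2
    -- The three parts use disjoint ranges of numbers, so equal numbers occur only within one part.
    have part : ∀ q, L ≤ q → q ≤ H →
        (q < a ∧ L ≤ s₅.mem .V (s₅.mem .sfx q) ∧ s₅.mem .V (s₅.mem .sfx q) < a) ∨
        (a ≤ q ∧ q ≤ b ∧ s₅.mem .V (s₅.mem .sfx q) = b) ∨
        (b < q ∧ b < s₅.mem .V (s₅.mem .sfx q)) := by
      intro q c d
      by_cases h1 : q < a
      · have := left.mem_range c (by omega)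
        rw [gl q c h1]
        omega
      · by_cases h2 : q ≤ b
        · have := gm q (by omega) h2
          omega
        · have := right.mem_range (q := q) (by omega) d
          omega
    rcases part q hq1 hq2 with h1 | h1 | h1 <;> rcases part q' hq1' hq2' with h2 | h2 | h2 <;>
      try omega
    · rw [gl q hq1 h1.1, gl q' hq1' h2.1] at e
      have := left.keys hleft q q' hq1 (by omega) hq1' (by omega) e
      rwa [hV2, ← e53 q (by omega), ← e53 q' (by omega)] at this
    · rw [e53 q (by omega), e53 q' (by omega), e32 q (by omega), e32 q' (by omega),
        k1 q (by omega) (by omega), k1 q' (by omega) (by omega)]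
    · exact step _ _ ⟨q, by omega, hq2, rfl⟩ ⟨q', by omega, hq2', rfl⟩
        (right.keys hright q q' (by omega) hq2 (by omega) hq2' e)

/-! ### Splitting a group -/

/-- The time plus the potential of the resulting groups is covered by the potential of the group
plus a linear term. The outer parts have at most half the size, so `add_pot_le` pays for their
recursive calls in full, linear terms included; the middle part keeps at most its share of `m log
m`; and `10000 m` covers selection, ternary split and renumbering. -/
theorem sortSplit_spec {s : State} {L H h : ℤ} (hL : s.loc .lo = L) (hH : s.loc .hi = H)
    (hh : s.loc .h = h) (hLH : L ≤ H) (inj : Set.InjOn (s.mem .sfx) (Set.Icc L H)) :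
    wp sortSplitBody s (fun t s' => ∃ φ, (t : ℤ) + 10000 * φ ≤
      10000 * (H - L + 1 + pot (H - L + 1)) ∧ Split s s' L H h φ) := by
  obtain ⟨N, hN⟩ : ∃ N : ℕ, H - L + 1 ≤ N := ⟨(H - L + 1).toNat, Int.self_le_toNat _⟩
  induction N using Nat.strong_induction_on generalizing s L H with
  | _ N ih =>
  have call : ∀ (s : State) (e f : Expr) (L' H' : ℤ), e.eval s = L' → f.eval s = H' →
      s.loc .h = h → Set.InjOn (s.mem .sfx) (Set.Icc L' H') → H' - L' < H - L → L' ≤ H' →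
      e.cost ≤ 3 → f.cost ≤ 3 → wp (run .sortSplit [e, f, .var .h]) s
        (fun t s' => ∃ φ, (t : ℤ) + 10000 * φ ≤
          10000 * (H' - L' + 1 + pot (H' - L' + 1)) + 10 ∧ Split s s' L' H' h φ) := by
    intro s e f L' H' he hf hh inj hlt hle ce cf
    refine wp_call ((ih (N - 1) (by omega) (L := L') (H := H') ?_ ?_ ?_ hle ?_
      (by omega)).mono ?_)
    · simp [procs, he]
    · simp [procs, hf]
    · simp [procs, hh]
    · exact inj
    rintro t s' - ⟨φ, ht, hs⟩
    refine ⟨φ, ?_, hs.of_mem_eq rfl rfl⟩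
    simp
    omega
  unfold sortSplitBody
  simp only [wp_seq, wp_assign]
  refine (wp_while (fun B s' => L ≤ s'.loc .i ∧ s'.loc .i ≤ H + 1 ∧
      (∀ q, L ≤ q → q < s'.loc .i → s'.mem .M (q - L) = s.mem .V (s.mem .sfx q + h)) ∧
      B = (H + 1 - s'.loc .i) * 20 + 10) (B₀ := (H + 1 - L) * 20 + 10) (Post := fun s' =>
      ∀ q, L ≤ q → q ≤ H → s'.mem .M (q - L) = s.mem .V (s.mem .sfx q + h)) ?_ ?_ ?_).mono ?_
  · simp [hL]
    exact ⟨by omega, by intros; omega⟩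
  · rintro B s₁ hF ⟨h1, h2, hM, rfl⟩ hb
    have eH : s₁.loc .hi = H := by rw [hF.loc .hi rfl]; simp [hH]
    have eL : s₁.loc .lo = L := by rw [hF.loc .lo rfl]; simp [hL]
    have eh : s₁.loc .h = h := by rw [hF.loc .h rfl]; simp [hh]
    have es : s₁.mem .sfx = s.mem .sfx := by rw [hF.mem .sfx rfl]; simp
    have eV : s₁.mem .V = s.mem .V := by rw [hF.mem .V rfl]; simp
    simp [eH] at hb
    simp [eL, es, eV, eh]
    refine ⟨by omega, by omega, by omega, by omega, fun q a b => ?_⟩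
    rw [Function.update_apply]
    split_ifs with c
    · rw [show q = s₁.loc .i by omega]
    · exact hM q a (by omega)
  · rintro B s₁ hF ⟨h1, h2, hM, rfl⟩ hb
    have eH : s₁.loc .hi = H := by rw [hF.loc .hi rfl]; simp [hH]
    simp [eH] at hb
    exact ⟨by simp; omega, fun q a b => hM q a (by omega)⟩
  rintro t₁ s₁ hF₁ ⟨ht₁, hM⟩
  have eH : s₁.loc .hi = H := by rw [hF₁.loc .hi rfl]; simp [hH]
  have eL : s₁.loc .lo = L := by rw [hF₁.loc .lo rfl]; simp [hL]
  have eh : s₁.loc .h = h := by rw [hF₁.loc .h rfl]; simp [hh]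
  have es : s₁.mem .sfx = s.mem .sfx := by rw [hF₁.mem .sfx rfl]; simp
  have eV : s₁.mem .V = s.mem .V := by rw [hF₁.mem .V rfl]; simp
  have el : s₁.mem .len = s.mem .len := by rw [hF₁.mem .len rfl]; simp
  -- the median
  refine wp.mono (Q := fun t s' => (t : ℤ) ≤ 9000 * (H - L + 1) + 20 ∧
    HasRank (s₁.mem .M) 0 (H - L) ((H - L) / 2) (s'.loc .v)) ?_ ?_
  · refine wp_call ((select_spec (L := 0) (H := H - L) (K := (H - L) / 2) ?_ ?_ ?_ (by omega)
      (by omega)).mono ?_)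
    · simp [procs]
    · simp [procs, eL, eH]
    · simp [procs, eL, eH]
    rintro t₂ s₂ - ⟨ht, -, hr⟩
    refine ⟨by simp; omega, ?_⟩
    simpa using hr
  rintro t₂ s₂ hF₂ ⟨ht₂, hr1, hr2⟩
  have eH : s₂.loc .hi = H := by rw [hF₂.loc .hi rfl]; simp [eH]
  have eL : s₂.loc .lo = L := by rw [hF₂.loc .lo rfl]; simp [eL]
  have eh : s₂.loc .h = h := by rw [hF₂.loc .h rfl]; simp [eh]
  have es : s₂.mem .sfx = s.mem .sfx := by rw [hF₂.mem .sfx rfl, es]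
  have eV : s₂.mem .V = s.mem .V := by rw [hF₂.mem .V rfl, eV]
  have el : s₂.mem .len = s.mem .len := by rw [hF₂.mem .len rfl, el]
  have hcnt : ∀ p, cnt (s₁.mem .M) 0 (H - L) p =
      cnt (s.mem .sfx) L H (fun z => p (s.mem .V (z + h))) := fun p => by
    have := cnt_shift (s₁.mem .M) L H L p
    rw [sub_self] at this
    rw [← this]
    exact cnt_congr fun q a b => by rw [hM q a b]
  obtain ⟨v, hv⟩ : ∃ v, v = s₂.loc .v := ⟨_, rfl⟩
  rw [← hv, hcnt] at hr1 hr2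
  -- the ternary split
  refine (partition_spec (A := .sfx) (f := fun z => s.mem .V (z + h)) (L := L) (H := H) (p := v)
    eL eH hv.symm (by omega) ?_ ?_).mono ?_
  · intro s' hm hl e
    simp [hm .V (by decide), hl, eV, eh]
  · intro e
    simp
  rintro t₃ s₃ hF₃ ⟨ht₃, hp, hLa, hab', hbH, k1, k2, k3⟩
  have eH : s₃.loc .hi = H := by rw [hF₃.loc .hi rfl, eH]
  have eL : s₃.loc .lo = L := by rw [hF₃.loc .lo rfl, eL]
  have eh : s₃.loc .h = h := by rw [hF₃.loc .h rfl, eh]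
  have eV : s₃.mem .V = s.mem .V := by rw [hF₃.mem .V rfl, eV]
  have el : s₃.mem .len = s.mem .len := by rw [hF₃.mem .len rfl, el]
  rw [es] at hp
  rw [← hp.cnt_eq] at hr1 hr2
  obtain ⟨a, ha⟩ : ∃ a, a = s₃.loc .a := ⟨_, rfl⟩
  obtain ⟨b, hb⟩ : ∃ b, b = s₃.loc .b := ⟨_, rfl⟩
  rw [← ha] at hLa hab' k1 k2
  rw [← hb] at hab' hbH k2 k3
  -- All `a - L` keys on the left are less than the median, and by its rank at most `(H - L) / 2`
  -- keys are.
  have hsz1 : 2 * (a - L) ≤ H - L + 1 := by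
    have e1 := cnt_split (f := s₃.mem .sfx) (lo := L) (hi := H) (m := a - 1)
      (p := fun z => s.mem .V (z + h) < v) (by omega) (by omega)
    have e2 := cnt_all (f := s₃.mem .sfx) (lo := L) (hi := a - 1)
      (p := fun z => s.mem .V (z + h) < v) (by omega) fun q c d => k1 q c (by omega)
    omega
  have e3 := cnt_split (f := s₃.mem .sfx) (lo := L) (hi := H) (m := b)
    (p := fun z => s.mem .V (z + h) ≤ v) (by omega) (by omega)
  have e4 := cnt_none (f := s₃.mem .sfx) (lo := b + 1) (hi := H)
    (p := fun z => s.mem .V (z + h) ≤ v) fun q c d => by have := k3 q (by omega) d; omega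
  have e5 := cnt_le (f := s₃.mem .sfx) (lo := L) (hi := b)
    (p := fun z => s.mem .V (z + h) ≤ v) (by omega)
  have hsz2 : 2 * (H - b) ≤ H - L + 1 := by omega
  -- The rank separates the number of keys below `v` from the number of keys up to `v`, so `v` is
  -- one of the keys and the middle group is not empty.
  have hab : a ≤ b := by
    have e1 := cnt_split (f := s₃.mem .sfx) (lo := L) (hi := H) (m := a - 1)
      (p := fun z => s.mem .V (z + h) < v) (by omega) (by omega)
    have e2 := cnt_all (f := s₃.mem .sfx) (lo := L) (hi := a - 1)
      (p := fun z => s.mem .V (z + h) < v) (by omega) fun q c d => k1 q c (by omega)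
    omega
  have inj3 := hp.injOn le_rfl le_rfl inj
  -- small keys
  refine wp.mono (Q := fun t s' => ∃ φ, (t : ℤ) + 10000 * φ ≤
    10000 * (a - L + pot (a - L)) + 50 ∧ Split s₃ s' L (a - 1) h φ) ?_ ?_
  · unfold when
    rw [wp_ite, wp_skip]
    simp only [beval_lt, eval_var, eL, ← ha]
    refine ⟨fun hlt => ?_, fun hlt => ⟨0, ?_, Split.empty _ _ (by omega)⟩⟩
    · refine (call s₃ _ _ L (a - 1) ?_ ?_ eh (inj3.mono ?_) (by omega) (by omega) ?_ ?_).mono ?_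
      · simp [eL]
      · simp [ha]
      · exact Set.Icc_subset_Icc le_rfl (by omega)
      · simp
      · simp
      rintro t s' - ⟨φ, ht, hs⟩
      refine ⟨φ, ?_, hs⟩
      rw [show a - 1 - L + 1 = a - L by ring] at ht
      simp
      omega
    · rw [show a - L = 0 by omega]
      simp [pot]
  rintro t₄ s₄ hF₄ ⟨φ₁, ht₄, left⟩
  have ea4 : s₄.loc .a = a := by rw [hF₄.loc .a rfl, ha]
  have eb4 : s₄.loc .b = b := by rw [hF₄.loc .b rfl, hb]
  have eH4 : s₄.loc .hi = H := by rw [hF₄.loc .hi rfl, eH]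
  have eh4 : s₄.loc .h = h := by rw [hF₄.loc .h rfl, eh]
  -- the group with the key `v`
  refine wp.mono (Q := fun t s' => (t : ℤ) ≤ 20 * (b - a + 1) + 40 ∧
      (∀ x, (∀ q, a ≤ q → q ≤ b → s₄.mem .sfx q ≠ x) → s'.mem .V x = s₄.mem .V x) ∧
      (∀ q, a ≤ q → q ≤ b → s'.mem .V (s₄.mem .sfx q) = b) ∧
      s'.mem .len = Function.update (s₄.mem .len) a (if a = b then -1 else b - a + 1)) ?_ ?_
  · refine wp_call ((updateGroup_spec (L := a) (H := b) ?_ ?_ hab).mono ?_)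
    · simp [procs, ea4]
    · simp [procs, eb4]
    rintro t₅ s₅ - ⟨ht, h⟩
    exact ⟨by simp; omega, h⟩
  rintro t₅ s₅ hF₅ ⟨ht₅, hV5, hg5, hl5⟩
  have eb5 : s₅.loc .b = b := by rw [hF₅.loc .b rfl, eb4]
  have eH5 : s₅.loc .hi = H := by rw [hF₅.loc .hi rfl, eH4]
  have eh5 : s₅.loc .h = h := by rw [hF₅.loc .h rfl, eh4]
  have es5 : s₅.mem .sfx = s₄.mem .sfx := hF₅.mem .sfx rfl
  have inj5 : Set.InjOn (s₅.mem .sfx) (Set.Icc L H) := by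
    rw [es5]
    exact left.perm.injOn le_rfl (by omega) inj3
  -- large keys
  refine wp.mono (Q := fun t s' => ∃ φ, (t : ℤ) + 10000 * φ ≤
    10000 * (H - b + pot (H - b)) + 50 ∧ Split s₅ s' (b + 1) H h φ) ?_ ?_
  · unfold when
    rw [wp_ite, wp_skip]
    simp only [beval_lt, eval_var, eH5, eb5]
    refine ⟨fun hlt => ?_, fun hlt => ⟨0, ?_, Split.empty _ _ (by omega)⟩⟩
    · refine (call s₅ _ _ (b + 1) H ?_ ?_ eh5 (inj5.mono ?_) (by omega) (by omega) ?_ ?_).mono ?_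
      · simp [eb5]
      · simp [eH5]
      · exact Set.Icc_subset_Icc (by omega) le_rfl
      · simp
      · simp
      rintro t s' - ⟨φ, ht, hs⟩
      refine ⟨φ, ?_, hs⟩
      rw [show H - (b + 1) + 1 = H - b by ring] at ht
      simp
      omega
    · rw [show H - b = 0 by omega]
      simp [pot]
  rintro t₆ s₆ - ⟨φ₂, ht₆, right⟩
  obtain ⟨φ, hφ, hs⟩ := Split.combine eV el es5 inj hp hLa hab hbH k2 left hV5 hg5 hl5 right
  refine ⟨φ, ?_, hs⟩
  have p1 := add_pot_le (m := a - L) (N := H - L + 1) (by omega) hsz1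
  have p2 := pot_le (m := b + 1 - a) (N := H - L + 1) (by omega) (by omega)
  have p3 := add_pot_le (m := H - b) (N := H - L + 1) (by omega) hsz2
  have p4 : pot (H - L + 1) = (a - L) * Nat.log 2 (H - L + 1).toNat +
      (b + 1 - a) * Nat.log 2 (H - L + 1).toNat + (H - b) * Nat.log 2 (H - L + 1).toNat := by
    unfold pot; ring
  simp
  omega

/-! ### Suffix sorting -/

/-- The array `w` contains a string of length `n`, followed by a terminator. -/
def Terminated (w : ℤ → ℤ) (n : ℤ) : Prop :=
  (∀ q, 1 ≤ q → q ≤ n → w q ≠ 0) ∧ w (n + 1) = 0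

/-- Suffixes with the same group number have the same first `h` symbols. -/
def Agree (w V : ℤ → ℤ) (n h : ℤ) : Prop :=
  ∀ x y, 1 ≤ x → x ≤ n + 1 → 1 ≤ y → y ≤ n + 1 → V x = V y →
    ∀ o, 0 ≤ o → o < h → w (x + o) = w (y + o)

/-- If the agreement reached past the terminator of the later suffix, the earlier one would have a
proper symbol there, which is not `0`. This keeps the lookups at `q + h` within the suffixes, and it
makes all groups singletons once `h > n`. -/
theorem Terminated.add_le {w : ℤ → ℤ} {n h x y : ℤ} (hw : Terminated w n) (hx₁ : 1 ≤ x)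
    (hx₂ : x ≤ n + 1) (hy₁ : 1 ≤ y) (hy₂ : y ≤ n + 1) (hxy : x ≠ y)
    (h₁ : ∀ o, 0 ≤ o → o < h → w (x + o) = w (y + o)) : x + h ≤ n + 1 ∧ y + h ≤ n + 1 := by
  rcases lt_or_gt_of_ne hxy with h2 | h2
  · suffices y + h ≤ n + 1 by omega
    by_contra hn
    have := h₁ (n + 1 - y) (by omega) (by omega)
    rw [show y + (n + 1 - y) = n + 1 by ring, hw.2] at this
    exact hw.1 _ (by omega) (by omega) this
  · suffices x + h ≤ n + 1 by omega
    by_contra hn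
    have := h₁ (n + 1 - x) (by omega) (by omega)
    rw [show x + (n + 1 - x) = n + 1 by ring, hw.2] at this
    exact hw.1 _ (by omega) (by omega) this.symm

/-- The cells `0, …, n` of `f` contain the numbers `1, …, n + 1`. -/
structure Enumerates (f : ℤ → ℤ) (n : ℤ) : Prop where
  inj : Set.InjOn f (Set.Icc 0 n)
  range : ∀ q, 0 ≤ q → q ≤ n → 1 ≤ f q ∧ f q ≤ n + 1
  surj : ∀ x, 1 ≤ x → x ≤ n + 1 → ∃ q, 0 ≤ q ∧ q ≤ n ∧ f q = x

theorem Enumerates.perm {f f' : ℤ → ℤ} {n : ℤ} (h : Enumerates f n) (hp : PermOn 0 n f f') :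
    Enumerates f' n where
  inj := hp.injOn le_rfl le_rfl h.inj
  range q h1 h2 := by
    obtain ⟨q', h3, h4, h5⟩ := hp.exists_eq h1 h2
    rw [h5]; exact h.range q' h3 h4
  surj x h1 h2 := by
    obtain ⟨q, h3, h4, rfl⟩ := h.surj x h1 h2
    obtain ⟨q', h5, h6, h7⟩ := hp.symm.exists_eq h3 h4
    exact ⟨q', h5, h6, h7.symm⟩

theorem Enumerates.eq_of_eq {f : ℤ → ℤ} {n q q' : ℤ} (h : Enumerates f n) (h₁ : 0 ≤ q)
    (h₂ : q ≤ n) (h₃ : 0 ≤ q') (h₄ : q' ≤ n) (e : f q = f q') : q = q' :=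
  h.inj (Set.mem_Icc.2 ⟨h₁, h₂⟩) (Set.mem_Icc.2 ⟨h₃, h₄⟩) e

/-- The suffixes are sorted by at least their first `h` symbols. -/
structure Grouped (s : State) (n h φ : ℤ) : Prop where
  enum : Enumerates (s.mem .sfx) n
  tiled : Tiled (fun q => s.mem .V (s.mem .sfx q)) (s.mem .len) (n + 1) 0 φ
  agree : Agree (s.mem .w) (s.mem .V) n h

/-- The invariant of a pass that started with the group numbers `V₀`: the groups to the left of
cell `i` are split, and the last `sl` of them are sorted groups that have yet to be combined. -/
structure PassInv (s : State) (V₀ : ℤ → ℤ) (n h i sl φ₁ φ₂ : ℤ) : Prop where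
  enum : Enumerates (s.mem .sfx) n
  refines : ∀ x y, 1 ≤ x → x ≤ n + 1 → 1 ≤ y → y ≤ n + 1 → s.mem .V x = s.mem .V y → V₀ x = V₀ y
  agree : ∀ x y, 1 ≤ x → x ≤ n + 1 → 1 ≤ y → y ≤ n + 1 → s.mem .V x = s.mem .V y →
    s.mem .V x < i → ∀ o, 0 ≤ o → o < h + h → s.mem .w (x + o) = s.mem .w (y + o)
  sl_nonneg : 0 ≤ sl
  sl_le : sl ≤ i
  left : Tiled (fun q => s.mem .V (s.mem .sfx q)) (s.mem .len) (i - sl) 0 φ₁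
  single : ∀ q, i - sl ≤ q → q < i → s.mem .V (s.mem .sfx q) = q
  right : Tiled (fun q => s.mem .V (s.mem .sfx q)) (s.mem .len) (n + 1) i φ₂
  all : (∀ x y, 1 ≤ x → x ≤ n + 1 → 1 ≤ y → y ≤ n + 1 → V₀ x = V₀ y → x = y) → sl = i

theorem PassInv.of_mem_eq {s s' : State} {V₀ : ℤ → ℤ} {n h i sl φ₁ φ₂ : ℤ}
    (hI : PassInv s V₀ n h i sl φ₁ φ₂) (hm : s'.mem = s.mem) :
    PassInv s' V₀ n h i sl φ₁ φ₂ := by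
  obtain ⟨a, b, c, d, e, f, g, k, l⟩ := hI
  rw [← hm] at a b c f g k
  exact ⟨a, b, c, d, e, f, g, k, l⟩

/-- Combine the sorted groups to the left of cell `i`. -/
theorem PassInv.flush {s : State} {V₀ : ℤ → ℤ} {n h i sl φ₁ φ₂ : ℤ}
    (hI : PassInv s V₀ n h i sl φ₁ φ₂) (hsl : 0 < sl) :
    Tiled (fun q => s.mem .V (s.mem .sfx q)) (Function.update (s.mem .len) (i - sl) (-sl)) i 0
        φ₁ ∧
      Tiled (fun q => s.mem .V (s.mem .sfx q)) (Function.update (s.mem .len) (i - sl) (-sl))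
        (n + 1) i φ₂ := by
  constructor
  · rw [← add_zero φ₁]
    refine (hI.left.congr (fun _ _ _ => rfl) fun q _ h => Function.update_of_ne (by omega) _ _).trans
      (.sorted hsl (by simp) (fun q h1 h2 => hI.single q h1 (by omega)) ?_)
    rw [sub_add_cancel]
    exact .nil
  · exact hI.right.congr (fun _ _ _ => rfl) fun q h _ => Function.update_of_ne (by omega) _ _

/-- The state within a pass after the sorted groups to the left have been combined. -/
theorem PassInv.split {s s' : State} {V₀ : ℤ → ℤ} {n h i j φ₁ φ₂ φ : ℤ}
    (hw : Terminated (s.mem .w) n) (hV₀ : Agree (s.mem .w) V₀ n h) (hh : 0 ≤ h)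
    (hI : PassInv s V₀ n h i 0 φ₁ (pot (j + 1 - i) + φ₂)) (hi : 0 ≤ i) (hij : i < j)
    (hg : ∀ q, i ≤ q → q ≤ j → s.mem .V (s.mem .sfx q) = j)
    (hr : Tiled (fun q => s.mem .V (s.mem .sfx q)) (s.mem .len) (n + 1) (j + 1) φ₂)
    (hs : Split s s' i j h φ) (hw' : s'.mem .w = s.mem .w) :
    PassInv s' V₀ n h (j + 1) 0 (φ₁ + φ) φ₂ := by
  obtain ⟨enum, refines, agree, -, -, left, -, -, -⟩ := hI
  rw [sub_zero] at left
  have hjn : j + 1 ≤ n + 1 := hr.le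
  have hsep : ∀ x ∈ Set.Icc 1 (n + 1), (∀ q, i ≤ q → q ≤ j → s.mem .sfx q ≠ x) →
      ¬ (i ≤ s.mem .V x ∧ s.mem .V x ≤ j) := by
    rintro x ⟨hx1, hx2⟩ hn
    obtain ⟨q, h1, h2, rfl⟩ := enum.surj x hx1 hx2
    by_cases c : q < i
    · have := left.mem_Ico h1 c
      omega
    · by_cases d : q ≤ j
      · exact absurd rfl (hn q (by omega) d)
      · have := hr.mem_Ico (q := q) (by omega) (by omega)
        omega
  -- An unsorted group has at least two members. Another member agrees with this one on `h` symbols,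
  -- so `Terminated.add_le` bounds the position of the key.
  have hD : ∀ q, i ≤ q → q ≤ j → s.mem .sfx q + h ∈ Set.Icc 1 (n + 1) := by
    intro q h1 h2
    obtain ⟨q', h3, h4, h5⟩ : ∃ q', i ≤ q' ∧ q' ≤ j ∧ q' ≠ q := by
      by_cases c : q = i
      · exact ⟨j, by omega, le_rfl, by omega⟩
      · exact ⟨i, le_rfl, by omega, by omega⟩
    have r1 := enum.range q (by omega) (by omega)
    have r2 := enum.range q' (by omega) (by omega)
    have hne : s.mem .sfx q ≠ s.mem .sfx q' := fun e =>
      h5 (enum.eq_of_eq (by omega) (by omega) (by omega) (by omega) e).symm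
    have := hw.add_le r1.1 r1.2 r2.1 r2.2 hne (hV₀ _ _ r1.1 r1.2 r2.1 r2.2
      (refines _ _ r1.1 r1.2 r2.1 r2.2 (by rw [hg q h1 h2, hg q' h3 h4])))
    exact ⟨by omega, this.1⟩
  have hiso : Isolated s i j h := ⟨Set.Icc 1 (n + 1), j, le_rfl, hD, hg, hsep⟩
  have hp := hs.perm.mono (lo' := 0) (hi' := n) hi (by omega)
  have enum' := enum.perm hp
  have href : ∀ x y, 1 ≤ x → x ≤ n + 1 → 1 ≤ y → y ≤ n + 1 → s'.mem .V x = s'.mem .V y →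
      s.mem .V x = s.mem .V y := fun x y a b c d e =>
    refines_of_split (D := Set.Icc 1 (n + 1)) hs.perm hs.V
      (fun q h1 h2 => .inl (hs.mem_range h1 h2)) hg hsep ⟨a, b⟩ ⟨c, d⟩ e
  have hout : ∀ q, 0 ≤ q → q ≤ n → ¬ (i ≤ q ∧ q ≤ j) → s'.mem .sfx q = s.mem .sfx q ∧
      s'.mem .V (s'.mem .sfx q) = s.mem .V (s.mem .sfx q) := by
    intro q h1 h2 h3
    have e := hs.perm.eq_of_not_mem (q := q) (by omega)
    refine ⟨e, ?_⟩
    rw [e, hs.V _ fun q' h4 h5 e => ?_]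
    have := enum.eq_of_eq (by omega) (by omega) h1 h2 e
    omega
  have hle : ∀ q, 0 ≤ q → q ≤ n → ¬ (i ≤ q ∧ q ≤ j) →
      s'.mem .V (s'.mem .sfx q) < i ∧ s.mem .V (s.mem .sfx q) < i ∨
      j < s'.mem .V (s'.mem .sfx q) := by
    intro q h1 h2 h3
    rw [(hout q h1 h2 h3).2]
    by_cases c : q < i
    · have := left.mem_Ico h1 c
      omega
    · have := hr.mem_Ico (q := q) (by omega) (by omega)
      omega
  refine ⟨enum', fun x y a b c d e => refines x y a b c d (href x y a b c d e), ?_, le_rfl,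
    by omega, ?_, fun q h1 h2 => by omega, ?_, ?_⟩
  · intro x y hx1 hx2 hy1 hy2 e hlt o ho1 ho2
    rw [hw']
    obtain ⟨q, a1, a2, rfl⟩ := enum'.surj x hx1 hx2
    obtain ⟨q', b1, b2, rfl⟩ := enum'.surj y hy1 hy2
    by_cases c : i ≤ q ∧ q ≤ j
    · have m1 := hs.mem_range c.1 c.2
      have c' : i ≤ q' ∧ q' ≤ j := by
        by_contra hn
        have := hle q' b1 b2 hn
        omega
      have hk := hs.keys (.inr hiso) q q' c.1 c.2 c'.1 c'.2 e
      have e1 := refines _ _ hx1 hx2 hy1 hy2 (href _ _ hx1 hx2 hy1 hy2 e)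
      -- The doubling: the first `h` symbols agree by the old grouping of the two suffixes, the next
      -- `h` by the old grouping of their keys.
      by_cases hoh : o < h
      · exact hV₀ _ _ hx1 hx2 hy1 hy2 e1 o ho1 hoh
      · obtain ⟨z, z1, z2, z3⟩ := hs.perm.exists_eq c.1 c.2
        obtain ⟨z', z1', z2', z3'⟩ := hs.perm.exists_eq c'.1 c'.2
        have d1 := hD z z1 z2
        have d2 := hD z' z1' z2'
        rw [← z3] at d1
        rw [← z3'] at d2
        have := hV₀ _ _ d1.1 d1.2 d2.1 d2.2 (refines _ _ d1.1 d1.2 d2.1 d2.2 hk) (o - h)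
          (by omega) (by omega)
        rwa [show s'.mem .sfx q + h + (o - h) = s'.mem .sfx q + o by ring,
          show s'.mem .sfx q' + h + (o - h) = s'.mem .sfx q' + o by ring] at this
    · have := hle q a1 a2 c
      have c' : ¬ (i ≤ q' ∧ q' ≤ j) := by
        intro hn
        have := hs.mem_range hn.1 hn.2
        omega
      have o1 := hout q a1 a2 c
      have o2 := hout q' b1 b2 c'
      rw [o1.2, o2.2] at e
      rw [o1.1, o2.1]
      rw [o1.1] at hx1 hx2
      rw [o2.1] at hy1 hy2
      exact agree _ _ hx1 hx2 hy1 hy2 e (by omega) o ho1 ho2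
  · rw [sub_zero]
    refine (left.congr (fun q h1 h2 => (hout q h1 (by omega) (by omega)).2)
      fun q h1 h2 => hs.len q (by omega)).trans hs.tiled
  · exact hr.congr (fun q h1 h2 => (hout q (by omega) (by omega) (by omega)).2)
      fun q h1 h2 => hs.len q (by omega)
  -- The group just split had two different members with one number, so numbers that separate all
  -- suffixes are excluded.
  · intro hinj
    have r1 := enum.range i (by omega) (by omega)
    have r2 := enum.range j (by omega) (by omega)
    have := hinj _ _ r1.1 r1.2 r2.1 r2.2 (refines _ _ r1.1 r1.2 r2.1 r2.2
      (by rw [hg i le_rfl (by omega), hg j (by omega) le_rfl]))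
    have := enum.eq_of_eq (by omega) (by omega) (by omega) (by omega) this
    omega

/-- One pass over the groups. -/
def suffixPass : Cmd :=
  .seq (.assign .i 0) <|
  .seq (.assign .sl 0) <|
  .seq (.while (.le (.var .i) (.var .n))
    (.ite (.lt (.get .len (.var .i)) 0)
      (.seq (.assign .sl (.var .sl - .get .len (.var .i)))
        (.assign .i (.var .i - .get .len (.var .i))))
      (.seq (when (.lt 0 (.var .sl))
          (.seq (.store .len (.var .i - .var .sl) (-.var .sl)) (.assign .sl 0))) <|
        .seq (.assign .j (.get .V (.get .sfx (.var .i)))) <|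
        .seq (run .sortSplit [.var .i, .var .j, .var .h]) <|
        .assign .i (.var .j + 1)))) <|
  .seq (when (.lt 0 (.var .sl)) (.store .len (.var .i - .var .sl) (-.var .sl))) <|
  .assign .h (.var .h + .var .h)

/-- The costs of `sortSplit_spec` add up over disjoint groups: beyond the released potential, a pass
is linear. If `h > n` at its start, every group is a singleton already, and the pass combines all of
them into one sorted group, which ends the sorting. -/
theorem suffixPass_spec {s : State} {n h φ : ℤ} (hn : s.loc .n = n) (hh : s.loc .h = h)
    (hn0 : 0 ≤ n) (hh0 : 1 ≤ h) (hw : Terminated (s.mem .w) n) (hg : Grouped s n h φ) :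
    wp suffixPass s (fun t s' => ∃ φ', (t : ℤ) + 10000 * φ' ≤
      10000 * φ + 10100 * (n + 1) + 50 ∧ s'.loc .h = h + h ∧ Grouped s' n (h + h) φ' ∧
      (n < h → s'.mem .len 0 = -(n + 1))) := by
  unfold suffixPass
  rw [wp_seq, wp_assign, wp_seq, wp_assign, wp_seq]
  refine (wp_while_amortized (fun B s' => ∃ φ₁ φ₂,
      PassInv s' (s.mem .V) n h (s'.loc .i) (s'.loc .sl) φ₁ φ₂ ∧
      B = 10100 * (n + 1 - s'.loc .i) + 10000 * (φ₁ + φ₂) + 8)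
    (B₀ := 10100 * (n + 1) + 10000 * φ + 8) (Post := fun B s' => ∃ φ₁,
      PassInv s' (s.mem .V) n h (n + 1) (s'.loc .sl) φ₁ 0 ∧ s'.loc .i = n + 1 ∧
      B ≥ 10000 * φ₁) ?_ ?_ ?_).mono ?_
  · refine ⟨0, φ, ?_, by simp⟩
    simp
    exact ⟨hg.enum, fun _ _ _ _ _ _ h => h, by
      intro x y a b c d e f
      obtain ⟨q, h1, h2, rfl⟩ := hg.enum.surj x a b
      have := hg.tiled.mem_Ico h1 (by omega)
      simp at f
      omega, le_rfl, le_rfl, .nil, by intros; omega, hg.tiled, fun _ => rfl⟩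
  · rintro B s₁ hF ⟨φ₁, φ₂, hI, rfl⟩ hb
    have en : s₁.loc .n = n := by rw [hF.loc .n rfl]; simp [hn]
    have eh : s₁.loc .h = h := by rw [hF.loc .h rfl]; simp [hh]
    have ew : s₁.mem .w = s.mem .w := by rw [hF.mem .w rfl]; simp
    simp [en] at hb
    have hi0 : 0 ≤ s₁.loc .i := hI.sl_nonneg.trans hI.sl_le
    have hφ₁ := hI.left.nonneg
    have hr := hI.right
    generalize hi : s₁.loc .i = i at *
    rw [wp_ite]
    simp only [beval_lt, eval_get, eval_var, eval_ofNat, hi]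
    cases hr with
    | nil => omega
    | @sorted _ m _ hm hlen hsing hr =>
      have hφ₂ := hr.nonneg
      have := hr.le
      refine ⟨fun _ => ?_, fun h => absurd (by rw [hlen]; simpa using hm) h⟩
      simp [hi, hlen]
      refine ⟨φ₁, φ₂, by omega, by omega, PassInv.of_mem_eq (s := s₁)
        ⟨hI.enum, hI.refines, ?_, ?_, ?_, ?_, ?_, hr, ?_⟩ rfl⟩
      · intro x y a b c d e f
        by_cases hlt : s₁.mem .V x < i
        · exact hI.agree x y a b c d e hlt
        · intro o ho1 ho2
          obtain ⟨q, q1, q2, rfl⟩ := hI.enum.surj x a b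
          obtain ⟨q', q1', q2', rfl⟩ := hI.enum.surj y c d
          have loc : ∀ q, 0 ≤ q → q ≤ n → i ≤ s₁.mem .V (s₁.mem .sfx q) →
              s₁.mem .V (s₁.mem .sfx q) < i + m → s₁.mem .V (s₁.mem .sfx q) = q := by
            intro q q1 q2 q3 q4
            by_cases c1 : q < i - s₁.loc .sl
            · have := hI.left.mem_Ico q1 c1
              have := hI.sl_nonneg
              omega
            · by_cases c2 : q < i + m
              · by_cases c3 : q < i
                · exact hI.single q (by omega) c3
                · exact hsing q (by omega) c2
              · have := hr.mem_Ico (q := q) (by omega) (by omega)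
                omega
          have l1 := loc q q1 q2 (by omega) f
          have l2 := loc q' q1' q2' (by omega) (by omega)
          rw [show q = q' by omega]
      · have := hI.sl_nonneg
        omega
      · have := hI.sl_le
        omega
      · have := hI.left
        rwa [show i + m - (s₁.loc .sl + m) = i - s₁.loc .sl by ring]
      · intro q h1 h2
        by_cases c : q < i
        · exact hI.single q (by omega) c
        · exact hsing q (by omega) h2
      · intro hinj
        rw [hI.all hinj]
    | @group _ j φ₂ hij hlen hgr hr =>
      have hφ₂ := hr.nonneg
      have hjn := hr.le
      refine ⟨fun h => by omega, fun _ => ?_⟩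
      rw [wp_seq]
      refine wp.mono (Q := fun t s₂ => t ≤ 20 ∧ s₂.loc .sl = 0 ∧ s₂.mem .sfx = s₁.mem .sfx ∧
        PassInv s₂ (s.mem .V) n h i 0 φ₁ (pot (j + 1 - i) + φ₂) ∧ 0 ≤ s₂.mem .len i ∧
        Tiled (fun q => s₂.mem .V (s₂.mem .sfx q)) (s₂.mem .len) (n + 1) (j + 1) φ₂) ?_ ?_
      · simp only [when, wp_ite, wp_seq, wp_store, wp_assign, wp_skip]
        simp [hi]
        have hnn := hI.sl_nonneg
        refine ⟨fun hsl => ⟨?_, ?_, ?_⟩, fun hsl => ?_⟩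
        · have hf := hI.flush hsl
          refine ⟨hI.enum, hI.refines, hI.agree, le_rfl, hi0, ?_, fun q _ _ => by omega, ?_, ?_⟩
          · simpa using hf.1
          · simpa using hf.2
          · intro hinj
            exfalso
            have r1 := hI.enum.range i (by omega) (by omega)
            have r2 := hI.enum.range j (by omega) (by omega)
            have := hinj _ _ r1.1 r1.2 r2.1 r2.2 (hI.refines _ _ r1.1 r1.2 r2.1 r2.2
              (by rw [hgr i le_rfl (by omega), hgr j (by omega) le_rfl]))
            have := hI.enum.eq_of_eq (by omega) (by omega) (by omega) (by omega) this
            omega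
        · rwa [Function.update_of_ne (by omega)]
        · exact hr.congr (fun _ _ _ => rfl) fun q h _ => Function.update_of_ne (by omega) _ _
        · have e0 : s₁.loc .sl = 0 := by omega
          rw [e0] at hI
          exact ⟨e0, hI, hlen, hr⟩
      rintro t₂ s₂ hF₂ ⟨ht₂, hsl, es, hI₂, hlen₂, hr₂⟩
      have ei₂ : s₂.loc .i = i := by rw [hF₂.loc .i rfl, hi]
      have eh₂ : s₂.loc .h = h := by rw [hF₂.loc .h rfl, eh]
      have eV₂ : s₂.mem .V = s₁.mem .V := hF₂.mem .V rfl
      have ew₂ : s₂.mem .w = s.mem .w := by rw [hF₂.mem .w rfl, ew]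
      have hgr₂ : ∀ q, i ≤ q → q ≤ j → s₂.mem .V (s₂.mem .sfx q) = j := by
        rw [es, eV₂]; exact hgr
      rw [wp_seq, wp_assign, wp_seq]
      refine wp.mono (Q := fun t s₃ => ∃ φ, (t : ℤ) + 10000 * φ ≤
        10000 * (j + 1 - i + pot (j + 1 - i)) + 10 ∧ Split s₂ s₃ i j h φ) ?_ ?_
      · refine wp_call ((sortSplit_spec (L := i) (H := j) (h := h) ?_ ?_ ?_ hij.le ?_).mono ?_)
        · simp [procs, ei₂]
        · simp [procs, ei₂, hgr₂ i le_rfl hij.le]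
        · simp [procs, eh₂]
        · refine hI₂.enum.inj.mono ?_
          exact Set.Icc_subset_Icc hi0 (by omega)
        · rintro t s' - ⟨φ, ht, hs⟩
          rw [show j - i + 1 = j + 1 - i by ring] at ht
          exact ⟨φ, by simp; omega, hs.of_mem_eq rfl rfl⟩
      rintro t₃ s₃ hF₃ ⟨φ', ht₃, hs⟩
      have ej₃ : s₃.loc .j = j := by
        rw [hF₃.loc .j rfl]; simp [ei₂, hgr₂ i le_rfl hij.le]
      have esl₃ : s₃.loc .sl = 0 := by rw [hF₃.loc .sl rfl]; simp [hsl]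
      have ew₃ : s₃.mem .w = s₂.mem .w := by rw [hF₃.mem .w rfl]; simp
      have hI₃ := hI₂.split (by rwa [ew₂]) (by rw [ew₂]; exact hg.agree) (by omega) hi0 hij hgr₂
        hr₂ hs ew₃
      have hφ' := hs.tiled.nonneg
      rw [wp_assign]
      refine ⟨10100 * (n + 1 - (j + 1)) + 10000 * (φ₁ + φ' + φ₂) + 8, by omega, ?_,
        φ₁ + φ', φ₂, ?_, ?_⟩
      · simp
        omega
      · simp [ej₃, esl₃]
        exact hI₃.of_mem_eq rfl
      · simp [ej₃]
  · rintro B s₁ hF ⟨φ₁, φ₂, hI, rfl⟩ hb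
    have en : s₁.loc .n = n := by rw [hF.loc .n rfl]; simp [hn]
    simp [en] at hb
    have hle := hI.right.le
    have hi : s₁.loc .i = n + 1 := by omega
    have hφ₂ := hI.right.nonneg
    rw [hi] at hI
    refine ⟨φ₁, ⟨hI.enum, hI.refines, hI.agree, hI.sl_nonneg, hI.sl_le, hI.left, hI.single,
      .nil, hI.all⟩, hi, ?_⟩
    simp
    omega
  rintro t₁ s₁ hF ⟨B, ht, φ₁, hI, hi, hB⟩
  have eh : s₁.loc .h = h := by rw [hF.loc .h rfl]; simp [hh]
  have ew : s₁.mem .w = s.mem .w := by rw [hF.mem .w rfl]; simp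
  rw [wp_seq]
  refine wp.mono (Q := fun t s₂ => t ≤ 20 ∧ Grouped s₂ n (h + h) φ₁ ∧
    (n < h → s₂.mem .len 0 = -(n + 1))) ?_ ?_
  · have hag : Agree (s₁.mem .w) (s₁.mem .V) n (h + h) := by
      intro x y a b c d e
      refine hI.agree x y a b c d e ?_
      obtain ⟨q, q1, q2, rfl⟩ := hI.enum.surj x a b
      by_cases c1 : q < n + 1 - s₁.loc .sl
      · have := hI.left.mem_Ico q1 c1
        have := hI.sl_nonneg
        omega
      · rw [hI.single q (by omega) (by omega)]
        omega
    -- Different suffixes with the same number would give `x + h ≤ n + 1` with `x ≥ 1`.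
    have hall : n < h → s₁.loc .sl = n + 1 := by
      intro hlt
      refine hI.all fun x y a b c d e => ?_
      by_contra hne
      have := hw.add_le a b c d hne (hg.agree x y a b c d e)
      omega
    simp only [when, wp_ite, wp_store, wp_skip]
    simp [hi]
    have hnn := hI.sl_nonneg
    refine ⟨fun hsl => ⟨⟨hI.enum, ?_, hag⟩, fun hlt => ?_⟩, fun hsl => ⟨⟨hI.enum, ?_, hag⟩,
      fun hlt => ?_⟩⟩
    · simpa using (hI.flush hsl).1
    · rw [hall hlt]
      simp
    · have e0 : s₁.loc .sl = 0 := by omega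
      have := hI.left
      rwa [e0, sub_zero] at this
    · have := hall hlt
      omega
  rintro t₂ s₂ hF₂ ⟨ht₂, hG, hlen⟩
  have eh₂ : s₂.loc .h = h := by rw [hF₂.loc .h rfl, eh]
  rw [wp_assign]
  refine ⟨φ₁, ?_, ?_, ⟨hG.enum, hG.tiled, hG.agree⟩, hlen⟩
  · simp
    omega
  · simp [eh₂]

/-- The potential is paid once, at most `(n + 1) log (n + 1)` for the group of all suffixes; the
linear term is paid in each of at most `log (n + 1) + 2` passes. -/
theorem suffixSort_spec {s : State} {n : ℤ} (hn : s.loc .n = n) (hn0 : 0 ≤ n)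
    (hw : Terminated (s.mem .w) n) :
    wp suffixSortBody s (fun t s' => (t : ℤ) ≤
      40000 * ((n + 1) * (Nat.log 2 (n + 1).toNat + 2)) ∧ Enumerates (s'.mem .sfx) n) := by
  unfold suffixSortBody
  rw [wp_seq, wp_assign, wp_seq]
  refine (wp_while (fun B s' => 0 ≤ s'.loc .i ∧ s'.loc .i ≤ n + 1 ∧
      (∀ q, 0 ≤ q → q < s'.loc .i → s'.mem .sfx q = q + 1) ∧
      (∀ q, 1 ≤ q → q ≤ s'.loc .i → s'.mem .V q = s.mem .w q) ∧
      B = (n + 1 - s'.loc .i) * 30 + 8) (B₀ := (n + 1) * 30 + 8) (Post := fun s' =>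
      (∀ q, 0 ≤ q → q ≤ n → s'.mem .sfx q = q + 1) ∧
      (∀ q, 1 ≤ q → q ≤ n + 1 → s'.mem .V q = s.mem .w q)) ?_ ?_ ?_).mono ?_
  · simp
    exact ⟨by omega, by intros; omega, by intros; omega⟩
  · rintro B s₁ hF ⟨h1, h2, hs, hV, rfl⟩ hb
    have en : s₁.loc .n = n := by rw [hF.loc .n rfl]; simp [hn]
    have ew : s₁.mem .w = s.mem .w := by rw [hF.mem .w rfl]; simp
    simp [en] at hb
    simp [ew]
    refine ⟨by omega, by omega, by omega, by omega, fun q a b => ?_, fun q a b => ?_⟩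
    · rw [Function.update_apply]
      split_ifs with c
      · omega
      · exact hs q a (by omega)
    · rw [Function.update_apply]
      split_ifs with c
      · rw [c]
      · exact hV q a (by omega)
  · rintro B s₁ hF ⟨h1, h2, hs, hV, rfl⟩ hb
    have en : s₁.loc .n = n := by rw [hF.loc .n rfl]; simp [hn]
    simp [en] at hb
    exact ⟨by simp; omega, fun q a b => hs q a (by omega), fun q a b => hV q a (by omega)⟩
  rintro t₁ s₁ hF₁ ⟨ht₁, hs, hV⟩
  have en : s₁.loc .n = n := by rw [hF₁.loc .n rfl]; simp [hn]
  have ew : s₁.mem .w = s.mem .w := by rw [hF₁.mem .w rfl]; simp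
  have enum : Enumerates (s₁.mem .sfx) n := by
    refine ⟨fun q hq q' hq' e => ?_, fun q a b => ?_, fun x a b => ⟨x - 1, by omega, by omega, ?_⟩⟩
    · rw [hs q hq.1 hq.2, hs q' hq'.1 hq'.2] at e
      omega
    · rw [hs q a b]; omega
    · rw [hs _ (by omega) (by omega)]; omega
  -- the first symbols
  rw [wp_seq]
  refine wp.mono (Q := fun t s' => ∃ φ, (t : ℤ) + 10000 * φ ≤
    10000 * (n + 1 + pot (n + 1)) + 10 ∧ Split s₁ s' 0 n 0 φ) ?_ ?_
  · refine wp_call ((sortSplit_spec (L := 0) (H := n) (h := 0) ?_ ?_ ?_ hn0 ?_).mono ?_)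
    · simp [procs]
    · simp [procs, en]
    · simp [procs]
    · exact enum.inj
    · rintro t s' - ⟨φ, ht, hs⟩
      rw [sub_zero] at ht
      exact ⟨φ, by simp; omega, hs.of_mem_eq rfl rfl⟩
  rintro t₂ s₂ hF₂ ⟨φ₀, ht₂, hsp⟩
  have en₂ : s₂.loc .n = n := by rw [hF₂.loc .n rfl, en]
  have ew₂ : s₂.mem .w = s.mem .w := by rw [hF₂.mem .w rfl, ew]
  have hG : Grouped s₂ n 1 φ₀ := by
    have enum₂ := enum.perm hsp.perm
    refine ⟨enum₂, hsp.tiled, fun x y a b c d e o ho1 ho2 => ?_⟩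
    obtain ⟨q, q1, q2, rfl⟩ := enum₂.surj x a b
    obtain ⟨q', q1', q2', rfl⟩ := enum₂.surj y c d
    have := hsp.keys (.inl rfl) q q' q1 q2 q1' q2' e
    rw [add_zero, add_zero, hV _ a b, hV _ c d] at this
    rw [show o = 0 by omega, add_zero, add_zero, ew₂, this]
  -- the passes
  rw [wp_seq, wp_assign]
  -- Here `ρ` bounds the number of passes still to come. With `ρ = 1` the inequality says `h > n`,
  -- so that the next pass is the last.
  refine (wp_while (fun B s' => ∃ (ρ : ℕ) (φ : ℤ), 1 ≤ s'.loc .h ∧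
      Grouped s' n (s'.loc .h) φ ∧
      (s'.mem .len 0 = -(n + 1) ∨ 1 ≤ ρ ∧ 2 * n < s'.loc .h * 2 ^ ρ) ∧
      B = ρ * (10100 * (n + 1) + 70) + 10000 * φ + 20)
    (B₀ := (Nat.log 2 (n + 1).toNat + 2) * (10100 * (n + 1) + 70) + 10000 * φ₀ + 20)
    (Post := fun s' => Enumerates (s'.mem .sfx) n) ?_ ?_ ?_).mono ?_
  · refine ⟨Nat.log 2 (n + 1).toNat + 2, φ₀, by simp, ⟨hG.enum, hG.tiled, hG.agree⟩, .inr ?_, ?_⟩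
    · have h1 := Nat.lt_pow_succ_log_self (b := 2) (by omega) (n + 1).toNat
      have h2 : n + 1 < 2 ^ (Nat.log 2 (n + 1).toNat + 1) := by
        have : ((n + 1).toNat : ℤ) < 2 ^ (Nat.log 2 (n + 1).toNat + 1) := by exact_mod_cast h1
        omega
      refine ⟨by omega, ?_⟩
      simp only [setVar_loc, Function.update_self, eval_ofNat]
      rw [pow_succ]
      push_cast
      omega
    · push_cast
      ring
  · rintro B s₃ hF ⟨ρ, φ, hh, hG₃, hor, rfl⟩ hb
    have en₃ : s₃.loc .n = n := by rw [hF.loc .n rfl]; simp [en₂]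
    have ew₃ : s₃.mem .w = s.mem .w := by rw [hF.mem .w rfl]; simp [ew₂]
    simp [en₃] at hb
    obtain ⟨hρ, hlt⟩ := hor.resolve_left (by omega)
    refine (suffixPass_spec en₃ rfl hn0 hh (by rwa [ew₃]) hG₃).mono ?_
    rintro t₄ s₄ hF₄ ⟨φ', ht, hh', hG', hlen⟩
    obtain ⟨ρ, rfl⟩ : ∃ k, ρ = k + 1 := ⟨ρ - 1, by omega⟩
    have hφ' := hG'.tiled.nonneg
    have hB : 0 ≤ (ρ : ℤ) * (10100 * (n + 1) + 70) := by positivity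
    refine ⟨_, ?_, ?_, ρ, φ', by omega, by rwa [hh'], ?_, rfl⟩
    · omega
    · simp
      rw [add_mul]
      omega
    · by_cases hc : n < s₃.loc .h
      · exact .inl (hlen hc)
      · refine .inr ⟨?_, ?_⟩
        · by_contra h0
          rw [show ρ = 0 by omega] at hlt
          simp at hlt
          omega
        · rw [hh']
          rw [pow_succ] at hlt
          nlinarith
  · rintro B s₃ hF ⟨ρ, φ, hh, hG₃, hor, rfl⟩ hb
    have hB : 0 ≤ (ρ : ℤ) * (10100 * (n + 1) + 70) := by positivity
    have := hG₃.tiled.nonneg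
    exact ⟨by simp; omega, hG₃.enum⟩
  rintro t₃ s₃ - ⟨ht₃, henum⟩
  refine ⟨?_, henum⟩
  obtain ⟨l, hl⟩ : ∃ l : ℤ, l = Nat.log 2 (n + 1).toNat := ⟨_, rfl⟩
  have hl0 : 0 ≤ l := by omega
  unfold pot at ht₂
  rw [← hl] at ht₂ ht₃ ⊢
  simp
  have : 0 ≤ n * l := mul_nonneg hn0 hl0
  nlinarith

/-- Not even the place of the empty suffix in cell `0` is established. So `r` and `p` are described
through an enumeration `f` of all `n + 1` suffixes whose cell `0` is dropped, wherever the empty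
suffix may be. -/
theorem suffixArray_spec {s : State} {n : ℤ} (hn : s.loc .n = n) (hn0 : 0 ≤ n)
    (hw : Terminated (s.mem .w) n) (hr : ∀ q, s.mem .r q = 0) (hp : ∀ q, s.mem .p q = 0) :
    wp suffixArrayBody s (fun t s' => (t : ℤ) ≤
      40100 * ((n + 1) * (Nat.log 2 (n + 1).toNat + 2)) ∧
      ∃ f, Enumerates f n ∧ (∀ q, 1 ≤ q → q ≤ n → s'.mem .r q = f q ∧ s'.mem .p (f q) = q) ∧
        (∀ q, q < 1 ∨ n < q → s'.mem .r q = 0) ∧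
        ∀ x, (∀ q, 1 ≤ q → q ≤ n → f q ≠ x) → s'.mem .p x = 0) := by
  unfold suffixArrayBody
  rw [wp_seq]
  refine wp.mono (Q := fun t s' => (t : ℤ) ≤
      40000 * ((n + 1) * (Nat.log 2 (n + 1).toNat + 2)) + 10 ∧ Enumerates (s'.mem .sfx) n) ?_ ?_
  · refine wp_call ((suffixSort_spec (n := n) ?_ hn0 ?_).mono ?_)
    · simp [procs, hn]
    · exact hw
    · rintro t s' - ⟨ht, he⟩
      exact ⟨by simp; omega, he⟩
  rintro t₁ s₁ hF₁ ⟨ht₁, he⟩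
  have en : s₁.loc .n = n := by rw [hF₁.loc .n rfl, hn]
  have er : s₁.mem .r = s.mem .r := hF₁.mem .r rfl
  have ep : s₁.mem .p = s.mem .p := hF₁.mem .p rfl
  rw [wp_seq, wp_assign]
  refine (wp_while (fun B s' => 1 ≤ s'.loc .i ∧ s'.loc .i ≤ n + 1 ∧
      (∀ q, 1 ≤ q → q < s'.loc .i → s'.mem .r q = s₁.mem .sfx q ∧ s'.mem .p (s₁.mem .sfx q) = q) ∧
      (∀ q, q < 1 ∨ n < q → s'.mem .r q = 0) ∧
      (∀ x, (∀ q, 1 ≤ q → q ≤ n → s₁.mem .sfx q ≠ x) → s'.mem .p x = 0) ∧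
      B = (n + 1 - s'.loc .i) * 30 + 8) (B₀ := n * 30 + 8) (Post := fun s' =>
      (∀ q, 1 ≤ q → q ≤ n → s'.mem .r q = s₁.mem .sfx q ∧ s'.mem .p (s₁.mem .sfx q) = q) ∧
        (∀ q, q < 1 ∨ n < q → s'.mem .r q = 0) ∧
        ∀ x, (∀ q, 1 ≤ q → q ≤ n → s₁.mem .sfx q ≠ x) → s'.mem .p x = 0) ?_ ?_ ?_).mono ?_
  · simp [er, ep, hr, hp]
    exact ⟨by omega, by intros; omega⟩
  · rintro B s₂ hF ⟨h1, h2, hrp, hr0, hp0, rfl⟩ hb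
    have en₂ : s₂.loc .n = n := by rw [hF.loc .n rfl]; simp [en]
    have es : s₂.mem .sfx = s₁.mem .sfx := by rw [hF.mem .sfx rfl]; simp
    simp [en₂] at hb
    simp [es]
    refine ⟨by omega, by omega, by omega, by omega, fun q a b => ?_, fun q h => ?_,
      fun x hx => ?_⟩
    · by_cases c : q = s₂.loc .i
      · subst c; simp
      · have hne : s₁.mem .sfx q ≠ s₁.mem .sfx (s₂.loc .i) := fun e =>
          c (he.eq_of_eq (by omega) (by omega) (by omega) (by omega) e)
        rw [Function.update_of_ne c, Function.update_of_ne hne]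
        exact hrp q a (by omega)
    · rw [Function.update_of_ne (by omega)]
      exact hr0 q h
    · rw [Function.update_of_ne (fun e => hx _ h1 hb e.symm)]
      exact hp0 x hx
  · rintro B s₂ hF ⟨h1, h2, hrp, hr0, hp0, rfl⟩ hb
    have en₂ : s₂.loc .n = n := by rw [hF.loc .n rfl]; simp [en]
    simp [en₂] at hb
    exact ⟨by simp; omega, fun q a b => hrp q a (by omega), hr0, hp0⟩
  rintro t₂ s₂ - ⟨ht₂, h⟩
  refine ⟨?_, _, he, h⟩
  have : 0 ≤ (n + 1) * (Nat.log 2 (n + 1).toNat : ℤ) := by positivity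
  simp
  nlinarith

/-! ### Longest common prefixes -/

/-- A comparison that succeeds raises `i + h`, which is at most `n + 1`; a decrement of `h` is
offset by the increment of `i`. A reset of `h` costs up to `n + 1` further comparisons, but `hp`
allows only one; `d` counts the resets still possible. The assumption `hr` is for the strict bound
on `LCP` at `i = 1`. -/
theorem lcpArray_spec {s : State} {n : ℤ} (hn : s.loc .n = n) (hn0 : 0 ≤ n)
    (hp : ∀ x y, 1 ≤ x → x ≤ n → 1 ≤ y → y ≤ n → n ≤ s.mem .p x → n ≤ s.mem .p y → x = y)
    (hr : 1 ≤ n → s.mem .p 1 < n → 2 ≤ s.mem .r (s.mem .p 1 + 1))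
    (hLCP : ∀ q, s.mem .LCP q = 0) :
    wp lcpArrayBody s (fun t s' => (t : ℤ) ≤ 200 * (n + 1) ∧
      (1 ≤ n → ∀ q, 0 ≤ s'.mem .LCP q ∧ s'.mem .LCP q < n)) := by
  unfold lcpArrayBody
  rw [wp_seq, wp_assign, wp_seq, wp_assign]
  refine (wp_while (fun B s' => ∃ d : ℤ, 0 ≤ d ∧ 1 ≤ s'.loc .i ∧ s'.loc .i ≤ n + 1 ∧
      0 ≤ s'.loc .h ∧ s'.loc .i + s'.loc .h ≤ n + 1 ∧ (s'.loc .i = 1 → s'.loc .h = 0) ∧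
      (∀ x, s'.loc .i ≤ x → x ≤ n → n ≤ s.mem .p x → d = 1) ∧
      (1 ≤ n → ∀ q, 0 ≤ s'.mem .LCP q ∧ s'.mem .LCP q < n) ∧
      B = 100 * (n + 1 - s'.loc .i) + 30 * (n + 1 - s'.loc .i - s'.loc .h) +
        d * (30 * (n + 1)) + 8)
    (B₀ := 100 * n + 30 * n + 1 * (30 * (n + 1)) + 8) (Post := fun s' =>
      1 ≤ n → ∀ q, 0 ≤ s'.mem .LCP q ∧ s'.mem .LCP q < n) ?_ ?_ ?_).mono ?_
  · refine ⟨1, ?_⟩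
    simp [hLCP]
    omega
  · rintro B s₁ hF ⟨d, hd, hi1, hi2, hh0, hih, hh1, hres, hL, rfl⟩ hb
    have en : s₁.loc .n = n := by rw [hF.loc .n rfl]; simp [hn]
    have ep : s₁.mem .p = s.mem .p := by rw [hF.mem .p rfl]; simp
    have er : s₁.mem .r = s.mem .r := by rw [hF.mem .r rfl]; simp
    have hd0 : 0 ≤ d * (30 * (n + 1)) := by positivity
    simp [en] at hb
    rw [wp_seq, wp_ite]
    simp only [beval_lt, eval_get, eval_var, ep, en]
    refine ⟨fun hlt => ?_, fun hlt => ?_⟩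
    · rw [wp_seq, wp_assign, wp_seq]
      refine (wp_while_amortized (fun B s' => s₁.loc .h ≤ s'.loc .h ∧
        s₁.loc .i + s'.loc .h ≤ n + 1 ∧
        (s'.loc .h = s₁.loc .h ∨ s'.loc .j + s'.loc .h ≤ n + 1) ∧
        B = 30 * (n + 1 - s₁.loc .i - s'.loc .h) + 22)
        (B₀ := 30 * (n + 1 - s₁.loc .i - s₁.loc .h) + 22)
        (Post := fun B s' => s₁.loc .h ≤ s'.loc .h ∧ s₁.loc .i + s'.loc .h ≤ n + 1 ∧
        (s'.loc .h = s₁.loc .h ∨ s'.loc .j + s'.loc .h ≤ n + 1) ∧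
        B = 30 * (n + 1 - s₁.loc .i - s'.loc .h)) ?_ ?_ ?_).mono ?_
      · simp
        omega
      · rintro B s₂ hF₂ ⟨a1, a2, a3, rfl⟩ hb₂
        have en₂ : s₂.loc .n = n := by rw [hF₂.loc .n rfl]; simp [en]
        have ei₂ : s₂.loc .i = s₁.loc .i := by rw [hF₂.loc .i rfl]; simp
        simp [en₂, ei₂] at hb₂
        simp
        omega
      · rintro B s₂ hF₂ ⟨a1, a2, a3, rfl⟩ hb₂
        refine ⟨a1, a2, a3, ?_⟩
        simp
      rintro t₂ s₂ hF₂ ⟨B, ht₂, a1, a2, a3, rfl⟩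
      have en₂ : s₂.loc .n = n := by rw [hF₂.loc .n rfl]; simp [en]
      have ei₂ : s₂.loc .i = s₁.loc .i := by rw [hF₂.loc .i rfl]; simp
      have ej₂ : s₂.loc .j = s.mem .r (s.mem .p (s₁.loc .i) + 1) := by
        rw [hF₂.loc .j rfl]; simp [ep, er]
      have ep₂ : s₂.mem .p = s.mem .p := by rw [hF₂.mem .p rfl]; simp [ep]
      have eL₂ : s₂.mem .LCP = s₁.mem .LCP := by rw [hF₂.mem .LCP rfl]; simp
      -- For `i ≥ 2` this is `i + h ≤ n + 1`. For `i = 1` the value starts at `0` and is limited by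
      -- `j + h ≤ n + 1` with `j ≥ 2`.
      have hle : s₂.loc .h ≤ n - 1 := by
        by_cases hc : s₁.loc .i = 1
        · rw [hc] at hlt ej₂
          have := hr (by omega) hlt
          have := hh1 hc
          omega
        · omega
      have hL₂ : ∀ q, 0 ≤ Function.update (s₁.mem .LCP) (s.mem .p (s₁.loc .i)) (s₂.loc .h) q ∧
          Function.update (s₁.mem .LCP) (s.mem .p (s₁.loc .i)) (s₂.loc .h) q < n := by
        intro q
        rw [Function.update_apply]
        split_ifs
        · omega
        · exact hL (by omega) q
      simp only [when, wp_seq, wp_store, wp_ite, wp_assign, wp_skip]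
      refine ⟨fun hc => ⟨100 * (n + 1 - (s₁.loc .i + 1)) +
          30 * (n + 1 - (s₁.loc .i + 1) - (s₂.loc .h - 1)) + d * (30 * (n + 1)) + 8, ?_, ?_,
          d, hd, ?_⟩, fun hc => ⟨100 * (n + 1 - (s₁.loc .i + 1)) +
          30 * (n + 1 - (s₁.loc .i + 1) - s₂.loc .h) + d * (30 * (n + 1)) + 8, ?_, ?_,
          d, hd, ?_⟩⟩
      · simp at hc
        omega
      · simp
        omega
      · simp at hc
        simp [ei₂, ep₂, eL₂]
        exact ⟨by omega, by omega, by omega, by omega, by omega,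
          fun x h1 h2 => hres x (by omega) h2, fun _ => hL₂⟩
      · simp at hc
        omega
      · simp
        omega
      · simp at hc
        simp [ei₂, ep₂, eL₂]
        exact ⟨by omega, by omega, by omega, by omega, by omega,
          fun x h1 h2 => hres x (by omega) h2, fun _ => hL₂⟩
    · have hd1 := hres (s₁.loc .i) le_rfl hb (by omega)
      subst hd1
      simp only [wp_assign]
      refine ⟨100 * (n + 1 - (s₁.loc .i + 1)) + 30 * (n + 1 - (s₁.loc .i + 1) - 0) +
        0 * (30 * (n + 1)) + 8, by omega, ?_, 0, le_rfl, ?_⟩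
      · simp
        omega
      · simp
        refine ⟨by omega, by omega, fun x h1 h2 => ?_, hL⟩
        by_contra! h3
        have := hp x (s₁.loc .i) (by omega) h2 hi1 hb h3 (by omega)
        omega
  · rintro B s₁ hF ⟨d, hd, hi1, hi2, hh0, hih, hh1, hres, hL, rfl⟩ hb
    have hd0 : 0 ≤ d * (30 * (n + 1)) := by positivity
    exact ⟨by simp; omega, hL⟩
  · rintro t s' - ⟨ht, h⟩
    exact ⟨by simp; omega, h⟩

/-! ### The tree of bits -/

/-- Halving takes a leaf to node `1` in logarithmically many steps. That the root is set is the only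
fact about the tree that the time of the searches depends on. -/
theorem insert_spec {s : State} {z i : ℤ} {ρ : ℕ} (hz : s.loc .size = z) (hi : s.loc .i = i)
    (h : 1 ≤ z + i) (hρ : z + i ≤ 2 ^ ρ) :
    wp insertBody s (fun t s' => (t : ℤ) ≤ 20 * ρ + 30 ∧ s'.mem .S 1 = 1) := by
  unfold insertBody
  rw [wp_seq, wp_assign]
  refine (wp_while (fun B s' => 0 ≤ s'.loc .t ∧ (s'.loc .t = 0 → s'.mem .S 1 = 1) ∧
      B = if s'.loc .t = 0 then 4 else 20 * (Nat.log 2 (s'.loc .t).toNat : ℤ) + 24)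
    (B₀ := 20 * (Nat.log 2 (z + i).toNat : ℤ) + 24) (Post := fun s' => s'.mem .S 1 = 1)
    ?_ ?_ ?_).mono ?_
  · simp [hz, hi]
    exact ⟨by omega, by omega, by omega⟩
  · rintro B s₁ hF ⟨h1, h2, rfl⟩ hb
    simp at hb
    have h0 : s₁.loc .t ≠ 0 := by omega
    rw [if_neg h0]
    simp only [wp_seq, wp_store, wp_assign]
    refine ⟨_, ?_, ?_, ?_, ?_, rfl⟩
    · split_ifs <;> omega
    · simp
      split_ifs with hc
      · omega
      · have : Nat.log 2 (s₁.loc .t / 2).toNat + 1 = Nat.log 2 (s₁.loc .t).toNat := by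
          rw [show (s₁.loc .t / 2).toNat = (s₁.loc .t).toNat / 2 by omega]
          exact (Nat.log_of_one_lt_of_le (by omega) (by omega)).symm
        omega
    · simp
      omega
    · simp
      intro hc
      rw [show s₁.loc .t = 1 by omega]
      simp
  · rintro B s₁ hF ⟨h1, h2, rfl⟩ hb
    simp at hb
    have h0 : s₁.loc .t = 0 := by omega
    rw [if_pos h0]
    exact ⟨by simp, h2 h0⟩
  · rintro t s' - ⟨ht, h⟩
    have h1 : (z + i).toNat ≤ 2 ^ ρ := by
      have : ((z + i).toNat : ℤ) ≤ ((2 ^ ρ : ℕ) : ℤ) := by push_cast; omega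
      exact_mod_cast this
    have h2 := (Nat.log_mono_right (b := 2) h1).trans (Nat.log_pow (by omega) ρ).le
    exact ⟨by simp; omega, h⟩

/-- The descent to a leaf that ends a search. -/
theorem descend_spec {s : State} {z : ℤ} {ρ : ℕ} {b : BExpr} {e f : Expr}
    (hz : s.loc .size = z) (ht : 1 ≤ s.loc .t) (hρ : z ≤ 2 ^ ρ) (hb : b.cost ≤ 10)
    (he : ∀ s, e.eval s = s.loc .t + s.loc .t ∨ e.eval s = s.loc .t + s.loc .t + 1)
    (hf : ∀ s, f.eval s = s.loc .t + s.loc .t ∨ f.eval s = s.loc .t + s.loc .t + 1)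
    (hec : e.cost ≤ 5) (hfc : f.cost ≤ 5) :
    wp (.while (.lt (.var .t) (.var .size)) (.ite b (.assign .t e) (.assign .t f))) s
      (fun t _ => (t : ℤ) ≤ 30 * ρ + 10) := by
  -- The exponent `k` bounds the remaining depth: both children of `t` are at least `2t`.
  refine (wp_while (fun B s' => ∃ k : ℕ, 1 ≤ s'.loc .t ∧ z ≤ s'.loc .t * 2 ^ k ∧
      B = 30 * k + 10) (B₀ := 30 * ρ + 10) (Post := fun _ => True) ?_ ?_ ?_).mono ?_
  · refine ⟨ρ, ht, hρ.trans ?_, rfl⟩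
    exact le_mul_of_one_le_left (by positivity) ht
  · rintro B s₁ hF ⟨k, h1, h2, rfl⟩ hlt
    have ez : s₁.loc .size = z := by rw [hF.loc .size rfl, hz]
    simp [ez] at hlt
    obtain ⟨k, rfl⟩ : ∃ m, k = m + 1 := by
      refine ⟨k - 1, ?_⟩
      by_contra hk
      rw [show k = 0 by omega] at h2
      simp at h2
      omega
    have step : ∀ y, y = s₁.loc .t + s₁.loc .t ∨ y = s₁.loc .t + s₁.loc .t + 1 →
        1 ≤ y ∧ z ≤ y * 2 ^ k := by
      intro y hy
      refine ⟨by omega, h2.trans ?_⟩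
      rw [pow_succ, mul_comm (2 ^ k) 2, ← mul_assoc]
      exact mul_le_mul_of_nonneg_right (by omega) (by positivity)
    simp only [wp_ite, wp_assign]
    refine ⟨fun _ => ⟨_, ?_, ?_, k, ?_, ?_, rfl⟩, fun _ => ⟨_, ?_, ?_, k, ?_, ?_, rfl⟩⟩
    · omega
    · simp; omega
    · simpa using (step _ (he s₁)).1
    · simpa using (step _ (he s₁)).2
    · omega
    · simp; omega
    · simpa using (step _ (hf s₁)).1
    · simpa using (step _ (hf s₁)).2
  · rintro B s₁ hF ⟨k, h1, h2, rfl⟩ hlt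
    exact ⟨by simp; omega, trivial⟩
  · rintro t s' - ⟨h, -⟩
    exact h

/-- With `t ≤ 2 ^ k`, the way up is measured by `2k + (1 - t % 2)`. A step to the left neighbour
makes `t` odd, and a step to the parent lowers `k`, so either decreases the measure. The walk stays
at nodes `≥ 1` and stops at node `1` at the latest. -/
theorem maxLess_spec {s : State} {z i : ℤ} {ρ : ℕ} (hz : s.loc .size = z) (hi : s.loc .i = i)
    (h : 2 ≤ z + i) (hi0 : 0 ≤ i) (hρ : z + i ≤ 2 ^ ρ) (hS : s.mem .S 1 = 1) :
    wp maxLessBody s (fun t _ => (t : ℤ) ≤ 80 * ρ + 80) := by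
  unfold maxLessBody
  rw [wp_seq, wp_assign, wp_seq]
  refine wp.mono (Q := fun t s' => (t : ℤ) ≤ 15 ∧ 1 ≤ s'.loc .t ∧ s'.loc .t ≤ 2 ^ ρ) ?_ ?_
  · simp [stepLeft, hz, hi]
    omega
  rintro t₁ s₁ hF₁ ⟨ht₁, h1, h2⟩
  have ez : s₁.loc .size = z := by rw [hF₁.loc .size rfl]; simp [hz]
  have eS : s₁.mem .S 1 = 1 := by rw [hF₁.mem .S rfl]; simpa using hS
  rw [wp_seq]
  refine (wp_while (fun B s' => ∃ k : ℕ, 1 ≤ s'.loc .t ∧ s'.loc .t ≤ 2 ^ k ∧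
      B = 25 * (2 * k + (1 - s'.loc .t % 2)) + 10) (B₀ := 25 * (2 * ρ + (1 - s₁.loc .t % 2)) + 10)
      (Post := fun s' => 1 ≤ s'.loc .t) ?_ ?_ ?_).mono ?_
  · exact ⟨ρ, h1, h2, rfl⟩
  · rintro B s₂ hF ⟨k, a1, a2, rfl⟩ hb
    have eS₂ : s₂.mem .S 1 = 1 := by rw [hF.mem .S rfl, eS]
    have hne : s₂.loc .t ≠ 1 := by
      rintro e
      simp [e, eS₂] at hb
    obtain ⟨k, rfl⟩ : ∃ m, k = m + 1 := by
      refine ⟨k - 1, ?_⟩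
      by_contra hk
      rw [show k = 0 by omega] at a2
      simp at a2
      omega
    have hp := pow_succ (2 : ℤ) k
    simp only [stepLeft, wp_ite, wp_assign]
    refine ⟨fun c => ⟨_, ?_, ?_, k + 1, ?_, ?_, rfl⟩, fun c => ⟨_, ?_, ?_, k, ?_, ?_, rfl⟩⟩ <;>
      simp at c ⊢ <;> omega
  · rintro B s₂ hF ⟨k, a1, a2, rfl⟩ hb
    exact ⟨by simp; omega, a1⟩
  rintro t₂ s₂ hF₂ ⟨ht₂, a1⟩
  have ez₂ : s₂.loc .size = z := by rw [hF₂.loc .size rfl, ez]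
  rw [wp_seq]
  refine (descend_spec (ρ := ρ) ez₂ a1 (by omega) ?_ ?_ ?_ ?_ ?_).mono ?_
  · simp
  · simp
  · simp
  · simp
  · simp
  rintro t₃ s₃ - ht₃
  simp
  omega

/-- The measure is `2k + t % 2`. A step to the right neighbour starts from an odd `t`, which differs
from an even `2 ^ k`, so `t + 1 ≤ 2 ^ k` still holds. The strict bound `hρ` leaves room for the
first step. -/
theorem minGreater_spec {s : State} {z i : ℤ} {ρ : ℕ} (hz : s.loc .size = z) (hi : s.loc .i = i)
    (h : 2 ≤ z + i) (hi0 : 0 ≤ i) (hρ : z + i < 2 ^ ρ) (hS : s.mem .S 1 = 1) :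
    wp minGreaterBody s (fun t _ => (t : ℤ) ≤ 80 * ρ + 80) := by
  unfold minGreaterBody
  rw [wp_seq, wp_assign, wp_seq]
  refine wp.mono (Q := fun t s' => (t : ℤ) ≤ 15 ∧ 1 ≤ s'.loc .t ∧ s'.loc .t ≤ 2 ^ ρ) ?_ ?_
  · simp [stepRight, hz, hi]
    omega
  rintro t₁ s₁ hF₁ ⟨ht₁, h1, h2⟩
  have ez : s₁.loc .size = z := by rw [hF₁.loc .size rfl]; simp [hz]
  have eS : s₁.mem .S 1 = 1 := by rw [hF₁.mem .S rfl]; simpa using hS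
  rw [wp_seq]
  refine (wp_while (fun B s' => ∃ k : ℕ, 1 ≤ s'.loc .t ∧ s'.loc .t ≤ 2 ^ k ∧
      B = 25 * (2 * k + s'.loc .t % 2) + 10) (B₀ := 25 * (2 * ρ + s₁.loc .t % 2) + 10)
      (Post := fun s' => 1 ≤ s'.loc .t) ?_ ?_ ?_).mono ?_
  · exact ⟨ρ, h1, h2, rfl⟩
  · rintro B s₂ hF ⟨k, a1, a2, rfl⟩ hb
    have eS₂ : s₂.mem .S 1 = 1 := by rw [hF.mem .S rfl, eS]
    have hne : s₂.loc .t ≠ 1 := by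
      rintro e
      simp [e, eS₂] at hb
    obtain ⟨k, rfl⟩ : ∃ m, k = m + 1 := by
      refine ⟨k - 1, ?_⟩
      by_contra hk
      rw [show k = 0 by omega] at a2
      simp at a2
      omega
    have hp := pow_succ (2 : ℤ) k
    simp only [stepRight, wp_ite, wp_assign]
    refine ⟨fun c => ⟨_, ?_, ?_, k, ?_, ?_, rfl⟩, fun c => ⟨_, ?_, ?_, k + 1, ?_, ?_, rfl⟩⟩ <;>
      simp at c ⊢ <;> omega
  · rintro B s₂ hF ⟨k, a1, a2, rfl⟩ hb
    exact ⟨by simp; omega, a1⟩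
  rintro t₂ s₂ hF₂ ⟨ht₂, a1⟩
  have ez₂ : s₂.loc .size = z := by rw [hF₂.loc .size rfl, ez]
  rw [wp_seq]
  refine (descend_spec (ρ := ρ) ez₂ a1 (by omega) ?_ ?_ ?_ ?_ ?_).mono ?_
  · simp
  · simp
  · simp
  · simp
  · simp
  rintro t₃ s₃ - ht₃
  simp
  omega

/-- Doubling stops at `size ≤ 2n + 2`, so leaves have numbers at most `3n + 2`; hence the condition
on `ρ`. -/
theorem initS_spec {s : State} {n : ℤ} {ρ : ℕ} (hn : s.loc .n = n) (hn0 : 0 ≤ n)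
    (hρ : 3 * n + 4 ≤ 2 ^ ρ) :
    wp initS s (fun t s' => (t : ℤ) ≤ (n + 3) * (20 * ρ + 150) ∧ n + 2 ≤ s'.loc .size ∧
      s'.loc .size ≤ 2 * n + 2 ∧ s'.mem .S 1 = 1) := by
  unfold initS
  rw [wp_seq, wp_assign, wp_seq]
  -- Each doubling adds at least one to `size`; the resulting linear bound on the number of rounds
  -- is good enough.
  refine (wp_while (fun B s' => 1 ≤ s'.loc .size ∧ s'.loc .size ≤ 2 * n + 2 ∧
      B = 20 * (2 * n + 4 - s'.loc .size) + 10) (B₀ := 20 * (2 * n + 3) + 10)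
      (Post := fun s' => n + 2 ≤ s'.loc .size ∧ s'.loc .size ≤ 2 * n + 2) ?_ ?_ ?_).mono ?_
  · simp
    omega
  · rintro B s₁ hF ⟨h1, h2, rfl⟩ hb
    have en : s₁.loc .n = n := by rw [hF.loc .n rfl]; simp [hn]
    simp [en] at hb
    simp
    omega
  · rintro B s₁ hF ⟨h1, h2, rfl⟩ hb
    have en : s₁.loc .n = n := by rw [hF.loc .n rfl]; simp [hn]
    simp [en] at hb
    exact ⟨by simp; omega, hb, h2⟩
  rintro t₁ s₁ hF₁ ⟨ht₁, hz1, hz2⟩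
  have en : s₁.loc .n = n := by rw [hF₁.loc .n rfl]; simp [hn]
  have insert : ∀ (s : State) (e : Expr), s.loc .size = s₁.loc .size → 0 ≤ e.eval s →
      e.eval s ≤ n → e.cost = 1 → wp (run .insert [.var .size, e]) s
      (fun t s' => (t : ℤ) ≤ 20 * ρ + 40 ∧ s'.mem .S 1 = 1) := by
    intro s e hs h1 h2 hc
    refine wp_call ((insert_spec (z := s₁.loc .size) (i := e.eval s) (ρ := ρ) ?_ ?_ (by omega)
      (by omega)).mono ?_)
    · simp [procs, hs]
    · simp [procs]
    · rintro t s' - ⟨ht, h⟩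
      exact ⟨by simp; omega, h⟩
  rw [wp_seq]
  refine (insert s₁ 0 rfl (by simp) (by simpa using hn0) (by simp)).mono ?_
  rintro t₂ s₂ hF₂ ⟨ht₂, hS₂⟩
  have en₂ : s₂.loc .n = n := by rw [hF₂.loc .n rfl, en]
  have ez₂ : s₂.loc .size = s₁.loc .size := hF₂.loc .size rfl
  rw [wp_seq]
  refine (insert s₂ (.var .n) ez₂ (by simpa [en₂] using hn0) (by simp [en₂]) (by simp)).mono ?_
  rintro t₃ s₃ hF₃ ⟨ht₃, hS₃⟩
  have en₃ : s₃.loc .n = n := by rw [hF₃.loc .n rfl, en₂]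
  have ez₃ : s₃.loc .size = s₁.loc .size := by rw [hF₃.loc .size rfl, ez₂]
  rw [wp_seq, wp_assign]
  refine (wp_while (fun B s' => 1 ≤ s'.loc .u ∧ (s'.loc .u ≤ n ∨ s'.loc .u = 1) ∧
      s'.mem .S 1 = 1 ∧ B = (n + 1 - s'.loc .u) * (20 * ρ + 70) + 10)
      (B₀ := n * (20 * ρ + 70) + 10) (Post := fun s' => s'.mem .S 1 = 1) ?_ ?_ ?_).mono ?_
  · simp [hS₃]
  · rintro B s₄ hF ⟨h1, h2, hS, rfl⟩ hb
    have en₄ : s₄.loc .n = n := by rw [hF.loc .n rfl]; simp [en₃]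
    have ez₄ : s₄.loc .size = s₁.loc .size := by rw [hF.loc .size rfl]; simp [ez₃]
    simp [en₄] at hb
    rw [wp_seq]
    refine wp.mono (Q := fun t s' => (t : ℤ) ≤ 20 * ρ + 50 ∧ s'.mem .S 1 = 1) ?_ ?_
    · unfold when
      rw [wp_ite, wp_skip]
      refine ⟨fun _ => ?_, fun _ => ⟨by simp; omega, hS⟩⟩
      refine (insert s₄ (.var .u) ez₄ (by simp; omega) (by simp; omega) (by simp)).mono ?_
      rintro t s' - ⟨ht, h⟩
      exact ⟨by simp; omega, h⟩
    rintro t₅ s₅ hF₅ ⟨ht₅, hS₅⟩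
    have eu : s₅.loc .u = s₄.loc .u := hF₅.loc .u rfl
    have hB : 0 ≤ (n - s₄.loc .u) * (20 * (ρ : ℤ) + 70) := mul_nonneg (by omega) (by omega)
    rw [wp_assign]
    refine ⟨(n - s₄.loc .u) * (20 * ρ + 70) + 10, by omega, ?_, ?_, ?_, hS₅, ?_⟩
    · simp
      rw [show n + 1 - s₄.loc .u = (n - s₄.loc .u) + 1 by ring, add_mul]
      omega
    · simp [eu]; omega
    · simp [eu]; omega
    · simp [eu]
  · rintro B s₄ hF ⟨h1, h2, hS, rfl⟩ hb
    have hB : 0 ≤ (n + 1 - s₄.loc .u) * (20 * (ρ : ℤ) + 70) := mul_nonneg (by omega) (by omega)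
    exact ⟨by simp; omega, hS⟩
  rintro t₄ s₄ hF₄ ⟨ht₄, hS₄⟩
  have ez₄ : s₄.loc .size = s₁.loc .size := by rw [hF₄.loc .size rfl]; simp [ez₃]
  refine ⟨?_, by omega, by omega, hS₄⟩
  simp
  have : 0 ≤ n * (ρ : ℤ) := by positivity
  nlinarith

/-! ### Counting -/

theorem cnt_or {f : ℤ → ℤ} {lo hi : ℤ} {p p' : ℤ → Prop}
    (h : ∀ q, lo ≤ q → q ≤ hi → p (f q) → ¬ p' (f q)) :
    cnt f lo hi (fun z => p z ∨ p' z) = cnt f lo hi p + cnt f lo hi p' := by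
  classical
  unfold cnt
  rw [← Finset.card_union_of_disjoint, ← Finset.filter_or]
  · congr
  · rw [Finset.disjoint_filter]
    intro q hq
    rw [Finset.mem_Icc] at hq
    exact h q hq.1 hq.2

theorem cnt_succ {f : ℤ → ℤ} {lo hi : ℤ} {p : ℤ → Prop} [Decidable (p (f hi))] (h : lo ≤ hi) :
    cnt f lo hi p = cnt f lo (hi - 1) p + if p (f hi) then 1 else 0 := by
  rw [cnt_split (m := hi - 1) (by omega) (by omega), sub_add_cancel]
  split_ifs with hp
  · rw [cnt_single.2 hp]
  · rw [cnt_none (lo := hi) fun q a b => by rwa [show q = hi by omega]]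

/-- The exact counts matter only for the variant, where they make the ranks a permutation. -/
theorem countLCP_spec {s : State} {n : ℤ} (hn : s.loc .n = n) (hn0 : 0 ≤ n)
    (hL : 1 ≤ n → ∀ q, 0 ≤ s.mem .LCP q ∧ s.mem .LCP q < n) (hC : ∀ q, s.mem .cnt q = 0) :
    wp countLCP s (fun t s' => (t : ℤ) ≤ 50 * (n + 1) ∧ ∀ q, 0 ≤ q → q ≤ n →
      s'.mem .cnt q = cnt (s.mem .LCP) 0 (n - 1) (· < q)) := by
  unfold countLCP
  rw [wp_seq, wp_assign, wp_seq]
  refine (wp_while (fun B s' => 0 ≤ s'.loc .u ∧ s'.loc .u ≤ n ∧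
      (∀ q, s'.mem .cnt q = cnt (s.mem .LCP) 0 (s'.loc .u - 1) (· + 1 = q)) ∧
      B = (n - s'.loc .u) * 25 + 8) (B₀ := n * 25 + 8) (Post := fun s' =>
      ∀ q, s'.mem .cnt q = cnt (s.mem .LCP) 0 (n - 1) (· + 1 = q)) ?_ ?_ ?_).mono ?_
  · simp [hC, hn0, cnt_empty]
  · rintro B s₁ hF ⟨h1, h2, hc, rfl⟩ hb
    have en : s₁.loc .n = n := by rw [hF.loc .n rfl]; simp [hn]
    have eL : s₁.mem .LCP = s.mem .LCP := by rw [hF.mem .LCP rfl]; simp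
    simp [en] at hb
    simp [eL]
    refine ⟨by omega, by omega, by omega, by omega, fun q => ?_⟩
    rw [cnt_succ h1, Function.update_apply]
    push_cast
    split_ifs with c1 c2 c2
    · rw [hc, c1]
    · omega
    · omega
    · rw [hc, add_zero]
  · rintro B s₁ hF ⟨h1, h2, hc, rfl⟩ hb
    have en : s₁.loc .n = n := by rw [hF.loc .n rfl]; simp [hn]
    simp [en] at hb
    rw [show s₁.loc .u = n by omega] at hc
    exact ⟨by simp; omega, hc⟩
  rintro t₁ s₁ hF₁ ⟨ht₁, hc⟩
  have en : s₁.loc .n = n := by rw [hF₁.loc .n rfl]; simp [hn]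
  rw [wp_seq, wp_assign]
  refine (wp_while (fun B s' => 1 ≤ s'.loc .u ∧ s'.loc .u ≤ n + 1 ∧
      (∀ q, 0 ≤ q → q < s'.loc .u → s'.mem .cnt q = cnt (s.mem .LCP) 0 (n - 1) (· < q)) ∧
      (∀ q, s'.loc .u ≤ q → s'.mem .cnt q = cnt (s.mem .LCP) 0 (n - 1) (· + 1 = q)) ∧
      B = (n + 1 - s'.loc .u) * 25 + 8) (B₀ := n * 25 + 8) (Post := fun s' =>
      ∀ q, 0 ≤ q → q ≤ n → s'.mem .cnt q = cnt (s.mem .LCP) 0 (n - 1) (· < q)) ?_ ?_ ?_).mono ?_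
  · simp
    refine ⟨hn0, fun q h1 h2 => ?_, fun q h1 => hc q⟩
    rw [hc]
    norm_cast
    exact cnt_congr fun u _ _ => by have := (hL (by omega) u).1; omega
  · rintro B s₂ hF ⟨h1, h2, hlt, hge, rfl⟩ hb
    have en₂ : s₂.loc .n = n := by rw [hF.loc .n rfl]; simp [en]
    simp [en₂] at hb
    simp
    refine ⟨by omega, by omega, by omega, by omega, fun q a b => ?_, fun q a => ?_⟩
    · rw [Function.update_apply]
      split_ifs with c
      · rw [hge _ le_rfl, hlt _ (by omega) (by omega), c, ← Nat.cast_add, ← cnt_or]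
        · norm_cast
          exact cnt_congr fun u _ _ => by omega
        · intro q _ _; omega
      · exact hlt q a (by omega)
    · rw [Function.update_of_ne (by omega)]
      exact hge q (by omega)
  · rintro B s₂ hF ⟨h1, h2, hlt, hge, rfl⟩ hb
    have en₂ : s₂.loc .n = n := by rw [hF.loc .n rfl]; simp [en]
    simp [en₂] at hb
    exact ⟨by simp; omega, fun q a b => hlt q a (by omega)⟩
  rintro t₂ s₂ - ⟨ht₂, h⟩
  exact ⟨by simp; omega, h⟩

/-- Whatever the counts are, only indices `u < n` are written into an array of zeros. This range
suffices to use the entries as leaves. -/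
theorem sortLCP_spec {s : State} {n : ℤ} (hn : s.loc .n = n) (hn0 : 0 ≤ n)
    (hL : 1 ≤ n → ∀ q, 0 ≤ s.mem .LCP q ∧ s.mem .LCP q < n) (hC : ∀ q, s.mem .cnt q = 0)
    (hI : ∀ q, s.mem .I q = 0) :
    wp sortLCP s (fun t s' => (t : ℤ) ≤ 80 * (n + 1) ∧
      ∀ q, 0 ≤ s'.mem .I q ∧ s'.mem .I q ≤ n) := by
  unfold sortLCP
  rw [wp_seq]
  refine (countLCP_spec hn hn0 hL hC).mono ?_
  rintro t₁ s₁ hF₁ ⟨ht₁, -⟩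
  have en : s₁.loc .n = n := by rw [hF₁.loc .n rfl, hn]
  have eI : s₁.mem .I = s.mem .I := hF₁.mem .I rfl
  rw [wp_seq, wp_assign]
  refine (wp_while (fun B s' => 0 ≤ s'.loc .u ∧ s'.loc .u ≤ n ∧
      (∀ q, 0 ≤ s'.mem .I q ∧ s'.mem .I q ≤ n) ∧
      B = (n - s'.loc .u) * 28 + 8) (B₀ := n * 28 + 8) (Post := fun s' =>
      ∀ q, 0 ≤ s'.mem .I q ∧ s'.mem .I q ≤ n) ?_ ?_ ?_).mono ?_
  · simp [hn0, eI, hI]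
  · rintro B s₂ hF ⟨h1, h2, hI, rfl⟩ hb
    have en₂ : s₂.loc .n = n := by rw [hF.loc .n rfl]; simp [en]
    simp [en₂] at hb
    simp
    refine ⟨by omega, by omega, by omega, by omega, fun q => ?_⟩
    rw [Function.update_apply]
    split_ifs with c
    · exact ⟨h1, h2⟩
    · exact hI q
  · rintro B s₂ hF ⟨h1, h2, hI, rfl⟩ hb
    exact ⟨by simp; omega, hI⟩
  rintro t₂ s₂ - ⟨ht₂, h⟩
  exact ⟨by simp; omega, h⟩

/-- The rank of `v` is one more than the number of smaller values plus the number of equal values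
before `v`. It grows strictly in the lexicographic order of value and index, so it is injective, as
following cycles requires. -/
theorem rankLCP_spec {s : State} {n : ℤ} (hn : s.loc .n = n) (hn0 : 0 ≤ n)
    (hL : 1 ≤ n → ∀ q, 0 ≤ s.mem .LCP q ∧ s.mem .LCP q < n) (hC : ∀ q, s.mem .cnt q = 0) :
    wp rankLCP s (fun t s' => (t : ℤ) ≤ 80 * (n + 1) ∧
      (∀ q, 1 ≤ q → q ≤ n → 1 ≤ s'.mem .I q ∧ s'.mem .I q ≤ n) ∧
      ∀ q q', 1 ≤ q → q ≤ n → 1 ≤ q' → q' ≤ n → s'.mem .I q = s'.mem .I q' → q = q') := by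
  unfold rankLCP
  rw [wp_seq]
  refine (countLCP_spec hn hn0 hL hC).mono ?_
  rintro t₁ s₁ hF₁ ⟨ht₁, hc⟩
  have en : s₁.loc .n = n := by rw [hF₁.loc .n rfl, hn]
  have eL : s₁.mem .LCP = s.mem .LCP := hF₁.mem .LCP rfl
  rw [wp_seq, wp_assign]
  refine (wp_while (fun B s' => 0 ≤ s'.loc .u ∧ s'.loc .u ≤ n ∧
      (∀ q, 0 ≤ q → q < n → s'.mem .cnt q = cnt (s.mem .LCP) 0 (n - 1) (· < q) +
        cnt (s.mem .LCP) 0 (s'.loc .u - 1) (· = q)) ∧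
      (∀ v, 0 ≤ v → v < s'.loc .u → s'.mem .I (v + 1) =
        cnt (s.mem .LCP) 0 (n - 1) (· < s.mem .LCP v) +
        cnt (s.mem .LCP) 0 (v - 1) (· = s.mem .LCP v) + 1) ∧
      B = (n - s'.loc .u) * 29 + 8) (B₀ := n * 29 + 8) (Post := fun s' =>
      (∀ v, 0 ≤ v → v < n → s'.mem .I (v + 1) =
        cnt (s.mem .LCP) 0 (n - 1) (· < s.mem .LCP v) +
        cnt (s.mem .LCP) 0 (v - 1) (· = s.mem .LCP v) + 1)) ?_ ?_ ?_).mono ?_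
  · simp
    refine ⟨hn0, fun q a b => ?_, by intros; omega⟩
    rw [hc q a b.le, cnt_empty (hi := -1) (by omega)]
    simp
  · rintro B s₂ hF ⟨h1, h2, hc, hI, rfl⟩ hb
    have en₂ : s₂.loc .n = n := by rw [hF.loc .n rfl]; simp [en]
    have eL₂ : s₂.mem .LCP = s.mem .LCP := by rw [hF.mem .LCP rfl]; simp [eL]
    simp [en₂] at hb
    have hLu := hL (by omega) (s₂.loc .u)
    simp [eL₂]
    refine ⟨by omega, by omega, by omega, by omega, fun q a b => ?_, fun v a b => ?_⟩
    · rw [cnt_succ h1, Function.update_apply]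
      push_cast
      split_ifs with c1 c2 c2
      · rw [hc _ hLu.1 hLu.2, c1, add_assoc]
      · exact absurd c1.symm c2
      · exact absurd c2.symm c1
      · rw [hc q a b, add_zero]
    · rw [Function.update_apply]
      split_ifs with c
      · rw [hc _ hLu.1 hLu.2, show v = s₂.loc .u by omega]
      · exact hI v a (by omega)
  · rintro B s₂ hF ⟨h1, h2, hc, hI, rfl⟩ hb
    have en₂ : s₂.loc .n = n := by rw [hF.loc .n rfl]; simp [en]
    simp [en₂] at hb
    exact ⟨by simp; omega, fun v a b => hI v a (by omega)⟩
  rintro t₂ s₂ - ⟨ht₂, hI⟩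
  -- up to the last of the indices with the same value
  have hup : ∀ v, 0 ≤ v → v < n → s₂.mem .I (v + 1) ≤
      cnt (s.mem .LCP) 0 (n - 1) (· ≤ s.mem .LCP v) := by
    intro v a b
    rw [hI v a b]
    have h1 : cnt (s.mem .LCP) 0 (n - 1) (· ≤ s.mem .LCP v) =
        cnt (s.mem .LCP) 0 (n - 1) (· < s.mem .LCP v) +
        cnt (s.mem .LCP) 0 (n - 1) (· = s.mem .LCP v) := by
      rw [← cnt_or fun q _ _ => by omega]
      exact cnt_congr fun q _ _ => by omega
    have h2 := cnt_split (f := s.mem .LCP) (lo := 0) (hi := n - 1) (m := v)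
      (p := (· = s.mem .LCP v)) (by omega) (by omega)
    have h3 := cnt_succ (f := s.mem .LCP) (lo := 0) (hi := v) (p := (· = s.mem .LCP v)) a
    rw [if_pos rfl] at h3
    omega
  have hlt : ∀ v v', 0 ≤ v → v < n → 0 ≤ v' → v' < n → s.mem .LCP v < s.mem .LCP v' →
      s₂.mem .I (v + 1) < s₂.mem .I (v' + 1) := by
    intro v v' a b a' b' h
    have h1 := hup v a b
    have h2 := cnt_mono (f := s.mem .LCP) (f' := s.mem .LCP) (lo := 0) (hi := n - 1)
      (p := (· ≤ s.mem .LCP v)) (p' := (· < s.mem .LCP v')) fun q _ _ => by omega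
    rw [hI v' a' b']
    omega
  have hlt' : ∀ v v', 0 ≤ v → v < v' → v' < n → s.mem .LCP v = s.mem .LCP v' →
      s₂.mem .I (v + 1) < s₂.mem .I (v' + 1) := by
    intro v v' a b c h
    rw [hI v a (by omega), hI v' (by omega) c, ← h]
    have h2 := cnt_split (f := s.mem .LCP) (lo := 0) (hi := v' - 1) (m := v)
      (p := (· = s.mem .LCP v)) (by omega) (by omega)
    have h3 := cnt_succ (f := s.mem .LCP) (lo := 0) (hi := v) (p := (· = s.mem .LCP v)) a
    rw [if_pos rfl] at h3
    omega
  have hne : ∀ v v', 0 ≤ v → v < v' → v' < n → s₂.mem .I (v + 1) ≠ s₂.mem .I (v' + 1) := by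
    intro v v' a b c
    rcases lt_trichotomy (s.mem .LCP v) (s.mem .LCP v') with h | h | h
    · exact (hlt v v' a (by omega) (by omega) c h).ne
    · exact (hlt' v v' a b c h).ne
    · exact (hlt v' v (by omega) c a (by omega) h).ne'
  refine ⟨by simp; omega, fun q a b => ?_, fun q q' a b a' b' e => ?_⟩
  · have h1 := hup (q - 1) (by omega) (by omega)
    have h2 := hI (q - 1) (by omega) (by omega)
    have h3 := cnt_le (f := s.mem .LCP) (lo := 0) (hi := n - 1)
      (p := (· ≤ s.mem .LCP (q - 1))) (by omega)
    rw [sub_add_cancel] at h1 h2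
    omega
  · rcases lt_trichotomy q q' with h | h | h
    · refine absurd ?_ (hne (q - 1) (q' - 1) (by omega) (by omega) (by omega))
      rwa [sub_add_cancel, sub_add_cancel]
    · exact h
    · refine absurd ?_ (hne (q' - 1) (q - 1) (by omega) (by omega) (by omega))
      rw [sub_add_cancel, sub_add_cancel, e]

/-! ### Inversion of a permutation in place -/

theorem cnt_update {f : ℤ → ℤ} {lo hi q z : ℤ} {p : ℤ → Prop} (h₁ : lo ≤ q) (h₂ : q ≤ hi)
    (hp : p (f q)) (hz : ¬ p z) :
    cnt (Function.update f q z) lo hi p + 1 = cnt f lo hi p := by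
  rw [cnt_split (m := q) (by omega) h₂, cnt_split (f := f) (m := q) (by omega) h₂,
    cnt_split (hi := q) (m := q - 1) (by omega) (by omega),
    cnt_split (f := f) (hi := q) (m := q - 1) (by omega) (by omega), sub_add_cancel,
    cnt_single.2 hp, cnt_none (f := Function.update f q z) (lo := q) (hi := q),
    cnt_congr (f := Function.update f q z) (f' := f) (p := p) (p' := p) (lo := lo),
    cnt_congr (f := Function.update f q z) (f' := f) (p := p) (p' := p) (lo := q + 1)]
  · omega
  · intro u a b; rw [Function.update_of_ne (by omega)]
  · intro u a b; rw [Function.update_of_ne (by omega)]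
  · intro u a b; rw [show u = q by omega, Function.update_self]; exact hz

/-- The state of the inversion before cell `k` is treated: the cells to the right of `k` are
inverted; among the other cells, the positive ones contain the cycles that have not been visited,
and the negative ones contain the negated inverse of the permutation. -/
structure InvertInv (J : ℤ → ℤ) (n k : ℤ) : Prop where
  done : ∀ q, k < q → q ≤ n → 1 ≤ J q ∧ J q ≤ n
  cells : ∀ q, 1 ≤ q → q ≤ k → (J q < 0 ∧ -n ≤ J q) ∨ (1 ≤ J q ∧ J q ≤ k ∧ 0 < J (J q))
  inj : ∀ q q', 1 ≤ q → q ≤ k → 1 ≤ q' → q' ≤ k → 0 < J q → J q = J q' → q = q'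

/-- The state within a cycle that began with cell `k`, when the current cell is `x`. -/
structure CycleInv (J : ℤ → ℤ) (n k x : ℤ) : Prop where
  one_le : 1 ≤ x
  le : x ≤ k
  neg : J k < 0
  done : ∀ q, k < q → q ≤ n → 1 ≤ J q ∧ J q ≤ n
  cells : ∀ q, 1 ≤ q → q ≤ k → (J q < 0 ∧ (q = k ∨ -n ≤ J q)) ∨
    (1 ≤ J q ∧ J q ≤ k ∧ (0 < J (J q) ∨ J q = k))
  inj : ∀ q q', 1 ≤ q → q ≤ k → 1 ≤ q' → q' ≤ k → 0 < J q → J q = J q' → q = q'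
  fresh : ∀ q, 1 ≤ q → q ≤ k → J q ≠ x
  current : 0 < J x ∨ x = k

/-- Overwriting cell `k` removes the only reference to cell `J k`. The mark `j` may be any negative
number, since cell `k` is written again when the cycle closes. -/
theorem InvertInv.start {J : ℤ → ℤ} {n k j : ℤ} (h : InvertInv J n k) (hk : 1 ≤ k) (hJ : 0 < J k)
    (hj : j < 0) : CycleInv (Function.update J k j) n k (J k) := by
  have hc := (h.cells k hk le_rfl).resolve_left (by omega)
  refine ⟨hc.1, hc.2.1, by simpa using hj, fun q a b => ?_, fun q a b => ?_,
    fun q q' a b a' b' p e => ?_, fun q a b => ?_, ?_⟩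
  · rw [Function.update_of_ne (by omega)]
    exact h.done q a b
  · by_cases c : q = k
    · subst c; left; simp [hj]
    · rw [Function.update_of_ne c]
      rcases h.cells q a b with h1 | h1
      · exact .inl ⟨h1.1, .inr h1.2⟩
      · refine .inr ⟨h1.1, h1.2.1, ?_⟩
        by_cases d : J q = k
        · exact .inr d
        · rw [Function.update_of_ne d]
          exact .inl h1.2.2
  · by_cases c : q = k
    · subst c
      simp at p
      omega
    · rw [Function.update_of_ne c] at p e
      by_cases c' : q' = k
      · subst c'
        simp at e
        omega
      · rw [Function.update_of_ne c'] at e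
        exact h.inj q q' a b a' b' p e
  · by_cases c : q = k
    · subst c; simp; omega
    · rw [Function.update_of_ne c]
      intro e
      exact c (h.inj q k a b hk le_rfl (by omega) e)
  · by_cases c : J k = k
    · exact .inr c
    · rw [Function.update_of_ne c]
      exact .inl hc.2.2

/-- By `fresh` no cell refers to `x`, so making it negative spoils no reference. By injectivity the
next cell `J x` then loses its only reference. -/
theorem CycleInv.step {J : ℤ → ℤ} {n k x j : ℤ} (h : CycleInv J n k x) (hJ : 0 < J x)
    (hj : j < 0) (hjn : -n ≤ j) : CycleInv (Function.update J x j) n k (J x) := by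
  have hx1 := h.one_le
  have hxk := h.le
  have hc := (h.cells x hx1 hxk).resolve_left (by omega)
  have hne : x ≠ k := by rintro rfl; have := h.neg; omega
  refine ⟨hc.1, hc.2.1, ?_, fun q a b => ?_, fun q a b => ?_,
    fun q q' a b a' b' p e => ?_, fun q a b => ?_, ?_⟩
  · rw [Function.update_of_ne hne.symm]
    exact h.neg
  · rw [Function.update_of_ne (by omega)]
    exact h.done q a b
  · by_cases c : q = x
    · subst c; left; simp [hj, hjn]
    · rw [Function.update_of_ne c]
      rcases h.cells q a b with h1 | h1
      · exact .inl h1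
      · rw [Function.update_of_ne (h.fresh q a b)]
        exact .inr h1
  · by_cases c : q = x
    · subst c
      simp at p
      omega
    · rw [Function.update_of_ne c] at p e
      by_cases c' : q' = x
      · subst c'
        simp at e
        omega
      · rw [Function.update_of_ne c'] at e
        exact h.inj q q' a b a' b' p e
  · by_cases c : q = x
    · subst c; simp; omega
    · rw [Function.update_of_ne c]
      intro e
      exact c (h.inj q x a b hx1 hxk (by omega) e)
  · rw [Function.update_of_ne (h.fresh x hx1 hxk)]
    exact hc.2.2

/-- Back at `k`, no cell refers to `k`, so the unvisited cells below `k` refer only to cells below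
`k`. -/
theorem CycleInv.finish {J : ℤ → ℤ} {n k z : ℤ} (h : CycleInv J n k k) (hz₁ : 1 ≤ z)
    (hz₂ : z ≤ n) : InvertInv (Function.update J k z) n (k - 1) := by
  refine ⟨fun q a b => ?_, fun q a b => ?_, fun q q' a b a' b' p e => ?_⟩
  · by_cases c : q = k
    · subst c; simp [hz₁, hz₂]
    · rw [Function.update_of_ne c]
      exact h.done q (by omega) b
  · rw [Function.update_of_ne (by omega)]
    have hf := h.fresh q a (by omega)
    rw [Function.update_of_ne hf]
    rcases h.cells q a (by omega) with h1 | h1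
    · left; omega
    · right
      omega
  · rw [Function.update_of_ne (by omega)] at p e
    rw [Function.update_of_ne (by omega)] at e
    exact h.inj q q' a (by omega) a' (by omega) p e

/-- A cell that is not positive was visited on an earlier cycle. Unvisited cells refer only to
positive cells, hence not to `k`. -/
theorem InvertInv.finish {J : ℤ → ℤ} {n k : ℤ} (h : InvertInv J n k) (hk : 1 ≤ k)
    (hJ : J k ≤ 0) : InvertInv (Function.update J k (-J k)) n (k - 1) := by
  have hc := (h.cells k hk le_rfl).resolve_right (by omega)
  refine ⟨fun q a b => ?_, fun q a b => ?_, fun q q' a b a' b' p e => ?_⟩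
  · by_cases c : q = k
    · subst c; simp; omega
    · rw [Function.update_of_ne c]
      exact h.done q (by omega) b
  · rw [Function.update_of_ne (by omega)]
    rcases h.cells q a (by omega) with h1 | h1
    · left; omega
    · have hf : J q ≠ k := by
        intro e
        rw [e] at h1
        omega
      rw [Function.update_of_ne hf]
      right
      omega
  · rw [Function.update_of_ne (by omega)] at p e
    rw [Function.update_of_ne (by omega)] at e
    exact h.inj q q' a (by omega) a' (by omega) p e

/-- The number of positive cells up to `k` is the potential: each step along a cycle turns one of
them negative, so all cycles together take linear time. Of the result only the range is needed, for
its use as leaves. -/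
theorem invertInPlace_spec {s : State} {n : ℤ} (hn : s.loc .n = n) (hn0 : 0 ≤ n)
    (hr : ∀ q, 1 ≤ q → q ≤ n → 1 ≤ s.mem .I q ∧ s.mem .I q ≤ n)
    (hinj : ∀ q q', 1 ≤ q → q ≤ n → 1 ≤ q' → q' ≤ n → s.mem .I q = s.mem .I q' → q = q') :
    wp invertInPlace s (fun t s' => (t : ℤ) ≤ 100 * (n + 1) ∧
      ∀ q, 1 ≤ q → q ≤ n → 1 ≤ s'.mem .I q ∧ s'.mem .I q ≤ n) := by
  unfold invertInPlace
  rw [wp_seq, wp_assign, wp_seq, wp_assign]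
  have hcn := cnt_le (f := s.mem .I) (lo := 1) (hi := n) (p := (0 < ·)) (by omega)
  refine (wp_while (fun B s' => 0 ≤ s'.loc .k ∧ s'.loc .k ≤ n ∧ s'.loc .j < 0 ∧
      InvertInv (s'.mem .I) n (s'.loc .k) ∧
      B = 50 * s'.loc .k + 30 * cnt (s'.mem .I) 1 (s'.loc .k) (0 < ·) + 8)
      (B₀ := 50 * n + 30 * cnt (s.mem .I) 1 n (0 < ·) + 8)
      (Post := fun s' => ∀ q, 1 ≤ q → q ≤ n → 1 ≤ s'.mem .I q ∧ s'.mem .I q ≤ n)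
      ?_ ?_ ?_).mono ?_
  · simp [hn, hn0]
    exact ⟨by intros; omega, fun q a b => .inr ⟨(hr q a b).1, (hr q a b).2,
      (hr _ (hr q a b).1 (hr q a b).2).1⟩, fun q q' a b a' b' _ e => hinj q q' a b a' b' e⟩
  · rintro B s₁ hF ⟨hk0, hkn, hj, hI, rfl⟩ hb
    simp at hb
    obtain ⟨k, hk⟩ : ∃ k, k = s₁.loc .k := ⟨_, rfl⟩
    rw [← hk] at hb hI hk0 hkn
    rw [wp_seq, wp_assign, wp_seq, wp_assign, wp_seq]
    refine wp.mono (Q := fun t s₂ => ∃ z J, (t : ℤ) ≤ 30 * cnt (s₁.mem .I) 1 k (0 < ·) -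
        30 * cnt (s₂.mem .I) 1 (k - 1) (0 < ·) + 20 ∧ s₂.loc .x = k ∧ z = -s₂.loc .i ∧
        J = Function.update (s₂.mem .I) k z ∧ InvertInv J n (k - 1) ∧ s₂.loc .j < 0) ?_ ?_
    · simp only [when, wp_ite, wp_skip, wp_seq]
      constructor
      · intro hpos
        simp [← hk] at hpos
        refine wp_while_unroll (by simpa [← hk] using hpos) ?_
        simp only [wp_seq, wp_store, wp_assign]
        simp [← hk]
        have hstart := hI.start (j := s₁.loc .j) (by omega) hpos hj
        have hcnt := cnt_update (f := s₁.mem .I) (lo := 1) (hi := k) (q := k) (z := s₁.loc .j)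
          (p := (0 < ·)) (by omega) le_rfl hpos (by omega)
        refine (wp_while_amortized (fun B s' => CycleInv (s'.mem .I) n k (s'.loc .x) ∧
          s'.loc .i = s'.mem .I (s'.loc .x) ∧ s'.loc .j < 0 ∧ -n ≤ s'.loc .j ∧
          B = 30 * cnt (s'.mem .I) 1 k (0 < ·))
          (B₀ := 30 * cnt (Function.update (s₁.mem .I) k (s₁.loc .j)) 1 k (0 < ·))
          (Post := fun B s' => CycleInv (s'.mem .I) n k k ∧ s'.loc .x = k ∧
            s'.loc .j < 0 ∧ -n ≤ s'.loc .j ∧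
            B = 30 * cnt (s'.mem .I) 1 k (0 < ·) - 4) ?_ ?_ ?_).mono ?_
        · simp
          exact ⟨hstart, by omega, by omega⟩
        · rintro B s₂ - ⟨hC, hi, hj, hjn, rfl⟩ hb₂
          simp [hi] at hb₂
          have hstep := hC.step hb₂ hj hjn
          have hcnt := cnt_update (f := s₂.mem .I) (lo := 1) (hi := k) (q := s₂.loc .x)
            (z := s₂.loc .j) (p := (0 < ·)) hC.one_le hC.le hb₂ (by omega)
          have := hC.one_le
          have := hC.le
          simp [hi]
          exact ⟨by omega, hstep, by omega, by omega⟩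
        · rintro B s₂ - ⟨hC, hi, hj, hjn, rfl⟩ hb₂
          simp [hi] at hb₂
          have hx := hC.current.resolve_left (by omega)
          rw [hx] at hC
          refine ⟨hC, hx, hj, hjn, ?_⟩
          simp
        · rintro t s₂ - ⟨B, ht, hC, hx, hj, hjn, rfl⟩
          have := cnt_split (f := s₂.mem .I) (lo := 1) (hi := k) (m := k - 1) (p := (0 < ·))
            (by omega) (by omega)
          simp [hx]
          exact ⟨by omega, hC.finish (by omega) (by omega), hj⟩
      · intro hneg
        simp [← hk] at hneg
        have := cnt_split (f := s₁.mem .I) (lo := 1) (hi := k) (m := k - 1) (p := (0 < ·))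
            (by omega) (by omega)
        simp [← hk]
        exact ⟨by omega, hI.finish (by omega) hneg, hj⟩
    rintro t₂ s₂ hF₂ ⟨z, J, ht₂, hx, rfl, rfl, hI₂, hj₂⟩
    have ek : s₂.loc .k = k := by rw [hF₂.loc .k rfl]; simp [hk]
    have hcnt : cnt (Function.update (s₂.mem .I) k (-s₂.loc .i)) 1 (k - 1) (0 < ·) =
        cnt (s₂.mem .I) 1 (k - 1) (0 < ·) :=
      cnt_congr fun q _ _ => by rw [Function.update_of_ne (by omega)]
    simp only [wp_seq, wp_store, wp_assign]
    simp [ek, hx, hcnt, ← hk]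
    exact ⟨by omega, by omega, by omega, by omega, hj₂, hI₂⟩
  · rintro B s₁ hF ⟨hk0, hkn, hj, hI, rfl⟩ hb
    simp at hb
    exact ⟨by simp; omega, fun q a b => hI.done q (by omega) b⟩
  · rintro t s' - ⟨ht, h⟩
    exact ⟨by simp; omega, h⟩

/-! ### The algorithm -/

theorem updateS_spec {s : State} {z i : ℤ} {ρ : ℕ} (hz : s.loc .size = z) (hi : s.loc .i = i)
    (hz2 : 2 ≤ z) (hi0 : 0 ≤ i) (hρ : z + i < 2 ^ ρ) (hS : s.mem .S 1 = 1) :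
    wp updateS s (fun t s' => (t : ℤ) ≤ 180 * ρ + 230 ∧ s'.mem .S 1 = 1) := by
  unfold updateS
  rw [wp_seq]
  refine wp.mono (Q := fun t _ => (t : ℤ) ≤ 80 * ρ + 90) ?_ ?_
  · refine wp_call ((maxLess_spec (z := z) (i := i) (ρ := ρ) ?_ ?_ (by omega) hi0 hρ.le ?_).mono
      ?_)
    · simp [procs, hz]
    · simp [procs, hi]
    · exact hS
    · rintro t s' - ht
      simp; omega
  rintro t₁ s₁ hF₁ ht₁
  have ez₁ : s₁.loc .size = z := by rw [hF₁.loc .size rfl, hz]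
  have ei₁ : s₁.loc .i = i := by rw [hF₁.loc .i rfl, hi]
  have eS₁ : s₁.mem .S 1 = 1 := by rw [hF₁.mem .S rfl, hS]
  rw [wp_seq, wp_assign, wp_seq]
  refine wp.mono (Q := fun t _ => (t : ℤ) ≤ 80 * ρ + 90) ?_ ?_
  · refine wp_call ((minGreater_spec (z := z) (i := i) (ρ := ρ) ?_ ?_ (by omega) hi0 hρ ?_).mono
      ?_)
    · simp [procs, ez₁]
    · simp [procs, ei₁]
    · exact eS₁
    · rintro t s' - ht
      simp; omega
  rintro t₂ s₂ hF₂ ht₂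
  have ez₂ : s₂.loc .size = z := by rw [hF₂.loc .size rfl]; simp [ez₁]
  have ei₂ : s₂.loc .i = i := by rw [hF₂.loc .i rfl]; simp [ei₁]
  unfold run
  refine wp_call ((insert_spec (z := z) (i := i) (ρ := ρ) ?_ ?_ (by omega) hρ.le).mono ?_)
  · simp [procs, ez₂]
  · simp [procs, ei₂]
  · rintro t s' - ⟨ht, hS'⟩
    exact ⟨by simp; omega, hS'⟩

/-- The state after the initial set has been computed. -/
structure Prepared (s : State) (n : ℤ) : Prop where
  n_eq : s.loc .n = n
  le_size : n + 2 ≤ s.loc .size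
  size_le : s.loc .size ≤ 2 * n + 2
  S_root : s.mem .S 1 = 1
  LCP : 1 ≤ n → ∀ q, 0 ≤ s.mem .LCP q ∧ s.mem .LCP q < n
  cnt_zero : ∀ q, s.mem .cnt q = 0
  I_zero : ∀ q, s.mem .I q = 0
  r_nonneg : ∀ q, 0 ≤ s.mem .r q

/-- The beginning that both programs share, in continuation form so that it fits the nested `wp`
produced by `wp_seq`. -/
theorem prepare_spec {s : State} {n : ℤ} {ρ : ℕ} (hn : s.loc .n = n) (hn0 : 0 ≤ n)
    (hw : Terminated (s.mem .w) n) (h0 : ∀ A, A ≠ .w → ∀ q, s.mem A q = 0)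
    (hρ : 3 * n + 4 ≤ 2 ^ ρ) {Q : ℕ → ℕ → ℕ → State → Prop}
    (hQ : ∀ (t₁ t₂ t₃ : ℕ) s', ((t₁ : ℤ) + t₂ + t₃) ≤
      40100 * ((n + 1) * (Nat.log 2 (n + 1).toNat + 2)) + 200 * (n + 1) +
        (n + 3) * (20 * ρ + 150) + 20 → Prepared s' n → Q t₁ t₂ t₃ s') :
    wp (run .suffixArray [.var .n]) s fun t₁ s₁ => wp (run .lcpArray [.var .n]) s₁ fun t₂ s₂ =>
      wp initS s₂ fun t₃ s₃ => Q t₁ t₂ t₃ s₃ := by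
  refine wp.mono (Q := fun t s' => (t : ℤ) ≤
      40100 * ((n + 1) * (Nat.log 2 (n + 1).toNat + 2)) + 10 ∧
      ∃ f, Enumerates f n ∧ (∀ q, 1 ≤ q → q ≤ n → s'.mem .r q = f q ∧ s'.mem .p (f q) = q) ∧
        (∀ q, q < 1 ∨ n < q → s'.mem .r q = 0) ∧
        ∀ x, (∀ q, 1 ≤ q → q ≤ n → f q ≠ x) → s'.mem .p x = 0) ?_ ?_
  · refine wp_call ((suffixArray_spec (n := n) ?_ hn0 ?_ ?_ ?_).mono ?_)
    · simp [procs, hn]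
    · exact hw
    · exact h0 _ (by decide)
    · exact h0 _ (by decide)
    · rintro t s' - ⟨ht, h⟩
      exact ⟨by simp; omega, h⟩
  rintro t₁ s₁ hF₁ ⟨ht₁, f, hf, hrp, hr0, hp0⟩
  have en₁ : s₁.loc .n = n := by rw [hF₁.loc .n rfl, hn]
  -- Cell `0` of `f` is not copied to `r`, but `p` still has its initial value `0` at `f 0`, which
  -- is the right one.
  have pf : ∀ q, 0 ≤ q → q ≤ n → s₁.mem .p (f q) = q := by
    intro q a b
    by_cases c : q = 0
    · subst c
      refine hp0 _ fun q' a' b' e => ?_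
      have := hf.eq_of_eq (by omega) b' le_rfl b e
      omega
    · exact (hrp q (by omega) b).2
  refine wp.mono (Q := fun t s' => (t : ℤ) ≤ 200 * (n + 1) + 10 ∧
      (1 ≤ n → ∀ q, 0 ≤ s'.mem .LCP q ∧ s'.mem .LCP q < n)) ?_ ?_
  · refine wp_call ((lcpArray_spec (n := n) ?_ hn0 ?_ ?_ ?_).mono ?_)
    · simp [procs, en₁]
    · intro x y hx1 hx2 hy1 hy2 hx hy
      obtain ⟨q, a, b, rfl⟩ := hf.surj x hx1 (by omega)
      obtain ⟨q', a', b', rfl⟩ := hf.surj y hy1 (by omega)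
      simp only [pf q a b, pf q' a' b'] at hx hy
      rw [show q = q' by omega]
    · intro h1 hp1
      obtain ⟨q, a, b, e⟩ := hf.surj 1 le_rfl (by omega)
      have hq := pf q a b
      rw [e] at hq
      simp only [hq] at hp1 ⊢
      rw [(hrp (q + 1) (by omega) (by omega)).1]
      have h2 := hf.range (q + 1) (by omega) (by omega)
      have h3 : f (q + 1) ≠ 1 := fun h => by
        have := hf.eq_of_eq (by omega) (by omega) a b (h.trans e.symm)
        omega
      omega
    · intro q
      have : s₁.mem .LCP = s.mem .LCP := hF₁.mem .LCP rfl
      simp only [this]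
      exact h0 _ (by decide) q
    · rintro t s' - ⟨ht, h⟩
      exact ⟨by simp; omega, h⟩
  rintro t₂ s₂ hF₂ ⟨ht₂, hL⟩
  have en₂ : s₂.loc .n = n := by rw [hF₂.loc .n rfl, en₁]
  refine (initS_spec en₂ hn0 hρ).mono ?_
  rintro t₃ s₃ hF₃ ⟨ht₃, hz1, hz2, hS⟩
  refine hQ _ _ _ _ (by omega) ⟨?_, hz1, hz2, hS, ?_, ?_, ?_, ?_⟩
  · rw [hF₃.loc .n rfl, en₂]
  · rwa [hF₃.mem .LCP rfl]
  · rw [hF₃.mem .cnt rfl, hF₂.mem .cnt rfl, hF₁.mem .cnt rfl]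
    exact h0 _ (by decide)
  · rw [hF₃.mem .I rfl, hF₂.mem .I rfl, hF₁.mem .I rfl]
    exact h0 _ (by decide)
  · rw [hF₃.mem .r rfl, hF₂.mem .r rfl]
    intro q
    by_cases c : q < 1 ∨ n < q
    · rw [hr0 q c]
    · rw [(hrp q (by omega) (by omega)).1]
      have := hf.range q (by omega) (by omega)
      omega

/-- The search for the first index that is treated in the main loop. -/
theorem skipSmall_spec {s : State} {n : ℤ} {e f : Expr} (hn : s.loc .n = n) (hn0 : 0 ≤ n)
    (ht : s.loc .t = 0) (he : e.cost ≤ 10) (hf : f.cost ≤ 10) :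
    wp (.while (.and (.lt (.var .t) (.var .n)) (.lt e f)) (.assign .t (.var .t + 1))) s
      (fun t s' => (t : ℤ) ≤ 40 * n + 40 ∧ 0 ≤ s'.loc .t ∧ s'.loc .t ≤ n) := by
  refine (wp_while (fun B s' => 0 ≤ s'.loc .t ∧ s'.loc .t ≤ n ∧ B = (n - s'.loc .t) * 40 + 40)
      (B₀ := n * 40 + 40) (Post := fun s' => 0 ≤ s'.loc .t ∧ s'.loc .t ≤ n) ?_ ?_ ?_).mono ?_
  · simp [ht, hn0]
  · rintro B s₁ hF ⟨h1, h2, rfl⟩ hb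
    have en₁ : s₁.loc .n = n := by rw [hF.loc .n rfl, hn]
    simp [en₁] at hb
    simp
    omega
  · rintro B s₁ hF ⟨h1, h2, rfl⟩ hb
    exact ⟨by simp; omega, h1, h2⟩
  · rintro t s' - ⟨ht, h⟩
    exact ⟨by omega, h⟩

theorem report_spec {s : State} {b : BExpr} {l : Expr} (hb : b.cost ≤ 60) (hl : l.cost ≤ 10) :
    wp (when b (when leftMaximal (report l))) s (fun t _ => (t : ℤ) ≤ 200) := by
  simp only [when, leftMaximal, report, wp_ite, wp_seq, wp_store, wp_assign, wp_skip]
  simp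
  exact ⟨fun _ => ⟨fun _ => by omega, fun _ => by omega⟩, fun _ => by omega⟩

/-- `2 ^ (log (n + 1) + 1)` is at least `n + 2`, and four times that exceeds every leaf number. -/
theorem log_bound (n : ℤ) (hn0 : 0 ≤ n) :
    3 * n + 4 ≤ 2 ^ (Nat.log 2 (n + 1).toNat + 3) := by
  have h1 := Nat.lt_pow_succ_log_self (b := 2) (by omega) (n + 1).toNat
  have h2 : ((n + 1).toNat : ℤ) < 2 ^ (Nat.log 2 (n + 1).toNat + 1) := by exact_mod_cast h1
  rw [show Nat.log 2 (n + 1).toNat + 3 = Nat.log 2 (n + 1).toNat + 1 + 2 by ring, pow_add]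
  omega

theorem findmaxr_spec {s : State} {n : ℤ} (hn : s.loc .n = n) (hn0 : 0 ≤ n)
    (hw : Terminated (s.mem .w) n) (h0 : ∀ A, A ≠ .w → ∀ q, s.mem A q = 0) :
    wp findmaxr s (fun t _ => (t : ℤ) ≤
      60000 * ((n + 1) * (Nat.log 2 (n + 1).toNat + 2))) := by
  have hρ := log_bound n hn0
  obtain ⟨l, hl⟩ : ∃ l, l = Nat.log 2 (n + 1).toNat := ⟨_, rfl⟩
  rw [← hl] at hρ
  unfold findmaxr
  rw [wp_seq]
  simp only [wp_seq (c := run .lcpArray _), wp_seq (c := initS)]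
  refine prepare_spec hn hn0 hw h0 hρ ?_
  rintro t₁ t₂ t₃ s₃ ht hP
  rw [wp_seq]
  refine (sortLCP_spec hP.n_eq hn0 hP.LCP hP.cnt_zero hP.I_zero).mono ?_
  rintro t₄ s₄ hF₄ ⟨ht₄, hI⟩
  have en₄ : s₄.loc .n = n := by rw [hF₄.loc .n rfl, hP.n_eq]
  have ez₄ : s₄.loc .size = s₃.loc .size := hF₄.loc .size rfl
  have eS₄ : s₄.mem .S 1 = 1 := by rw [hF₄.mem .S rfl, hP.S_root]
  rw [wp_seq, wp_assign, wp_seq]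
  refine (skipSmall_spec (n := n) (by simp [en₄]) hn0 (by simp) (by simp) (by simp)).mono ?_
  rintro t₅ s₅ hF₅ ⟨ht₅, h1, h2⟩
  have en₅ : s₅.loc .n = n := by rw [hF₅.loc .n rfl]; simp [en₄]
  have ez₅ : s₅.loc .size = s₃.loc .size := by rw [hF₅.loc .size rfl]; simp [ez₄]
  have eS₅ : s₅.mem .S 1 = 1 := by rw [hF₅.mem .S rfl]; simp [eS₄]
  have eI₅ : s₅.mem .I = s₄.mem .I := by rw [hF₅.mem .I rfl]; simp
  have hz1 := hP.le_size
  have hz2 := hP.size_le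
  refine (wp_while (fun B s' => 0 ≤ s'.loc .t ∧ s'.loc .t ≤ n ∧ s'.mem .S 1 = 1 ∧
      B = (n - s'.loc .t) * (180 * (l + 3) + 500) + 10)
      (B₀ := (n - s₅.loc .t) * (180 * (l + 3) + 500) + 10)
      (Post := fun _ => True) ?_ ?_ ?_).mono ?_
  · exact ⟨h1, h2, eS₅, rfl⟩
  · rintro B s₆ hF ⟨ht0, htn, hS, rfl⟩ hb
    have en₆ : s₆.loc .n = n := by rw [hF.loc .n rfl, en₅]
    have ez₆ : s₆.loc .size = s₃.loc .size := by rw [hF.loc .size rfl, ez₅]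
    have eI₆ : s₆.mem .I = s₄.mem .I := by rw [hF.mem .I rfl, eI₅]
    simp [en₆] at hb
    have hi := hI (s₆.loc .t)
    rw [wp_seq, wp_assign, wp_seq]
    refine (updateS_spec (z := s₃.loc .size) (i := s₄.mem .I (s₆.loc .t)) (ρ := l + 3)
      ?_ ?_ ?_ hi.1 ?_ ?_).mono ?_
    · simp [ez₆]
    · simp [eI₆]
    · omega
    · omega
    · simp [hS]
    rintro t₇ s₇ hF₇ ⟨ht₇, hS₇⟩
    have et₇ : s₇.loc .t = s₆.loc .t := by rw [hF₇.loc .t rfl]; simp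
    rw [wp_seq]
    refine (report_spec (by simp) (by simp)).mono ?_
    rintro t₈ s₈ hF₈ ht₈
    have et₈ : s₈.loc .t = s₆.loc .t := by rw [hF₈.loc .t rfl, et₇]
    have eS₈ : s₈.mem .S 1 = 1 := by rw [hF₈.mem .S rfl, hS₇]
    rw [wp_assign]
    have hB : 0 ≤ (n - (s₆.loc .t + 1)) * (180 * ((l : ℤ) + 3) + 500) :=
      mul_nonneg (by omega) (by omega)
    refine ⟨(n - (s₆.loc .t + 1)) * (180 * (l + 3) + 500) + 10, by omega, ?_, ?_, ?_, eS₈, ?_⟩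
    · simp
      rw [show n - s₆.loc .t = n - (s₆.loc .t + 1) + 1 by ring, add_mul]
      push_cast at ht₇
      omega
    · simp [et₈]; omega
    · simp [et₈]; omega
    · simp [et₈]
  · rintro B s₆ hF ⟨ht0, htn, hS, rfl⟩ hb
    have hB : 0 ≤ (n - s₆.loc .t) * (180 * ((l : ℤ) + 3) + 500) :=
      mul_nonneg (by omega) (by omega)
    exact ⟨by simp; omega, trivial⟩
  rintro t₆ s₆ - ⟨ht₆, -⟩
  have hB : (n - s₅.loc .t) * (180 * ((l : ℤ) + 3) + 500) ≤ n * (180 * ((l : ℤ) + 3) + 500) :=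
    mul_le_mul_of_nonneg_right (by omega) (by omega)
  rw [← hl] at ht ⊢
  have hnl : 0 ≤ n * (l : ℤ) := by positivity
  have hl0 : 0 ≤ (l : ℤ) := by positivity
  push_cast at ht ⊢
  simp
  nlinarith

/-- The variable `curLCP` never decreases, and the test `r i + curLCP ≤ n` with `r i ≥ 0` keeps it
at most `n + 1`. So the extension loops take linear time in total, paid from the term `50 * (n + 1 -
curLCP)`; the rest of a round is logarithmic. -/
theorem findmaxrMem_spec {s : State} {n : ℤ} (hn : s.loc .n = n) (hn0 : 0 ≤ n)
    (hw : Terminated (s.mem .w) n) (h0 : ∀ A, A ≠ .w → ∀ q, s.mem A q = 0) :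
    wp findmaxrMem s (fun t _ => (t : ℤ) ≤
      60000 * ((n + 1) * (Nat.log 2 (n + 1).toNat + 2))) := by
  have hρ := log_bound n hn0
  obtain ⟨l, hl⟩ : ∃ l, l = Nat.log 2 (n + 1).toNat := ⟨_, rfl⟩
  rw [← hl] at hρ
  unfold findmaxrMem
  rw [wp_seq]
  simp only [wp_seq (c := run .lcpArray _), wp_seq (c := initS)]
  refine prepare_spec hn hn0 hw h0 hρ ?_
  rintro t₁ t₂ t₃ s₃ ht hP
  rw [wp_seq]
  refine (rankLCP_spec hP.n_eq hn0 hP.LCP hP.cnt_zero).mono ?_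
  rintro t₄ s₄ hF₄ ⟨ht₄, hIr, hIi⟩
  have en₄ : s₄.loc .n = n := by rw [hF₄.loc .n rfl, hP.n_eq]
  have ez₄ : s₄.loc .size = s₃.loc .size := hF₄.loc .size rfl
  have eS₄ : s₄.mem .S 1 = 1 := by rw [hF₄.mem .S rfl, hP.S_root]
  have er₄ : s₄.mem .r = s₃.mem .r := hF₄.mem .r rfl
  rw [wp_seq, wp_assign, wp_seq]
  refine (invertInPlace_spec (s := s₄.setVar .t (Expr.eval s₄ 0)) (n := n) (by simp [en₄]) hn0 hIr hIi).mono ?_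
  rintro t₅ s₅ hF₅ ⟨ht₅, hI⟩
  have en₅ : s₅.loc .n = n := by rw [hF₅.loc .n rfl]; simp [en₄]
  have et₅ : s₅.loc .t = 0 := by rw [hF₅.loc .t rfl]; simp
  have ez₅ : s₅.loc .size = s₃.loc .size := by rw [hF₅.loc .size rfl]; simp [ez₄]
  have eS₅ : s₅.mem .S 1 = 1 := by rw [hF₅.mem .S rfl]; simp [eS₄]
  have er₅ : s₅.mem .r = s₃.mem .r := by rw [hF₅.mem .r rfl]; simp [er₄]
  rw [wp_seq]
  refine (skipSmall_spec (n := n) en₅ hn0 et₅ (by simp) (by simp)).mono ?_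
  rintro t₆ s₆ hF₆ ⟨ht₆, h1, h2⟩
  have en₆ : s₆.loc .n = n := by rw [hF₆.loc .n rfl, en₅]
  have ez₆ : s₆.loc .size = s₃.loc .size := by rw [hF₆.loc .size rfl, ez₅]
  have eS₆ : s₆.mem .S 1 = 1 := by rw [hF₆.mem .S rfl, eS₅]
  have er₆ : s₆.mem .r = s₃.mem .r := by rw [hF₆.mem .r rfl, er₅]
  have eI₆ : s₆.mem .I = s₅.mem .I := hF₆.mem .I rfl
  have hz1 := hP.le_size
  have hz2 := hP.size_le
  rw [wp_seq, wp_assign, wp_seq, wp_assign, wp_seq, wp_assign]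
  refine (wp_while (fun B s' => 0 ≤ s'.loc .t ∧ s'.loc .t ≤ n ∧ s'.mem .S 1 = 1 ∧
      s'.loc .curLCP ≤ n + 1 ∧
      B = (n - s'.loc .t) * (180 * (l + 3) + 600) + 50 * (n + 1 - s'.loc .curLCP) + 10)
      (B₀ := (n - s₆.loc .t) * (180 * (l + 3) + 600) + 50 * (n + 1) + 10)
      (Post := fun _ => True) ?_ ?_ ?_).mono ?_
  · simp
    exact ⟨h1, h2, eS₆, by omega⟩
  · rintro B s₇ hF ⟨ht0, htn, hS, hcur, rfl⟩ hb
    have en₇ : s₇.loc .n = n := by rw [hF.loc .n rfl]; simp [en₆]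
    have ez₇ : s₇.loc .size = s₃.loc .size := by rw [hF.loc .size rfl]; simp [ez₆]
    have eI₇ : s₇.mem .I = s₅.mem .I := by rw [hF.mem .I rfl]; simp [eI₆]
    have er₇ : s₇.mem .r = s₃.mem .r := by rw [hF.mem .r rfl]; simp [er₆]
    simp [en₇] at hb
    have hi := hI (s₇.loc .t + 1) (by omega) (by omega)
    rw [wp_seq, wp_assign, wp_seq]
    refine (wp_while_amortized (fun B s' => s'.loc .curLCP ≤ n + 1 ∧
      B = 50 * (n + 1 - s'.loc .curLCP)) (B₀ := 50 * (n + 1 - s₇.loc .curLCP))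
      (Post := fun B s' => s'.loc .curLCP ≤ n + 1 ∧
        B = 50 * (n + 1 - s'.loc .curLCP) - 30) ?_ ?_ ?_).mono ?_
    · simp
      exact hcur
    · rintro B s₈ hF₈ ⟨hc, rfl⟩ hb₈
      have en₈ : s₈.loc .n = n := by rw [hF₈.loc .n rfl]; simp [en₇]
      have er₈ : s₈.mem .r = s₃.mem .r := by rw [hF₈.mem .r rfl]; simp [er₇]
      simp [en₈, er₈] at hb₈
      have := hP.r_nonneg (s₈.loc .i)
      simp
      omega
    · rintro B s₈ hF₈ ⟨hc, rfl⟩ hb₈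
      refine ⟨hc, ?_⟩
      simp
    rintro t₈ s₈ hF₈ ⟨B, ht₈, hc, rfl⟩
    have ez₈ : s₈.loc .size = s₃.loc .size := by rw [hF₈.loc .size rfl]; simp [ez₇]
    have ei₈ : s₈.loc .i = s₅.mem .I (s₇.loc .t + 1) - 1 := by
      rw [hF₈.loc .i rfl]; simp [eI₇]
    have et₈ : s₈.loc .t = s₇.loc .t := by rw [hF₈.loc .t rfl]; simp
    have eS₈ : s₈.mem .S 1 = 1 := by rw [hF₈.mem .S rfl]; simp [hS]
    rw [wp_seq]
    refine (updateS_spec (ρ := l + 3) ez₈ ei₈ (by omega) (by omega) (by omega) eS₈).mono ?_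
    rintro t₉ s₉ hF₉ ⟨ht₉, hS₉⟩
    have et₉ : s₉.loc .t = s₇.loc .t := by rw [hF₉.loc .t rfl, et₈]
    have ec₉ : s₉.loc .curLCP = s₈.loc .curLCP := hF₉.loc .curLCP rfl
    rw [wp_seq]
    refine (report_spec (by simp) (by simp)).mono ?_
    rintro t₁₀ s₁₀ hF₁₀ ht₁₀
    have et₁₀ : s₁₀.loc .t = s₇.loc .t := by rw [hF₁₀.loc .t rfl, et₉]
    have ec₁₀ : s₁₀.loc .curLCP = s₈.loc .curLCP := by rw [hF₁₀.loc .curLCP rfl, ec₉]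
    have eS₁₀ : s₁₀.mem .S 1 = 1 := by rw [hF₁₀.mem .S rfl, hS₉]
    simp only [wp_seq, wp_assign]
    have hB : 0 ≤ (n - (s₇.loc .t + 1)) * (180 * ((l : ℤ) + 3) + 600) :=
      mul_nonneg (by omega) (by omega)
    refine ⟨(n - (s₇.loc .t + 1)) * (180 * (l + 3) + 600) +
      50 * (n + 1 - s₈.loc .curLCP) + 10, by omega, ?_, ?_, ?_, eS₁₀, ?_, ?_⟩
    · simp
      rw [show n - s₇.loc .t = n - (s₇.loc .t + 1) + 1 by ring, add_mul]
      push_cast at ht₉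
      omega
    · simp [et₁₀]; omega
    · simp [et₁₀]; omega
    · simp [ec₁₀, hc]
    · simp [et₁₀, ec₁₀]
  · rintro B s₇ hF ⟨ht0, htn, hS, hcur, rfl⟩ hb
    have hB : 0 ≤ (n - s₇.loc .t) * (180 * ((l : ℤ) + 3) + 600) :=
      mul_nonneg (by omega) (by omega)
    exact ⟨by simp; omega, trivial⟩
  rintro t₇ s₇ - ⟨ht₇, -⟩
  have hB : (n - s₆.loc .t) * (180 * ((l : ℤ) + 3) + 600) ≤ n * (180 * ((l : ℤ) + 3) + 600) :=
    mul_le_mul_of_nonneg_right (by omega) (by omega)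
  rw [← hl] at ht ⊢
  have hnl : 0 ≤ n * (l : ℤ) := by positivity
  have hl0 : 0 ≤ (l : ℤ) := by positivity
  push_cast at ht ⊢
  simp
  nlinarith

/-! ### The encoded input, and the passage to natural logarithms. -/

theorem terminated_input {σ : ℕ} (w : List (Fin σ)) (ml : ℕ) :
    Terminated ((input w ml).mem .w) w.length := by
  constructor
  · intro q h1 h2
    have h3 : (q - 1).toNat < w.length := by omega
    simp only [input, if_pos h1, List.getElem?_eq_getElem h3, Option.elim_some]
    omega
  · simp [input]

/-- From `n + 1 ≤ n ^ 2` and `log 2 > 2/3`, both the binary logarithm of `n + 1` and the constant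
`2` are at most `3 log n`; the factor `n + 1` is at most `2n`. All this uses `n ≥ 2`. -/
theorem log_two_le (n : ℕ) (hn : 2 ≤ n) :
    ((n + 1) * (Nat.log 2 (n + 1) + 2) : ℝ) ≤ 12 * (n * Real.log n) := by
  have h2 : (2 : ℝ) ≤ n := by exact_mod_cast hn
  have hlog2 := Real.log_two_gt_d9
  have hle : Real.log 2 ≤ Real.log n := Real.log_le_log (by norm_num) h2
  have h1 : (Nat.log 2 (n + 1) : ℝ) * Real.log 2 ≤ 2 * Real.log n := by
    rw [← Real.log_pow, show (2 : ℝ) * Real.log n = Real.log ((n : ℝ) ^ 2) by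
      rw [Real.log_pow]; norm_num]
    refine Real.log_le_log (by positivity) ?_
    have h3 : ((2 ^ Nat.log 2 (n + 1) : ℕ) : ℝ) ≤ ((n + 1 : ℕ) : ℝ) :=
      Nat.cast_le.2 (Nat.pow_log_le_self 2 (by omega))
    push_cast at h3
    nlinarith
  have h4 : (Nat.log 2 (n + 1) : ℝ) ≤ 3 * Real.log n := by
    have h5 : (Nat.log 2 (n + 1) : ℝ) * (2 / 3) ≤ (Nat.log 2 (n + 1) : ℝ) * Real.log 2 :=
      mul_le_mul_of_nonneg_left (by linarith) (by positivity)
    linarith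
  have h6 : (Nat.log 2 (n + 1) + 2 : ℝ) ≤ 6 * Real.log n := by linarith
  calc ((n + 1) * (Nat.log 2 (n + 1) + 2) : ℝ) ≤ (2 * n) * (6 * Real.log n) :=
        mul_le_mul (by linarith) h6 (by positivity) (by positivity)
    _ = 12 * (n * Real.log n) := by ring

end FindMaxR

theorem theorem3p8 (main : FindMaxR.Cmd)
    (hmain : main = FindMaxR.findmaxr ∨ main = FindMaxR.findmaxrMem) :
    ∃ C : ℝ, ∀ (σ : ℕ) (w : List (Fin σ)) (ml : ℕ), 1 ≤ ml →
      ∃ (t : ℕ) (s : FindMaxR.State),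
        FindMaxR.Exec FindMaxR.procs main (FindMaxR.input w ml) t s ∧
        (2 ≤ w.length → (t : ℝ) ≤ C * (w.length * Real.log w.length)) := by
  -- The factor `60000` bounds both programs in terms of the binary logarithm; the `12` comes from
  -- `log_two_le`.
  refine ⟨60000 * 12, fun σ w ml _ => ?_⟩
  have h : FindMaxR.wp main (FindMaxR.input w ml) (fun t _ => (t : ℤ) ≤
      60000 * ((w.length + 1) * (Nat.log 2 ((w.length : ℤ) + 1).toNat + 2))) := by
    have h0 : ∀ A, A ≠ FindMaxR.Arr.w → ∀ q, (FindMaxR.input w ml).mem A q = 0 := by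
      intro A hA q
      cases A <;> first | rfl | exact absurd rfl hA
    rcases hmain with rfl | rfl
    · exact FindMaxR.findmaxr_spec (by simp [FindMaxR.input]) (by omega)
        (FindMaxR.terminated_input w ml) h0
    · exact FindMaxR.findmaxrMem_spec (by simp [FindMaxR.input]) (by omega)
        (FindMaxR.terminated_input w ml) h0
  obtain ⟨t, s, he, ht⟩ := h
  refine ⟨t, s, he, fun hn => ?_⟩
  rw [show ((w.length : ℤ) + 1).toNat = w.length + 1 by omega] at ht
  have ht' : (t : ℝ) ≤ 60000 * ((w.length + 1) * (Nat.log 2 (w.length + 1) + 2)) := by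
    exact_mod_cast ht
  have := FindMaxR.log_two_le w.length hn
  linarith
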